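/- Let $\beta\in(1,2)$ be an algebraic integer none of whose Galois conjugates has absolute value $1$, let $\varphi\neq\beta$ be a real Galois conjugate of $\beta$ with $|\varphi|>1$ (the free direction), and assume that $\beta$ has at least one Galois conjugate of absolute value less than $1$. Call the conjugates $z\ne\varphi$ with $|z|>1$ expanding and those with $|z|<1$ contracting, and let $\mathbb K_e$ (respectively $\mathbb K_c$) be the product of one copy of $\mathbb R$ for each real expanding (contracting) conjugate and one copy of $\mathbb C$ for each pair of non-real ones. Let $\Pi=\prod_{z\text{ expanding}}|z|$, both members of each non-real pair being counted. Put $\bar{\mathbb K}=\mathbb K_e\times\mathbb K_c\times\mathbb R$, with projections $\pi_e,\pi_c,\pi_{\rm free}$ and $\pi_D=(\pi_e,\pi_c)$, and let $\bar\beta\in\bar{\mathbb K}$ be the vector of conjugates, powers being taken coordinatewise. Further notation: * $T_i(x)=\beta x+i$ (coordinatewise) on $\mathbb K_e$; $\nu_{\underline\beta}$ is the unique Borel probability measure on $\mathbb K_e$ with $\nu_{\underline\beta}(A)=\frac12\bigl(\nu_{\underline\beta}(T_0A)+\nu_{\underline\beta}(T_{-1}A)\bigr)$ for all Borel $A$.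 * $I=\prod I_z\subset\mathbb K_e$, where $I_z$ is the closed ball about $0$ of radius $\frac1{z-1}$ if $z>1$ is real and of radius $\frac2{|z|-1}$ otherwise; $g=\chi_I\circ T_1+\chi_I\circ T_{-1}+2\chi_I\circ T_0$. * $\mathcal R\subset\mathbb K_c$ is the attractor of the contractions $x\mapsto\beta x+i$, $i\in\{-1,0,1\}$; $D=I\times\mathcal R$. * $\bar Z=\{\sum_{k<\deg\beta}a_k\bar\beta^k:a_k\in\mathbb Z\}$, $S=\{x:\pi_e(x)\in I\}$, $\bar X=\{\sum_{k<n}a_k\bar\beta^k:n\ge0,\ a_k\in\{-1,0,1\}\}\cap S$. * For $x\in S$, $\bar\mu_n(x)$ is the number of pairs $(a,b)\in\{0,1\}^n\times\{0,1\}^n$ with $\sum_{k<n}(a_k-b_k)\bar\beta^k=x$; $\lambda=\lim_n\bar\mu_n(0)^{1/n}$ and $\bar\mu(x)=\lim_n\lambda^{-n}\bar\mu_n(x)$. Assume that $\lambda<4/\Pi$ and that $\bar X=\bar Z\cap\pi_c^{-1}(\operatorname{int}\mathcal R)\cap S$ (Condition 1). Then $\lambda>1$, for every $x\in\bar X$ the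 limit $\bar\mu(x)$ exists and is positive, and the following holds. There are a domain exchange transformation $T:D\to D$ (an injective map of the compact set $D$ with a finite measurable partition $D=D_1\sqcup\dots\sqcup D_N$ on each piece of which $T$ is a translation), vectors $u_1,\dots,u_N\in\bar{\mathbb K}$ with $T(x)=x+\pi_D(u_i)$ for $x\in D_i$, and functions $\bar f_1,\dots,\bar f_N:\mathcal R\to\mathbb R$ such that, writing $s(x)=i$ for $x\in D_i$ and $f(x)=\exp(\bar f_{s(x)}(\pi_c(x)))$: 1. for $x\in D_i\cap(I\times\operatorname{int}\mathcal R)$, $u_i$ is the element $u$ of $\bar Z$ with least positive free coordinate for which $x+\pi_D(u)\in I\times\operatorname{int}\mathcal R$; 2. $\bar f_i(\pi_c(x))=\log\bar\mu(x+u_i)-\log\bar\mu(x)$ whenever $x\in\bar X$ and $\pi_D(x)\in D_i$; 3. if $\operatorname{succ}(x)$ denotes the element of $\bar X$ with the least free coordinate exceeding $\pi_{\rm free}(x)$, then the iterates $\operatorname{succ}^k(0)$ exist, $\pi_D(\operatorname{succ}^k(0))=T^k(0)$, and $\bar\mu(\operatorname{succ}^k(0))=\bar\mu(0)\prod_{i<k}f(T^i(0))$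 for all $k\ge0$; 4. for every $n\ge0$ there is a greatest $m(n)$ with $\pi_{\rm free}(\operatorname{succ}^{m(n)}(0))\le\sum_{i=0}^{n-1}|\varphi|^i$; and if the measures $$w_n=\sum_{k=0}^{m(n)}f(0)f(T(0))\cdots f(T^{k-1}(0))\,\delta_{T^k(0)}$$ on $D$, with total mass $|w_n|$ and projection $\pi_ew_n$ to $I$, satisfy, for some constant $C>0$, $$\sum_{n=1}^{M}\log\Bigl(\frac{\Pi}{4}\,\frac1{|w_n|}\int g\,d\pi_ew_n\Bigr)\le\log C\qquad\text{for all }M\ge1,$$ then $\nu_{\underline\beta}$ is absolutely continuous with respect to Lebesgue measure on $\mathbb K_e$. -/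

import Mathlib

noncomputable section

open MeasureTheory Filter Topology
open scoped Classical

namespace BernoulliConv

/-! ### Galois conjugates -/

/-- The Galois conjugates of `β` (all complex roots of its minimal polynomial). -/
def conjugates (β : ℝ) : Finset ℂ := ((minpoly ℚ β).aroots ℂ).toFinset

/-- A hyperbolic algebraic integer: no Galois conjugate has absolute value one. -/
def IsHyperbolicInteger (β : ℝ) : Prop :=
  IsIntegral ℤ β ∧ ∀ z ∈ conjugates β, ‖z‖ ≠ 1

/-- The conjugates of modulus larger than one, apart from the real one `φ` that is singled out as
the free direction. -/
def expanding (β φ : ℝ) : Finset ℂ := (conjugates β).filter fun z => 1 < ‖z‖ ∧ z ≠ (φ : ℂ)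

/-- The conjugates of modulus smaller than one. -/
def contracting (β : ℝ) : Finset ℂ := (conjugates β).filter fun z => ‖z‖ < 1

/-- The product of the moduli of the expanding conjugates; both members of a pair of complex
conjugates are counted, so this is the factor by which `x ↦ β x` multiplies Lebesgue measure on
the expanding space. -/
def expandingProduct (β φ : ℝ) : ℝ := ∏ z ∈ expanding β φ, ‖z‖

/-! ### Coordinate spaces -/

/-- The real members of a set of conjugates. -/
def realPart (J : Finset ℂ) : Finset ℂ := J.filter fun z => z.im = 0

/-- One representative of each pair of non-real complex conjugates. -/
def complexPart (J : Finset ℂ) : Finset ℂ := J.filter fun z => 0 < z.im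

/-- The product of one copy of `ℝ` for each real conjugate in `J` and one copy of `ℂ` for each
pair of non-real conjugates in `J`. It is a commutative ring with coordinatewise operations. -/
abbrev Coord (J : Finset ℂ) : Type := (realPart J → ℝ) × (complexPart J → ℂ)

/-- The vector of the conjugates in `J`. -/
def conjVec (J : Finset ℂ) : Coord J := (fun z => z.1.re, fun z => z.1)

/-- The expanding space. -/
abbrev Ke (β φ : ℝ) : Type := Coord (expanding β φ)

/-- The contracting space. -/
abbrev Kc (β : ℝ) : Type := Coord (contracting β)

/-- The full space, with coordinates ordered as `((expanding, contracting), free)`. Thus for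
`x : Kbar β φ` the projections to the expanding, contracting and free directions are `x.1.1`,
`x.1.2` and `x.2`, and forgetting the free direction is `x.1`. -/
abbrev Kbar (β φ : ℝ) : Type := (Ke β φ × Kc β) × ℝ

/-- The vector of all conjugates, in the full space. -/
def betaBar (β φ : ℝ) : Kbar β φ := ((conjVec (expanding β φ), conjVec (contracting β)), φ)

/-- The map `x ↦ β x + i` on the expanding space. -/
def affMap (β φ : ℝ) (i : ℤ) (x : Ke β φ) : Ke β φ := conjVec (expanding β φ) * x + (i : Ke β φ)

/-! ### The self-affine measure -/

/-- `ν` is a probability measure with `ν = (ν ∘ T₀ + ν ∘ T₋₁) / 2`. -/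
def IsSelfAffineMeasure (β φ : ℝ) (ν : Measure (Ke β φ)) : Prop :=
  IsProbabilityMeasure ν ∧ ∀ A : Set (Ke β φ), MeasurableSet A →
    ν A = (ν (affMap β φ 0 '' A) + ν (affMap β φ (-1) '' A)) / 2

/-- The self-affine measure exists, is unique, and is absolutely continuous with respect to
Lebesgue measure. -/
def SelfAffineMeasureIsAbsolutelyContinuous (β φ : ℝ) : Prop :=
  ∃ ν : Measure (Ke β φ), IsSelfAffineMeasure β φ ν ∧
    (∀ ν' : Measure (Ke β φ), IsSelfAffineMeasure β φ ν' → ν' = ν) ∧ ν ≪ volume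

/-! ### The region `I`, the step function `g`, and the attractor -/

/-- Half the size of the factor of `I` that belongs to the conjugate `z`. -/
def radius (z : ℂ) : ℝ := if z.im = 0 ∧ 0 < z.re then 1 / (‖z‖ - 1) else 2 / (‖z‖ - 1)

/-- The region `I` in the expanding space. -/
def region (β φ : ℝ) : Set (Ke β φ) :=
  {x | (∀ z, |x.1 z| ≤ radius z.1) ∧ (∀ z, ‖x.2 z‖ ≤ radius z.1)}

/-- The step function `g = χ_I ∘ T₁ + χ_I ∘ T₋₁ + 2 χ_I ∘ T₀`. -/
def stepFun (β φ : ℝ) (x : Ke β φ) : ℝ :=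
  (region β φ).indicator 1 (affMap β φ 1 x) + (region β φ).indicator 1 (affMap β φ (-1) x)
    + 2 * (region β φ).indicator 1 (affMap β φ 0 x)

/-- The attractor `𝓡` of the contractions `x ↦ β x + i`, `i ∈ {-1, 0, 1}`, of the contracting
space: the set of all sums `∑ aₖ βᵏ` with digits `aₖ ∈ {-1, 0, 1}`. -/
def attractor (β : ℝ) : Set (Kc β) :=
  {x | ∃ a : ℕ → ℤ, (∀ k, a k ∈ ({-1, 0, 1} : Set ℤ)) ∧
    x = ∑' k, (a k : Kc β) * conjVec (contracting β) ^ k}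

/-- The domain `D = I × 𝓡`. -/
def domain (β φ : ℝ) : Set (Ke β φ × Kc β) := region β φ ×ˢ attractor β

/-- `I × int 𝓡`. -/
def openDomain (β φ : ℝ) : Set (Ke β φ × Kc β) := region β φ ×ˢ interior (attractor β)

/-! ### The lattice, the spectrum and the limit measure -/

/-- The lattice of integer combinations of `1, β, …, β^(deg β - 1)` in the full space. -/
def lattice (β φ : ℝ) : Set (Kbar β φ) :=
  {x | ∃ a : Fin (minpoly ℚ β).natDegree → ℤ,
    x = ∑ i, (a i : Kbar β φ) * betaBar β φ ^ (i : ℕ)}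

/-- The strip of points whose expanding coordinates lie in `I`. -/
def strip (β φ : ℝ) : Set (Kbar β φ) := {x | x.1.1 ∈ region β φ}

/-- The points of the strip of the form `∑_{i < n} aᵢ βⁱ`, with `aᵢ ∈ {-1, 0, 1}`. -/
def spectrumSet (β φ : ℝ) : Set (Kbar β φ) :=
  {x | ∃ (n : ℕ) (a : Fin n → ℤ), (∀ i, a i ∈ ({-1, 0, 1} : Set ℤ)) ∧
    x = ∑ i, (a i : Kbar β φ) * betaBar β φ ^ (i : ℕ)} ∩ strip β φ

/-- The number of pairs of words `a, b ∈ {0, 1}ⁿ` with `∑ (aᵢ - bᵢ) βⁱ = x`, for `x` in the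
strip; zero outside the strip. -/
def pairCount (β φ : ℝ) (n : ℕ) (x : Kbar β φ) : ℕ :=
  if x ∈ strip β φ then
    (Finset.univ.filter fun p : (Fin n → Fin 2) × (Fin n → Fin 2) =>
      ∑ i, (((p.1 i : ℕ) : Kbar β φ) - ((p.2 i : ℕ) : Kbar β φ)) * betaBar β φ ^ (i : ℕ) = x).card
  else 0

/-- The exponential growth rate `λ` of the number of pairs of words with the same value. -/
def growthRate (β φ : ℝ) : ℝ :=
  limUnder atTop fun n : ℕ => (pairCount β φ n 0 : ℝ) ^ (1 / (n : ℝ))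

/-- The mass of a point for the limit measure: the limit of `λ⁻ⁿ` times the number of pairs. -/
def limitMass (β φ : ℝ) (x : Kbar β φ) : ℝ :=
  limUnder atTop fun n : ℕ => (pairCount β φ n x : ℝ) / growthRate β φ ^ n

/-- The spectrum is the cut and project set with window `I × int 𝓡`. -/
def CutAndProjectCondition (β φ : ℝ) : Prop :=
  spectrumSet β φ =
    lattice β φ ∩ {x | x.1.2 ∈ interior (attractor β)} ∩ strip β φ

/-! ### Domain exchange -/

/-- `T : E → E` is a domain exchange transformation of the compact set `E`, with pieces `P i`. -/
def IsDomainExchange {V : Type*} [TopologicalSpace V] [MeasurableSpace V] [Add V]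
    (E : Set V) (T : V → V) {N : ℕ} (P : Fin N → Set V) : Prop :=
  IsCompact E ∧ (∀ i, MeasurableSet (P i)) ∧ Pairwise (fun i j => Disjoint (P i) (P j)) ∧
    (⋃ i, P i) = E ∧ Set.MapsTo T E E ∧ Set.InjOn T E ∧ ∀ i, ∃ t : V, ∀ x ∈ P i, T x = x + t

/-- `u` is the lattice vector with the least positive free coordinate that carries `x` back into
`I × int 𝓡`. -/
def IsFirstReturn (β φ : ℝ) (x : Ke β φ × Kc β) (u : Kbar β φ) : Prop :=
  (u ∈ lattice β φ ∧ 0 < u.2 ∧ x + u.1 ∈ openDomain β φ) ∧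
    ∀ v ∈ lattice β φ, 0 < v.2 → x + v.1 ∈ openDomain β φ → u.2 ≤ v.2

/-- `y` is the successor of `x` in the spectrum, ordered by the free coordinate. -/
def IsSuccessor (β φ : ℝ) (x y : Kbar β φ) : Prop :=
  (y ∈ spectrumSet β φ ∧ x.2 < y.2) ∧ ∀ z ∈ spectrumSet β φ, x.2 < z.2 → y.2 ≤ z.2

/-- The measure `∑_{k = 0}^{m} f(0) f(T 0) ⋯ f(T^{k-1} 0) δ_{T^k 0}`. -/
def orbitMeasure {V : Type*} [MeasurableSpace V] [Zero V] (T : V → V) (f : V → ℝ) (m : ℕ) :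
    Measure V :=
  ∑ k ∈ Finset.range (m + 1),
    ENNReal.ofReal (∏ i ∈ Finset.range k, f (T^[i] 0)) • Measure.dirac (T^[k] 0)

/-- The average of `g` for the normalized projection to `I` of a measure on `D`, divided by
its average `4 / |β₁ ⋯ β_d|` for normalized Lebesgue measure. -/
def averageRatio (β φ : ℝ) (w : Measure (Ke β φ × Kc β)) : ℝ :=
  expandingProduct β φ / 4 * (1 / w.real Set.univ * ∫ y, stepFun β φ y ∂(w.map Prod.fst))

end BernoulliConv

end

/-! The measure ν is the law of ∑ aₖ β⁻⁽ᵏ⁺¹⁾ with independent fair digits. Its absolute continuity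
is an L² statement: it suffices that the number of pairs of words of length n whose values differ by
an element of I (`closePairs`) is O((4/Π)ⁿ), the order for equidistributed values
(`Admissible.absolutelyContinuous`). The same packing estimate, `card_ball_subset_le`, shows that
this number is always at least c(4/Π)ⁿ (`Admissible.exists_le_closePairs`).

Close pairs are controlled by the limit measure μ. Differences of words are lattice points with
bounded contracting coordinate, so only finitely many have bounded expanding and free coordinates.
Hence the number of coincidences is multiplicative up to constants and grows like λⁿ. The normalized
counts evolve under a positive operator that acts in effect on a finite set, and a contraction
argument (`exists_tendsto_of_positive`) gives their convergence to μ, with λμ(y) = ∑ μ(β⁻¹(y - i +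
j)) over digits i, j. Concatenation of words bounds the count at x by λⁿμ(x)/μ(0), so `closePairs`
is O(λⁿpₙ), where pₙ is the μ-mass of the points of the spectrum with free coordinate between 0 and
sₙ = ∑_{i<n} |φ|ⁱ (`Admissible.closePairs_mul_le`).

Summing the equation for μ over a slab gives pₙ₊₁ ≤ q rₙ pₙ + O(1), where q = 4/(Πλ) and rₙ is Π/4
times the μ-average of g over the same part of the spectrum. Since λ < 4/Π means q > 1, the lower
bound pₙ ≥ c qⁿ makes the additive errors summable relative to pₙ. A bound on ∑ log rₙ therefore
gives pₙ = O(qⁿ) (`exists_le_mul_pow_of_recursion`), and `closePairs` is O((4/Π)ⁿ).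

The domain exchange computes rₙ dynamically. Under Condition 1 the spectrum is a cut and project
set, so passing to the successor is translation by a first return vector that depends only on the
position in D; density of the projected lattice leaves finitely many such vectors. A lattice point
is determined by its contracting coordinate, so the increment of log μ is a function of that
coordinate, and the products of f along the orbit of 0 telescope to μ(succᵏ(0))/μ(0). Thus rₙ is the
quantity inside the logarithm of the criterion. -/

open MeasureTheory Filter Topology
open scoped Classical

namespace BernoulliConv

/-! ### Words over `{0, 1}` and their values -/

section Words

variable {R : Type*} [CommRing R]

/-- The value `∑ aᵢ bⁱ` of a binary word. -/
def wordSum (b : R) {n : ℕ} (a : Fin n → Fin 2) : R := ∑ i, ((a i : ℕ) : R) * b ^ (i : ℕ)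

/-- The number of pairs of words of length `n` whose values differ by `x`. -/
noncomputable def diffCount (b : R) (n : ℕ) (x : R) : ℕ :=
  (Finset.univ.filter fun p : (Fin n → Fin 2) × (Fin n → Fin 2) =>
    wordSum b p.1 - wordSum b p.2 = x).card

theorem diffCount_eq_sum (b : R) (n : ℕ) (x : R) :
    diffCount b n x = ∑ a : Fin n → Fin 2, ∑ a' : Fin n → Fin 2,
      if wordSum b a - wordSum b a' = x then 1 else 0 := by
  rw [diffCount, Finset.card_filter, Fintype.sum_prod_type]

theorem sum_words_succ {M : Type*} [AddCommMonoid M] {n : ℕ} (F : (Fin (n + 1) → Fin 2) → M) :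
    ∑ a, F a = ∑ i : Fin 2, ∑ a : Fin n → Fin 2, F (Fin.cons i a) := by
  rw [← Fintype.sum_prod_type', ← (Fin.consEquiv fun _ : Fin (n + 1) => Fin 2).sum_comp]
  rfl

theorem sum_words_add {M : Type*} [AddCommMonoid M] {m n : ℕ} (F : (Fin (m + n) → Fin 2) → M) :
    ∑ a, F a = ∑ a : Fin m → Fin 2, ∑ a' : Fin n → Fin 2, F (Fin.append a a') := by
  rw [← Fintype.sum_prod_type', ← (Fin.appendEquiv m n).sum_comp]
  rfl

theorem wordSum_cons (b : R) {n : ℕ} (i : Fin 2) (a : Fin n → Fin 2) :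
    wordSum b (Fin.cons i a : Fin (n + 1) → Fin 2) = ((i : ℕ) : R) + b * wordSum b a := by
  simp only [wordSum, Fin.sum_univ_succ, Fin.cons_zero, Fin.cons_succ, Fin.val_zero, pow_zero,
    mul_one, Fin.val_succ, pow_succ', Finset.mul_sum]
  congr 1
  exact Finset.sum_congr rfl fun _ _ => by ring

theorem wordSum_append (b : R) {m n : ℕ} (a : Fin m → Fin 2) (a' : Fin n → Fin 2) :
    wordSum b (Fin.append a a') = wordSum b a + b ^ m * wordSum b a' := by
  simp only [wordSum, Fin.sum_univ_add, Fin.append_left, Fin.append_right, Fin.val_castAdd,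
    Fin.val_natAdd, pow_add, Finset.mul_sum]
  congr 1
  exact Finset.sum_congr rfl fun _ _ => by ring

theorem map_wordSum {S : Type*} [CommRing S] (f : R →+* S) (b : R) {n : ℕ} (a : Fin n → Fin 2) :
    f (wordSum b a) = wordSum (f b) a := by
  simp [wordSum]

theorem diffCount_zero (b : R) (x : R) : diffCount b 0 x = if x = 0 then 1 else 0 := by
  simp [diffCount_eq_sum, wordSum, eq_comm]

/-- Splitting off the lowest digits (i, j) leaves a pair of words of length n. A one-sided identity
`b * c = 1` replaces division because the full coordinate ring is not a field. -/
theorem diffCount_succ {b c : R} (hbc : b * c = 1) (n : ℕ) (x : R) :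
    diffCount b (n + 1) x =
      ∑ i : Fin 2, ∑ j : Fin 2, diffCount b n (c * (x - ((i : ℕ) : R) + ((j : ℕ) : R))) := by
  simp only [diffCount_eq_sum, sum_words_succ, wordSum_cons]
  refine Finset.sum_congr rfl fun i _ => ?_
  rw [Finset.sum_comm]
  refine Finset.sum_congr rfl fun j _ => Finset.sum_congr rfl fun a _ =>
    Finset.sum_congr rfl fun a' _ => ?_
  refine if_congr ?_ rfl rfl
  constructor
  · rintro rfl
    linear_combination (-(wordSum b a - wordSum b a')) * hbc
  · intro h
    linear_combination b * h + (x - ((i : ℕ) : R) + ((j : ℕ) : R)) * hbc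

theorem diffCount_neg (b : R) (n : ℕ) (x : R) : diffCount b n (-x) = diffCount b n x := by
  simp only [diffCount_eq_sum]
  rw [Finset.sum_comm]
  refine Finset.sum_congr rfl fun a _ => Finset.sum_congr rfl fun a' _ => ?_
  refine if_congr ?_ rfl rfl
  rw [← neg_sub, neg_inj]

theorem two_pow_le_diffCount (b : R) (n : ℕ) : 2 ^ n ≤ diffCount b n 0 := by
  rw [diffCount_eq_sum]
  calc 2 ^ n = ∑ _a : Fin n → Fin 2, 1 := by simp
    _ ≤ _ := Finset.sum_le_sum fun a _ => by
      refine le_trans ?_ (Finset.single_le_sum (f := fun a' =>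
        if wordSum b a - wordSum b a' = 0 then 1 else 0) (fun _ _ => Nat.zero_le _)
        (Finset.mem_univ a))
      simp

theorem diffCount_le (b : R) (n : ℕ) (x : R) : diffCount b n x ≤ 4 ^ n := by
  refine (Finset.card_filter_le _ _).trans ?_
  simp [← mul_pow]

/-- Concatenating a pair for u with a pair for v produces a pair for u + bᵐv, and the concatenation
determines both. The case v = 0 yields supermultiplicativity and, later, the comparison of finite
counts with the limit measure. -/
theorem diffCount_mul_le (b : R) (m n : ℕ) (u v : R) :
    diffCount b m u * diffCount b n v ≤ diffCount b (m + n) (u + b ^ m * v) := by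
  simp only [diffCount_eq_sum, sum_words_add, wordSum_append]
  rw [Finset.sum_mul_sum]
  refine Finset.sum_le_sum fun a _ => Finset.sum_le_sum fun c _ => ?_
  rw [Finset.sum_mul_sum]
  refine Finset.sum_le_sum fun a' _ => Finset.sum_le_sum fun c' _ => ?_
  by_cases h1 : wordSum b a - wordSum b a' = u
  · by_cases h2 : wordSum b c - wordSum b c' = v
    · rw [if_pos h1, if_pos h2, if_pos (by rw [← h1, ← h2]; ring), one_mul]
    · simp [h2]
  · simp [h1]

/-- Coincidences are most frequent at the origin (Cauchy–Schwarz). -/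
theorem diffCount_le_diffCount_zero (b : R) (n : ℕ) (x : R) :
    diffCount b n x ≤ diffCount b n 0 := by
  set N : R → ℕ := fun y => (Finset.univ.filter fun a : Fin n → Fin 2 => wordSum b a = y).card
  set U : Finset R := Finset.univ.image fun a : Fin n → Fin 2 => wordSum b a
  -- The count is the autocorrelation of the fibre sizes N, so it is largest at zero shift.
  have hN : ∀ y, diffCount b n y = ∑ z ∈ U, N z * N (z - y) := by
    intro y
    rw [diffCount_eq_sum, ← Finset.sum_fiberwise_of_maps_to (t := U)
      (g := fun a : Fin n → Fin 2 => wordSum b a)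
      (fun a _ => Finset.mem_image_of_mem _ (Finset.mem_univ a))]
    refine Finset.sum_congr rfl fun z _ => ?_
    rw [show N z = ∑ _a ∈ Finset.univ.filter fun a : Fin n → Fin 2 => wordSum b a = z, 1 from
      Finset.card_eq_sum_ones _, Finset.sum_mul]
    refine Finset.sum_congr rfl fun a ha => ?_
    rw [one_mul, ← Finset.card_filter]
    congr 1
    ext a'
    simp only [Finset.mem_filter, Finset.mem_univ, true_and] at ha ⊢
    rw [ha]
    exact ⟨fun h => by rw [← h]; ring, fun h => by rw [h]; ring⟩
  -- The shifted points may leave U, but N vanishes outside U.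
  have hshift : ∑ z ∈ U, N (z - x) ^ 2 ≤ ∑ z ∈ U, N z ^ 2 := by
    rw [← Finset.sum_image (f := fun z => N z ^ 2) (g := fun z => z - x)
      (fun _ _ _ _ h => sub_left_injective h)]
    refine Finset.sum_le_sum_of_ne_zero fun z _ hz => ?_
    have hz' : N z ≠ 0 := fun h => hz (by simp [h])
    obtain ⟨a, ha⟩ := Finset.card_ne_zero.mp hz'
    exact Finset.mem_image.mpr ⟨a, Finset.mem_univ _, (Finset.mem_filter.mp ha).2⟩
  have h1 : 2 * diffCount b n x ≤ 2 * diffCount b n 0 := by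
    rw [hN, hN, Finset.mul_sum]
    calc ∑ z ∈ U, 2 * (N z * N (z - x)) ≤ ∑ z ∈ U, (N z ^ 2 + N (z - x) ^ 2) :=
          Finset.sum_le_sum fun z _ => by
            have := two_mul_le_add_sq (N z) (N (z - x)); nlinarith
      _ ≤ ∑ z ∈ U, N z ^ 2 + ∑ z ∈ U, N z ^ 2 := by
          rw [Finset.sum_add_distrib]; gcongr
      _ = 2 * ∑ z ∈ U, N z * N (z - 0) := by
          simp only [sub_zero, ← sq]; ring
  omega

/-- If every pair of words of length `m + n` with equal values splits at an element of the finite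
set `G`, the number of such pairs is submultiplicative up to the factor `#G`. -/
theorem diffCount_add_le (b : R) (m n : ℕ) (G : Finset R)
    (hG : ∀ (a a' : Fin m → Fin 2) (c c' : Fin n → Fin 2),
      wordSum b a - wordSum b a' + b ^ m * (wordSum b c - wordSum b c') = 0 →
      wordSum b c - wordSum b c' ∈ G) :
    diffCount b (m + n) 0 ≤ G.card * (diffCount b m 0 * diffCount b n 0) := by
  calc diffCount b (m + n) 0
      ≤ ∑ x ∈ G, diffCount b m (-(b ^ m * x)) * diffCount b n x := by
        simp only [diffCount_eq_sum, sum_words_add, wordSum_append, Finset.sum_mul_sum]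
        rw [Finset.sum_comm (s := G)]
        refine Finset.sum_le_sum fun a _ => ?_
        rw [Finset.sum_comm (s := G)]
        refine Finset.sum_le_sum fun c _ => ?_
        rw [Finset.sum_comm (s := G)]
        refine Finset.sum_le_sum fun a' _ => ?_
        rw [Finset.sum_comm (s := G)]
        refine Finset.sum_le_sum fun c' _ => ?_
        split_ifs with h
        · have h' : wordSum b a - wordSum b a' + b ^ m * (wordSum b c - wordSum b c') = 0 := by
            rw [← h]; ring
          refine le_trans ?_ (Finset.single_le_sum (fun _ _ => Nat.zero_le _) (hG a a' c c' h'))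
          rw [if_pos (eq_neg_of_add_eq_zero_left h'), if_pos rfl, one_mul]
        · exact Nat.zero_le _
    _ ≤ ∑ x ∈ G, diffCount b m 0 * diffCount b n 0 :=
        Finset.sum_le_sum fun x _ => Nat.mul_le_mul (diffCount_le_diffCount_zero _ _ _)
          (diffCount_le_diffCount_zero _ _ _)
    _ = _ := by rw [Finset.sum_const, smul_eq_mul]

end Words

/-! ### Growth rate of a sequence that is multiplicative up to constants -/

/-- Fekete's lemma is used twice: -log aₙ and log(K aₙ) are both subadditive, and divided by n they
have opposite limits. Since Fekete's limit is also an infimum, each application gives one of the two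
bounds for every n, not only asymptotically. -/
theorem exists_growth_rate {a : ℕ → ℝ} {K B : ℝ} (h1 : ∀ n, 1 ≤ a n)
    (hsup : ∀ m n, a m * a n ≤ a (m + n)) (hsub : ∀ m n, a (m + n) ≤ K * (a m * a n))
    (hB : ∀ n, a n ≤ B ^ n) :
    ∃ l : ℝ, Tendsto (fun n : ℕ => a n ^ (1 / (n : ℝ))) atTop (𝓝 l) ∧
      (∀ n, a n ≤ l ^ n) ∧ (∀ n, l ^ n ≤ K * a n) ∧ 0 < l := by
  have hpos : ∀ n, 0 < a n := fun n => lt_of_lt_of_le one_pos (h1 n)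
  have ha0 : a 0 = 1 := le_antisymm (by simpa using hB 0) (h1 0)
  have hK : 1 ≤ K := by simpa [ha0] using hsub 0 0
  have hKpos : 0 < K := one_pos.trans_le hK
  have hsubadd : Subadditive fun n => -Real.log (a n) := by
    intro m n
    have := Real.log_le_log (mul_pos (hpos m) (hpos n)) (hsup m n)
    rw [Real.log_mul (hpos m).ne' (hpos n).ne'] at this
    linarith
  have hsubadd' : Subadditive fun n => Real.log (K * a n) := by
    intro m n
    have hm := mul_pos hKpos (hpos m)
    have hn := mul_pos hKpos (hpos n)
    rw [← Real.log_mul hm.ne' hn.ne']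
    refine Real.log_le_log (mul_pos hKpos (hpos _)) ?_
    calc K * a (m + n) ≤ K * (K * (a m * a n)) := by gcongr; exact hsub m n
      _ = K * a m * (K * a n) := by ring
  have hbdd : BddBelow (Set.range fun n : ℕ => -Real.log (a n) / n) := by
    refine ⟨-|Real.log B|, ?_⟩
    rintro _ ⟨n, rfl⟩
    rcases Nat.eq_zero_or_pos n with rfl | hn
    · simp
    · have h := Real.log_le_log (hpos n) (hB n)
      rw [Real.log_pow] at h
      have hn' : (0 : ℝ) < n := by exact_mod_cast hn
      change _ ≤ -Real.log (a n) / n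
      rw [le_div_iff₀ hn']
      nlinarith [le_abs_self (Real.log B)]
  have hbdd' : BddBelow (Set.range fun n : ℕ => Real.log (K * a n) / n) := by
    refine ⟨0, ?_⟩
    rintro _ ⟨n, rfl⟩
    exact div_nonneg (Real.log_nonneg (by nlinarith [h1 n])) n.cast_nonneg
  set L := -hsubadd.lim
  have hlim : Tendsto (fun n : ℕ => Real.log (a n) / n) atTop (𝓝 L) := by
    have := (hsubadd.tendsto_lim hbdd).neg
    refine this.congr fun n => ?_
    ring
  have hlim' : Tendsto (fun n : ℕ => Real.log (K * a n) / n) atTop (𝓝 L) := by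
    have h := (tendsto_const_nhds (x := Real.log K)).div_atTop
      (tendsto_natCast_atTop_atTop (R := ℝ)) |>.add hlim
    rw [zero_add] at h
    refine h.congr fun n => ?_
    rw [Real.log_mul hKpos.ne' (hpos n).ne', add_div]
  have hL' : hsubadd'.lim = L := tendsto_nhds_unique (hsubadd'.tendsto_lim hbdd') hlim'
  refine ⟨Real.exp L, ?_, ?_, ?_, Real.exp_pos _⟩
  · refine ((Real.continuous_exp.tendsto _).comp hlim).congr fun n => ?_
    rw [Function.comp, Real.rpow_def_of_pos (hpos n)]
    congr 1
    ring
  · intro n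
    rcases Nat.eq_zero_or_pos n with rfl | hn
    · simp [ha0]
    · have hn' : (0 : ℝ) < n := by exact_mod_cast hn
      have h := hsubadd.lim_le_div hbdd hn.ne'
      rw [le_div_iff₀ hn'] at h
      rw [← Real.exp_nat_mul, ← Real.log_le_iff_le_exp (hpos n)]
      change _ ≤ (n : ℝ) * -hsubadd.lim
      linarith
  · intro n
    rcases Nat.eq_zero_or_pos n with rfl | hn
    · simpa [ha0] using hK
    · have hn' : (0 : ℝ) < n := by exact_mod_cast hn
      have h := hsubadd'.lim_le_div hbdd' hn.ne'
      rw [le_div_iff₀ hn', hL'] at h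
      rw [← Real.exp_nat_mul, ← Real.le_log_iff_exp_le (mul_pos hKpos (hpos n))]
      linarith

/-! ### Convergence of the powers of a positive operator -/

section PositiveOperator

variable {X ι : Type*} [Fintype ι] {τ : ι → X → X} {l : ℝ} {V : ℕ → X → ℝ} {o : X}

/-- Limits of Cesàro means are harmonic. -/
theorem exists_harmonic (hrec : ∀ n x, V (n + 1) x = l⁻¹ * ∑ i, V n (τ i x))
    (h01 : ∀ n x, 0 ≤ V n x ∧ V n x ≤ 1) :
    ∃ h : X → ℝ, (∀ x, h x = l⁻¹ * ∑ i, h (τ i x)) ∧ (∀ x, 0 ≤ h x ∧ h x ≤ 1) ∧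
      (∀ x c m, (∀ k, m ≤ k → c ≤ V k x) → c ≤ h x) ∧ ∀ x, (∀ n, V n x = 0) → h x = 0 := by
  set A : ℕ → X → ℝ := fun n x => (∑ k ∈ Finset.range n, V k x) / n
  have hA : ∀ n x, A n x ∈ Set.Icc (0 : ℝ) 1 := by
    intro n x
    refine ⟨div_nonneg (Finset.sum_nonneg fun k _ => (h01 k x).1) n.cast_nonneg,
      div_le_one_of_le₀ ?_ n.cast_nonneg⟩
    calc ∑ k ∈ Finset.range n, V k x ≤ ∑ k ∈ Finset.range n, 1 :=
          Finset.sum_le_sum fun k _ => (h01 k x).2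
      _ = n := by simp
  -- A limit along one nonprincipal ultrafilter exists at all points simultaneously, so no
  -- subsequence has to be extracted.
  have hex : ∀ x, ∃ y ∈ Set.Icc (0 : ℝ) 1, Tendsto (fun n => A n x) (hyperfilter ℕ) (𝓝 y) := by
    intro x
    exact isCompact_Icc.ultrafilter_le_nhds ((hyperfilter ℕ).map fun n => A n x)
      (le_principal_iff.mpr (Filter.mem_map.mpr (Filter.univ_mem' fun n => hA n x)))
  choose h hmem hlim using hex
  have hle : ((hyperfilter ℕ : Ultrafilter ℕ) : Filter ℕ) ≤ atTop := Nat.hyperfilter_le_atTop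
  refine ⟨h, ?_, fun x => hmem x, ?_, ?_⟩
  · intro x
    have h1 : Tendsto (fun n => l⁻¹ * ∑ i, A n (τ i x)) (hyperfilter ℕ)
        (𝓝 (l⁻¹ * ∑ i, h (τ i x))) :=
      (tendsto_finsetSum _ fun i _ => hlim (τ i x)).const_mul _
    -- Applying the operator to a Cesàro mean shifts the summation index and changes the mean by
    -- exactly this boundary term.
    have h2 : Tendsto (fun n : ℕ => (V n x - V 0 x) / n) atTop (𝓝 0) := by
      refine squeeze_zero_norm (a := fun n : ℕ => 1 / (n : ℝ)) (fun n => ?_)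
        tendsto_one_div_atTop_nhds_zero_nat
      rw [norm_div, Real.norm_natCast]
      gcongr
      rw [Real.norm_eq_abs, abs_le]
      constructor <;> linarith [h01 n x, h01 0 x, (h01 n x).1, (h01 0 x).1, (h01 n x).2,
        (h01 0 x).2]
    have h3 := (hlim x).add (h2.mono_left hle)
    rw [add_zero] at h3
    refine tendsto_nhds_unique h3 (h1.congr fun n => ?_)
    simp only [A]
    rw [← add_div, ← Finset.sum_div, Finset.sum_comm, mul_div_assoc', Finset.mul_sum]
    congr 1
    simp only [← hrec]
    have := Finset.sum_range_succ (fun k => V k x) n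
    rw [Finset.sum_range_succ'] at this
    linarith
  · intro x c m hc
    have h1 : Tendsto (fun n : ℕ => c - (m * (|c|)) / n) atTop (𝓝 c) := by
      simpa using (tendsto_const_nhds (x := c)).sub
        ((tendsto_const_nhds (x := (m : ℝ) * |c|)).div_atTop
          (tendsto_natCast_atTop_atTop (R := ℝ)))
    refine le_of_tendsto_of_tendsto (h1.mono_left hle) (hlim x)
      (hle (eventually_atTop.mpr ⟨m + 1, fun n hn => ?_⟩))
    have hn' : (0 : ℝ) < n := by exact_mod_cast (by omega : 0 < n)
    simp only [A]
    rw [le_div_iff₀ hn', sub_mul, div_mul_cancel₀ _ hn'.ne']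
    obtain ⟨k, rfl⟩ := Nat.exists_eq_add_of_le (show m ≤ n by omega)
    rw [Finset.sum_range_add]
    have h2 : 0 ≤ ∑ j ∈ Finset.range m, V j x := Finset.sum_nonneg fun j _ => (h01 j x).1
    have h3 : ∑ j ∈ Finset.range k, c ≤ ∑ j ∈ Finset.range k, V (m + j) x :=
      Finset.sum_le_sum fun j _ => hc _ (by omega)
    simp only [Finset.sum_const, Finset.card_range, nsmul_eq_mul] at h3
    push_cast
    nlinarith [le_abs_self c, (Nat.cast_nonneg m : (0 : ℝ) ≤ m)]
  · intro x hx
    refine tendsto_nhds_unique (hlim x) ?_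
    simp [A, hx]

/-- A function evolving under the operator and nonnegative on a stable set is bounded below by
the contribution of the paths that end at `o`. -/
theorem mul_le_of_nonneg_on (hl : 0 ≤ l) (hrec : ∀ n x, V (n + 1) x = l⁻¹ * ∑ i, V n (τ i x))
    (h0 : ∀ x, V 0 x = if x = o then 1 else 0) {E : Set X} (hE : ∀ i, ∀ x ∈ E, τ i x ∈ E)
    {f : ℕ → X → ℝ} (hf : ∀ n x, f (n + 1) x = l⁻¹ * ∑ i, f n (τ i x))
    (hf0 : ∀ x ∈ E, 0 ≤ f 0 x) (n : ℕ) : ∀ x ∈ E, V n x * f 0 o ≤ f n x := by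
  induction n with
  | zero =>
    intro x hx
    rw [h0]
    split_ifs with h
    · rw [h, one_mul]
    · simpa using hf0 x hx
  | succ n ih =>
    intro x hx
    rw [hrec, hf, mul_assoc, Finset.sum_mul]
    have := inv_nonneg.mpr hl
    gcongr with i
    exact ih _ (hE i x hx)

/-- This is a Doeblin argument for V relative to a harmonic function h. At some time L the mass
dominates εh on E, so every L steps each point inherits a fixed proportion of whatever slack is
present at o. The interval containing the ratios V/h therefore shrinks geometrically. -/
theorem exists_tendsto_of_positive (hl : 0 ≤ l)
    (hrec : ∀ n x, V (n + 1) x = l⁻¹ * ∑ i, V n (τ i x))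
    (h0 : ∀ x, V 0 x = if x = o then 1 else 0) (h01 : ∀ n x, 0 ≤ V n x ∧ V n x ≤ 1)
    {δ : ℝ} (hδ : 0 < δ) (hlow : ∀ n, δ ≤ V n o)
    (hsup : ∀ m n x, V m x * V n o ≤ V (m + n) x) {E : Set X} (hE : ∀ i, ∀ x ∈ E, τ i x ∈ E)
    (ho : o ∈ E) (hfin : {x ∈ E | ∃ n, V n x ≠ 0}.Finite) :
    ∀ x ∈ E, ∃ y, Tendsto (fun n => V n x) atTop (𝓝 y) := by
  obtain ⟨h, hharm, hh01, hhlow, hhz⟩ := exists_harmonic hrec h01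
  have hlater : ∀ m k x, m ≤ k → V m x * δ ≤ V k x := by
    intro m k x hmk
    obtain ⟨j, rfl⟩ := Nat.exists_eq_add_of_le hmk
    exact (mul_le_mul_of_nonneg_left (hlow j) (h01 m x).1).trans (hsup m j x)
  have hho : 0 < h o := lt_of_lt_of_le hδ (hhlow o δ 0 fun k _ => hlow k)
  -- a time at which every relevant point has positive mass
  obtain ⟨L, ε, hε, hεV⟩ : ∃ (L : ℕ) (ε : ℝ), 0 < ε ∧ ∀ x ∈ E, ε * h x ≤ V L x := by
    have hch : ∀ x, ∃ n, (∃ n, V n x ≠ 0) → V n x ≠ 0 := fun x => by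
      by_cases hx : ∃ n, V n x ≠ 0
      · exact ⟨hx.choose, fun _ => hx.choose_spec⟩
      · exact ⟨0, fun h => absurd h hx⟩
    choose N hN using hch
    set F := hfin.toFinset
    set L := F.sup N
    have hpos : ∀ x ∈ F, 0 < V L x := by
      intro x hx
      have hx' := (hfin.mem_toFinset.mp hx).2
      have h1 : 0 < V (N x) x := lt_of_le_of_ne (h01 _ _).1 (hN x hx').symm
      exact (mul_pos h1 hδ).trans_le (hlater _ _ x (Finset.le_sup hx))
    have hoF : o ∈ F := hfin.mem_toFinset.mpr ⟨ho, 0, by rw [h0, if_pos rfl]; exact one_ne_zero⟩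
    obtain ⟨x₀, hx₀, hmin⟩ := F.exists_min_image (V L) ⟨o, hoF⟩
    refine ⟨L, V L x₀, hpos _ hx₀, fun x hx => ?_⟩
    by_cases hxF : x ∈ F
    · calc V L x₀ * h x ≤ V L x₀ * 1 := by
            have := (hpos _ hx₀).le
            gcongr
            exact (hh01 x).2
        _ ≤ V L x := by rw [mul_one]; exact hmin x hxF
    · have hz : ∀ n, V n x = 0 := by
        intro n
        by_contra hne
        exact hxF (hfin.mem_toFinset.mpr ⟨hx, n, hne⟩)
      rw [hhz x hz, hz L, mul_zero]
  have hρ1 : ε * h o ≤ 1 := (hεV o ho).trans (h01 _ _).2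
  set ρ := ε * h o with hρ
  have hρ0 : 0 < ρ := mul_pos hε hho
  -- bounds persist
  have hlo : ∀ (n : ℕ) (c : ℝ), (∀ x ∈ E, c * h x ≤ V n x) → ∀ k, ∀ x ∈ E,
      V k x * (V n o - c * h o) ≤ V (n + k) x - c * h x := by
    intro n c hc k
    refine mul_le_of_nonneg_on (f := fun k x => V (n + k) x - c * h x) hl hrec h0 hE ?_
      (fun x hx => sub_nonneg.mpr (hc x hx)) k
    intro k x
    rw [← add_assoc, hrec, hharm x, Finset.sum_sub_distrib, ← Finset.mul_sum]
    ring
  have hhi : ∀ (n : ℕ) (c : ℝ), (∀ x ∈ E, V n x ≤ c * h x) → ∀ k, ∀ x ∈ E,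
      V k x * (c * h o - V n o) ≤ c * h x - V (n + k) x := by
    intro n c hc k
    refine mul_le_of_nonneg_on (f := fun k x => c * h x - V (n + k) x) hl hrec h0 hE ?_
      (fun x hx => sub_nonneg.mpr (hc x hx)) k
    intro k x
    rw [← add_assoc, hrec, hharm x, Finset.sum_sub_distrib, ← Finset.mul_sum]
    ring
  -- The slacks at o below and above add up to (hi - lo) · h o. After L steps each is returned with
  -- weight at least ε, so the gap is multiplied by 1 - ρ no matter how the slack is distributed.
  have hkey : ∀ k : ℕ, ∃ (n : ℕ) (lo hi : ℝ), hi - lo ≤ (1 - ρ) ^ k * (1 / h o) ∧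
      ∀ x ∈ E, lo * h x ≤ V n x ∧ V n x ≤ hi * h x := by
    intro k
    induction k with
    | zero =>
      -- At time zero V is the indicator of o, so only the ratio at o matters.
      refine ⟨0, 0, 1 / h o, by simp, fun x hx => ⟨by rw [zero_mul]; exact (h01 _ _).1, ?_⟩⟩
      rw [h0]
      split_ifs with hxo
      · rw [hxo, one_div_mul_cancel hho.ne']
      · exact mul_nonneg (by positivity) (hh01 x).1
    | succ k ih =>
      obtain ⟨n, lo, hi, hd, hb⟩ := ih
      refine ⟨n + L, lo + ε * (V n o - lo * h o), hi - ε * (hi * h o - V n o), ?_, fun x hx => ?_⟩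
      · rw [pow_succ, mul_right_comm]
        calc _ = (hi - lo) * (1 - ρ) := by rw [hρ]; ring
          _ ≤ _ := mul_le_mul_of_nonneg_right hd (by linarith)
      · have h1 := hlo n lo (fun x hx => (hb x hx).1) L x hx
        have h2 := hhi n hi (fun x hx => (hb x hx).2) L x hx
        have h3 := mul_le_mul_of_nonneg_right (hεV x hx) (sub_nonneg.mpr (hb o ho).1)
        have h4 := mul_le_mul_of_nonneg_right (hεV x hx) (sub_nonneg.mpr (hb o ho).2)
        constructor <;> linarith
  have hsmall : Tendsto (fun k : ℕ => (1 - ρ) ^ k * (1 / h o)) atTop (𝓝 0) := by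
    simpa using (tendsto_pow_atTop_nhds_zero_of_lt_one (by linarith) (by linarith)).mul_const
      (1 / h o)
  intro x hx
  refine cauchySeq_tendsto_of_complete (Metric.cauchySeq_iff'.mpr fun r hr => ?_)
  obtain ⟨k, hk⟩ := (hsmall.eventually (gt_mem_nhds hr)).exists
  obtain ⟨n, lo, hi, hd, hb⟩ := hkey k
  refine ⟨n, fun j hj => ?_⟩
  obtain ⟨i, rfl⟩ := Nat.exists_eq_add_of_le hj
  have h1 := hlo n lo (fun x hx => (hb x hx).1) i x hx
  have h2 := hhi n hi (fun x hx => (hb x hx).2) i x hx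
  have h3 := mul_nonneg (h01 i x).1 (sub_nonneg.mpr (hb o ho).1)
  have h4 := mul_nonneg (h01 i x).1 (sub_nonneg.mpr (hb o ho).2)
  have h5 : (hi - lo) * h x ≤ hi - lo := by
    have : 0 ≤ hi - lo := by
      have := (hb o ho).1.trans (hb o ho).2
      nlinarith
    nlinarith [(hh01 x).2]
  rw [Real.dist_eq, abs_lt]
  constructor <;> linarith [(hb x hx).1, (hb x hx).2]

end PositiveOperator

/-! ### The coordinate spaces -/

section Coord

variable {J : Finset ℂ}

-- `Coord J` retains only the member of each non-real pair in the upper half plane; real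
-- coefficients carry the vanishing over to its conjugate.
open Polynomial in
theorem aeval_eq_zero_of_aeval_conjVec (hJ : ∀ z ∈ J, (starRingEnd ℂ) z ∈ J) {p : ℝ[X]}
    (hp : aeval (conjVec J) p = 0) {z : ℂ} (hz : z ∈ J) : aeval z p = 0 := by
  have hreal : ∀ x : realPart J, aeval (x.1.re) p = 0 := by
    intro x
    have h := congrArg (fun y : Coord J => y.1 x) hp
    have := Polynomial.aeval_algHom_apply
      ((Pi.evalAlgHom ℝ (fun _ : realPart J => ℝ) x).comp (AlgHom.fst ℝ _ (complexPart J → ℂ)))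
      (conjVec J) p
    exact this.trans h
  have hcomplex : ∀ x : complexPart J, aeval x.1 p = 0 := by
    intro x
    have h := congrArg (fun y : Coord J => y.2 x) hp
    have := Polynomial.aeval_algHom_apply
      ((Pi.evalAlgHom ℝ (fun _ : complexPart J => ℂ) x).comp (AlgHom.snd ℝ (realPart J → ℝ) _))
      (conjVec J) p
    exact this.trans h
  rcases lt_trichotomy z.im 0 with him | him | him
  · have hmem : (starRingEnd ℂ) z ∈ complexPart J :=
      Finset.mem_filter.mpr ⟨hJ z hz, by simpa using him⟩
    have h := hcomplex ⟨_, hmem⟩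
    have h2 := Polynomial.aeval_algHom_apply (Complex.conjAe : ℂ →ₐ[ℝ] ℂ) z p
    change aeval ((starRingEnd ℂ) z) p = (starRingEnd ℂ) (aeval z p) at h2
    rw [h2] at h
    simpa using h
  · have h := hreal ⟨z, Finset.mem_filter.mpr ⟨hz, him⟩⟩
    have hz' : z = algebraMap ℝ ℂ z.re := by
      apply Complex.ext <;> simp [him]
    rw [hz', Polynomial.aeval_algebraMap_apply, h, map_zero]
  · exact hcomplex ⟨z, Finset.mem_filter.mpr ⟨hz, him⟩⟩

theorem card_eq_realPart_add (hJ : ∀ z ∈ J, (starRingEnd ℂ) z ∈ J) :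
    J.card = (realPart J).card + 2 * (complexPart J).card := by
  have h1 : (J.filter fun z => z.im < 0).card = (complexPart J).card := by
    refine Finset.card_bij' (fun z _ => (starRingEnd ℂ) z) (fun z _ => (starRingEnd ℂ) z)
      ?_ ?_ ?_ ?_
    · intro z hz
      rw [Finset.mem_filter] at hz
      exact Finset.mem_filter.mpr ⟨hJ z hz.1, by simpa using hz.2⟩
    · intro z hz
      rw [complexPart, Finset.mem_filter] at hz
      exact Finset.mem_filter.mpr ⟨hJ z hz.1, by simpa using hz.2⟩
    · intro z _; simp
    · intro z _; simp
  have h2 := Finset.card_filter_add_card_filter_not (s := J) (fun z : ℂ => z.im = 0)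
  have h3 := Finset.card_filter_add_card_filter_not (s := J.filter fun z : ℂ => ¬ z.im = 0)
    (fun z : ℂ => 0 < z.im)
  have h4 : (J.filter fun z : ℂ => ¬ z.im = 0).filter (fun z => 0 < z.im) = complexPart J := by
    rw [Finset.filter_filter, complexPart]
    exact Finset.filter_congr fun z _ => ⟨fun h => h.2, fun h => ⟨h.ne', h⟩⟩
  have h5 : (J.filter fun z : ℂ => ¬ z.im = 0).filter (fun z => ¬ 0 < z.im) =
      J.filter fun z => z.im < 0 := by
    rw [Finset.filter_filter]
    exact Finset.filter_congr fun z _ =>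
      ⟨fun h => lt_of_le_of_ne (not_lt.mp h.2) h.1, fun h => ⟨h.ne, not_lt.mpr h.le⟩⟩
  rw [h4, h5, h1] at h3
  rw [realPart]
  omega

theorem finrank_coord (hJ : ∀ z ∈ J, (starRingEnd ℂ) z ∈ J) :
    Module.finrank ℝ (Coord J) = J.card := by
  rw [Module.finrank_prod, Module.finrank_pi, Module.finrank_pi_fintype,
    card_eq_realPart_add hJ]
  simp [Complex.finrank_real_complex, mul_comm]

/-- Only an inequality holds in general: J may be empty, and then the ring is trivial and 1 has norm
0. -/
theorem norm_one_coord_le : ‖(1 : Coord J)‖ ≤ 1 := by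
  refine max_le ?_ ?_ <;> exact (pi_norm_le_iff_of_nonneg zero_le_one).mpr fun z => by simp

theorem norm_conjVec_lt_one (h : ∀ z ∈ J, ‖z‖ < 1) : ‖conjVec J‖ < 1 := by
  refine max_lt ?_ ?_
  · refine (pi_norm_lt_iff one_pos).mpr fun z => lt_of_le_of_lt ?_ (h z.1 (Finset.mem_filter.mp z.2).1)
    exact Complex.abs_re_le_norm z.1
  · exact (pi_norm_lt_iff one_pos).mpr fun z => h z.1 (Finset.mem_filter.mp z.2).1

theorem re_norm_of_mem_realPart (z : realPart J) : |z.1.re| = ‖z.1‖ := by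
  have h := (Finset.mem_filter.mp z.2).2
  exact (Complex.abs_re_eq_norm.mpr h)

theorem norm_conjVec_inv_lt_one (h : ∀ z ∈ J, 1 < ‖z‖) : ‖(conjVec J)⁻¹‖ < 1 := by
  refine max_lt ?_ ?_
  · refine (pi_norm_lt_iff one_pos).mpr fun z => ?_
    change ‖(z.1.re)⁻¹‖ < 1
    rw [norm_inv, Real.norm_eq_abs, re_norm_of_mem_realPart]
    exact inv_lt_one_of_one_lt₀ (h z.1 (Finset.mem_filter.mp z.2).1)
  · refine (pi_norm_lt_iff one_pos).mpr fun z => ?_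
    change ‖(z.1)⁻¹‖ < 1
    rw [norm_inv]
    exact inv_lt_one_of_one_lt₀ (h z.1 (Finset.mem_filter.mp z.2).1)

theorem conjVec_mul_inv (h : ∀ z ∈ J, z ≠ 0) : conjVec J * (conjVec J)⁻¹ = 1 := by
  refine Prod.ext (funext fun z => ?_) (funext fun z => ?_)
  · change z.1.re * (z.1.re)⁻¹ = 1
    refine mul_inv_cancel₀ fun h0 => h z.1 (Finset.mem_filter.mp z.2).1 ?_
    rw [← norm_eq_zero, ← re_norm_of_mem_realPart, h0, abs_zero]
  · change z.1 * (z.1)⁻¹ = 1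
    exact mul_inv_cancel₀ (h z.1 (Finset.mem_filter.mp z.2).1)

end Coord

/-! ### Geometric bounds for digit sums -/

section Bounds

variable {A : Type*} [NormedCommRing A]

theorem norm_digit_sub_le (h1 : ‖(1 : A)‖ ≤ 1) (i j : Fin 2) :
    ‖((i : ℕ) : A) - ((j : ℕ) : A)‖ ≤ 1 := by
  fin_cases i <;> fin_cases j <;> simp [h1]

theorem norm_sum_mul_pow_le (h1 : ‖(1 : A)‖ ≤ 1) {b : A} (hb : ‖b‖ < 1) {n : ℕ} (a : Fin n → A)
    (ha : ∀ i, ‖a i‖ ≤ 1) : ‖∑ i, a i * b ^ (i : ℕ)‖ ≤ (1 - ‖b‖)⁻¹ := by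
  have hpow : ∀ k : ℕ, ‖b ^ k‖ ≤ ‖b‖ ^ k := by
    intro k
    rcases Nat.eq_zero_or_pos k with rfl | hk
    · simpa using h1
    · exact norm_pow_le' b hk
  calc ‖∑ i, a i * b ^ (i : ℕ)‖ ≤ ∑ i : Fin n, ‖b‖ ^ (i : ℕ) := by
        refine norm_sum_le_of_le _ fun i _ => (norm_mul_le _ _).trans ?_
        calc ‖a i‖ * ‖b ^ (i : ℕ)‖ ≤ 1 * ‖b‖ ^ (i : ℕ) := by
              gcongr
              · exact ha i
              · exact hpow i
          _ = _ := one_mul _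
    _ = ∑ i ∈ Finset.range n, ‖b‖ ^ i := Fin.sum_univ_eq_sum_range (fun i => ‖b‖ ^ i) n
    _ ≤ (1 - ‖b‖)⁻¹ := by
        rw [← tsum_geometric_of_lt_one (norm_nonneg b) hb]
        exact (summable_geometric_of_lt_one (norm_nonneg b) hb).sum_le_tsum _
          fun _ _ => by positivity

theorem wordSum_sub_eq (b : A) {n : ℕ} (a a' : Fin n → Fin 2) :
    wordSum b a - wordSum b a' = ∑ i, (((a i : ℕ) : A) - ((a' i : ℕ) : A)) * b ^ (i : ℕ) := by
  simp only [wordSum, sub_mul, Finset.sum_sub_distrib]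

theorem norm_wordSum_sub_le (h1 : ‖(1 : A)‖ ≤ 1) {b : A} (hb : ‖b‖ < 1) {n : ℕ}
    (a a' : Fin n → Fin 2) : ‖wordSum b a - wordSum b a'‖ ≤ (1 - ‖b‖)⁻¹ := by
  rw [wordSum_sub_eq]
  exact norm_sum_mul_pow_le h1 hb _ fun i => norm_digit_sub_le h1 _ _

/-- Reversing the digits turns cⁿ ∑ aᵢbⁱ into c times a digit sum in powers of c, to which the
geometric bound applies. -/
theorem norm_pow_mul_wordSum_sub_le (h1 : ‖(1 : A)‖ ≤ 1) {b c : A} (hbc : b * c = 1)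
    (hc : ‖c‖ < 1) {n : ℕ} (a a' : Fin n → Fin 2) :
    ‖c ^ n * (wordSum b a - wordSum b a')‖ ≤ (1 - ‖c‖)⁻¹ := by
  have h : c ^ n * (wordSum b a - wordSum b a') =
      c * ∑ i : Fin n, (((a i.rev : ℕ) : A) - ((a' i.rev : ℕ) : A)) * c ^ (i : ℕ) := by
    rw [wordSum_sub_eq, Finset.mul_sum, Finset.mul_sum, ← Equiv.sum_comp Fin.revPerm]
    refine Finset.sum_congr rfl fun i _ => ?_
    have h2 : c ^ n * b ^ (n - (i + 1)) = c ^ ((i : ℕ) + 1) := by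
      obtain ⟨k, hk⟩ := Nat.exists_eq_add_of_lt i.2
      have hn : c ^ n = c ^ ((i : ℕ) + 1) * c ^ k := by rw [← pow_add]; congr 1; omega
      rw [show n - ((i : ℕ) + 1) = k by omega, hn, mul_assoc, ← mul_pow, mul_comm c b, hbc,
        one_pow, mul_one]
    simp only [Fin.revPerm_apply, Fin.val_rev]
    rw [mul_left_comm, h2, pow_succ]
    ring
  rw [h]
  calc _ ≤ ‖c‖ * ‖∑ i : Fin n, (((a i.rev : ℕ) : A) - ((a' i.rev : ℕ) : A)) * c ^ (i : ℕ)‖ :=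
        norm_mul_le _ _
    _ ≤ 1 * (1 - ‖c‖)⁻¹ := by
        gcongr
        exact norm_sum_mul_pow_le h1 hc _ fun i => norm_digit_sub_le h1 _ _
    _ = _ := one_mul _

end Bounds

/-! ### The lattice -/

/-- The standing assumptions on `β` and on the free direction `φ`. -/
structure Admissible (β φ : ℝ) : Prop where
  hyperbolic : IsHyperbolicInteger β
  mem : (φ : ℂ) ∈ conjugates β
  one_lt_abs : 1 < |φ|
  nonempty : (contracting β).Nonempty

section Lattice

open Polynomial

variable {β φ : ℝ}

theorem mem_conjugates (hβ : IsIntegral ℤ β) {z : ℂ} :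
    z ∈ conjugates β ↔ aeval z (minpoly ℚ β) = 0 := by
  have h : minpoly ℚ β ≠ 0 := minpoly.ne_zero hβ.tower_top
  simp [conjugates, h]

theorem mem_conjugates_int (hβ : IsIntegral ℤ β) {z : ℂ} :
    z ∈ conjugates β ↔ aeval z (minpoly ℤ β) = 0 := by
  rw [mem_conjugates hβ, minpoly.isIntegrallyClosed_eq_field_fractions' ℚ hβ,
    aeval_map_algebraMap]

theorem conj_mem_conjugates (hβ : IsIntegral ℤ β) {z : ℂ} (hz : z ∈ conjugates β) :
    (starRingEnd ℂ) z ∈ conjugates β := by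
  rw [mem_conjugates_int hβ] at hz ⊢
  have h := Polynomial.aeval_algHom_apply
    ((Complex.conjAe : ℂ →ₐ[ℝ] ℂ).restrictScalars ℤ) z (minpoly ℤ β)
  change aeval ((starRingEnd ℂ) z) (minpoly ℤ β) = (starRingEnd ℂ) (aeval z (minpoly ℤ β)) at h
  rw [h, hz, map_zero]

theorem card_conjugates (hβ : IsIntegral ℤ β) :
    (conjugates β).card = (minpoly ℚ β).natDegree := by
  have hirr : Irreducible (minpoly ℚ β) := minpoly.irreducible hβ.tower_top
  have hsep : (minpoly ℚ β).Separable := hirr.separable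
  rw [conjugates, Multiset.toFinset_card_of_nodup
    (Polynomial.nodup_aroots_iff_of_splits hirr.ne_zero (IsAlgClosed.splits _) |>.mpr hsep)]
  rw [Polynomial.aroots_def, ← (IsAlgClosed.splits _).natDegree_eq_card_roots, natDegree_map]

namespace Admissible

variable (h : Admissible β φ)
include h

theorem integral : IsIntegral ℤ β := h.hyperbolic.1

theorem conj_expanding : ∀ z ∈ expanding β φ, (starRingEnd ℂ) z ∈ expanding β φ := by
  intro z hz
  rw [expanding, Finset.mem_filter] at hz ⊢
  refine ⟨conj_mem_conjugates h.integral hz.1, by simpa using hz.2.1, fun h' => hz.2.2 ?_⟩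
  rw [← Complex.conj_conj z, h', Complex.conj_ofReal]

theorem conj_contracting : ∀ z ∈ contracting β, (starRingEnd ℂ) z ∈ contracting β := by
  intro z hz
  rw [contracting, Finset.mem_filter] at hz ⊢
  exact ⟨conj_mem_conjugates h.integral hz.1, by simpa using hz.2⟩

theorem cases_of_mem {z : ℂ} (hz : z ∈ conjugates β) :
    z ∈ expanding β φ ∨ z ∈ contracting β ∨ z = φ := by
  by_cases hφ : z = φ
  · exact Or.inr (Or.inr hφ)
  rcases lt_or_gt_of_ne (h.hyperbolic.2 z hz) with h1 | h1
  · exact Or.inr (Or.inl (Finset.mem_filter.mpr ⟨hz, h1⟩))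
  · exact Or.inl (Finset.mem_filter.mpr ⟨hz, h1, hφ⟩)

theorem card_conjugates_eq :
    (conjugates β).card = (expanding β φ).card + (contracting β).card + 1 := by
  have hu : conjugates β = (expanding β φ ∪ contracting β) ∪ {(φ : ℂ)} := by
    ext z
    simp only [Finset.mem_union, Finset.mem_singleton]
    constructor
    · intro hz
      rcases h.cases_of_mem hz with h1 | h1 | h1 <;> tauto
    · rintro ((h1 | h1) | rfl)
      · exact (Finset.mem_filter.mp h1).1
      · exact (Finset.mem_filter.mp h1).1
      · exact h.mem
  rw [hu, Finset.card_union_of_disjoint, Finset.card_union_of_disjoint, Finset.card_singleton]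
  · rw [Finset.disjoint_left]
    intro z hz hz'
    exact absurd ((Finset.mem_filter.mp hz).2.1) (not_lt.mpr (Finset.mem_filter.mp hz').2.le)
  · rw [Finset.disjoint_singleton_right, Finset.mem_union]
    rintro (h1 | h1)
    · exact (Finset.mem_filter.mp h1).2.2 rfl
    · have := (Finset.mem_filter.mp h1).2
      rw [Complex.norm_real, Real.norm_eq_abs] at this
      linarith [h.one_lt_abs]

theorem aeval_conj_eq_zero {p : ℝ[X]} (hp : aeval (betaBar β φ) p = 0) {z : ℂ}
    (hz : z ∈ conjugates β) : aeval z p = 0 := by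
  have h1 := Polynomial.aeval_algHom_apply
    ((AlgHom.fst ℝ (Ke β φ) (Kc β)).comp (AlgHom.fst ℝ _ ℝ)) (betaBar β φ) p
  have h2 := Polynomial.aeval_algHom_apply
    ((AlgHom.snd ℝ (Ke β φ) (Kc β)).comp (AlgHom.fst ℝ _ ℝ)) (betaBar β φ) p
  have h3 := Polynomial.aeval_algHom_apply
    (AlgHom.snd ℝ (Ke β φ × Kc β) ℝ) (betaBar β φ) p
  rw [hp, map_zero] at h1 h2 h3
  rcases h.cases_of_mem hz with hz | hz | rfl
  · exact aeval_eq_zero_of_aeval_conjVec h.conj_expanding h1 hz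
  · exact aeval_eq_zero_of_aeval_conjVec h.conj_contracting h2 hz
  · change aeval φ p = 0 at h3
    change aeval (algebraMap ℝ ℂ φ) p = 0
    rw [Polynomial.aeval_algebraMap_apply, h3, map_zero]

end Admissible

/-- The linear map sending a real coefficient vector to the corresponding combination of the
powers of the vector of conjugates. -/
noncomputable def coeffMap (β φ : ℝ) : (Fin (minpoly ℚ β).natDegree → ℝ) →ₗ[ℝ] Kbar β φ :=
  Fintype.linearCombination ℝ fun i : Fin (minpoly ℚ β).natDegree => betaBar β φ ^ (i : ℕ)

theorem coeffMap_apply (t : Fin (minpoly ℚ β).natDegree → ℝ) :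
    coeffMap β φ t = ∑ i, t i • betaBar β φ ^ (i : ℕ) := rfl

namespace Admissible

variable (h : Admissible β φ)
include h

/-- A real polynomial of degree less than deg β cannot vanish at all conjugates, which are deg β
distinct points. With the dimension count this makes the lattice a full one. -/
theorem coeffMap_injective : Function.Injective (coeffMap β φ) := by
  rw [← LinearMap.ker_eq_bot, LinearMap.ker_eq_bot']
  intro t ht
  set p : ℝ[X] := ∑ i : Fin (minpoly ℚ β).natDegree, C (t i) * X ^ (i : ℕ) with hp
  have hev : aeval (betaBar β φ) p = 0 := by
    rw [← ht, coeffMap_apply, hp, map_sum]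
    refine Finset.sum_congr rfl fun i _ => ?_
    rw [map_mul, aeval_C, map_pow, aeval_X, Algebra.smul_def]
  have hdeg : p.degree < ((conjugates β).card : WithBot ℕ) := by
    rw [card_conjugates h.integral]
    exact Polynomial.degree_sum_fin_lt t
  have hp0 : p.map (algebraMap ℝ ℂ) = 0 := by
    refine Polynomial.eq_zero_of_degree_lt_of_eval_finset_eq_zero (conjugates β)
      (by rwa [degree_map]) fun z hz => ?_
    rw [eval_map_algebraMap]
    exact h.aeval_conj_eq_zero hev hz
  have hp0' : p = 0 := by
    rwa [Polynomial.map_eq_zero] at hp0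
  funext i
  have hc : p.coeff i = t i := by
    rw [hp, Polynomial.finsetSum_coeff]
    simp [Polynomial.coeff_C_mul, Polynomial.coeff_X_pow, Fin.val_inj]
  rw [← hc, hp0', coeff_zero, Pi.zero_apply]

theorem finrank_Kbar : Module.finrank ℝ (Kbar β φ) = (minpoly ℚ β).natDegree := by
  rw [← card_conjugates h.integral, h.card_conjugates_eq, Module.finrank_prod,
    Module.finrank_prod, finrank_coord h.conj_expanding, finrank_coord h.conj_contracting,
    Module.finrank_self]

theorem coeffMap_surjective : Function.Surjective (coeffMap β φ) :=
  (LinearMap.injective_iff_surjective_of_finrank_eq_finrank (by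
    rw [h.finrank_Kbar, Module.finrank_pi, Fintype.card_fin])).mp h.coeffMap_injective

theorem aeval_minpoly : aeval (betaBar β φ) (minpoly ℤ β) = 0 := by
  have hroot : ∀ {J : Finset ℂ}, J ⊆ conjugates β → aeval (conjVec J) (minpoly ℤ β) = 0 := by
    intro J hJ
    have h1 := Polynomial.aeval_algHom_apply
      (AlgHom.fst ℤ (realPart J → ℝ) (complexPart J → ℂ)) (conjVec J) (minpoly ℤ β)
    have h2 := Polynomial.aeval_algHom_apply
      (AlgHom.snd ℤ (realPart J → ℝ) (complexPart J → ℂ)) (conjVec J) (minpoly ℤ β)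
    refine Prod.ext (h1.symm.trans (funext fun z => ?_)) (h2.symm.trans (funext fun z => ?_))
    · have h3 := Polynomial.aeval_algHom_apply
        (Pi.evalAlgHom ℤ (fun _ : realPart J => ℝ) z) (conjVec J).1 (minpoly ℤ β)
      refine h3.symm.trans ?_
      change aeval z.1.re (minpoly ℤ β) = 0
      have hz := Finset.mem_filter.mp z.2
      have h4 := (mem_conjugates_int h.integral).mp (hJ hz.1)
      have hz' : z.1 = algebraMap ℝ ℂ z.1.re := by
        apply Complex.ext <;> simp [hz.2]
      rw [hz', Polynomial.aeval_algebraMap_apply] at h4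
      simpa using h4
    · have h3 := Polynomial.aeval_algHom_apply
        (Pi.evalAlgHom ℤ (fun _ : complexPart J => ℂ) z) (conjVec J).2 (minpoly ℤ β)
      exact h3.symm.trans ((mem_conjugates_int h.integral).mp
        (hJ (Finset.mem_filter.mp z.2).1))
  have h1 := Polynomial.aeval_algHom_apply
    ((AlgHom.fst ℤ (Ke β φ) (Kc β)).comp (AlgHom.fst ℤ _ ℝ)) (betaBar β φ) (minpoly ℤ β)
  have h2 := Polynomial.aeval_algHom_apply
    ((AlgHom.snd ℤ (Ke β φ) (Kc β)).comp (AlgHom.fst ℤ _ ℝ)) (betaBar β φ) (minpoly ℤ β)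
  have h3 := Polynomial.aeval_algHom_apply
    (AlgHom.snd ℤ (Ke β φ × Kc β) ℝ) (betaBar β φ) (minpoly ℤ β)
  refine Prod.ext (Prod.ext ?_ ?_) ?_
  · exact h1.symm.trans (hroot (Finset.filter_subset _ _))
  · exact h2.symm.trans (hroot (Finset.filter_subset _ _))
  · refine h3.symm.trans ?_
    have h4 := (mem_conjugates_int h.integral).mp h.mem
    change aeval (algebraMap ℝ ℂ φ) _ = 0 at h4
    rw [Polynomial.aeval_algebraMap_apply] at h4
    change aeval φ (minpoly ℤ β) = 0
    simpa using h4

/-- The lattice is the ring of integer polynomials in the vector of conjugates. -/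
theorem lattice_eq_range :
    lattice β φ = ((aeval (betaBar β φ) : ℤ[X] →ₐ[ℤ] Kbar β φ).range : Set (Kbar β φ)) := by
  ext x
  constructor
  · rintro ⟨a, rfl⟩
    refine ⟨∑ i, C (a i) * X ^ (i : ℕ), ?_⟩
    simp
  · rintro ⟨q, rfl⟩
    -- Division by a monic polynomial keeps the coefficients integral; this is where β must be an
    -- algebraic integer.
    have hmonic : (minpoly ℤ β).Monic := minpoly.monic h.integral
    have hdeg : (q %ₘ minpoly ℤ β).natDegree < (minpoly ℚ β).natDegree ∨
        q %ₘ minpoly ℤ β = 0 := by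
      rw [minpoly.isIntegrallyClosed_eq_field_fractions' ℚ h.integral, hmonic.natDegree_map]
      by_cases h0 : q %ₘ minpoly ℤ β = 0
      · exact Or.inr h0
      · exact Or.inl (natDegree_lt_natDegree h0 (degree_modByMonic_lt q hmonic))
    have hq : aeval (betaBar β φ) q = aeval (betaBar β φ) (q %ₘ minpoly ℤ β) := by
      conv_lhs => rw [← modByMonic_add_div q (minpoly ℤ β)]
      rw [map_add, map_mul, h.aeval_minpoly, zero_mul, add_zero]
    refine ⟨fun i => (q %ₘ minpoly ℤ β).coeff i, ?_⟩
    change aeval (betaBar β φ) q = _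
    rw [hq]
    rcases hdeg with hdeg | h0
    · rw [aeval_eq_sum_range' hdeg, Finset.sum_range]
      simp
    · simp [h0]

end Admissible

end Lattice

/-! ### Conjugate coordinates of lattice points; discreteness and density of the lattice -/

section Lattice

open Polynomial

variable {β φ : ℝ}

/-- An integer polynomial vanishing at one conjugate vanishes at all of them. -/
theorem minpoly_dvd_of_aeval_conj (hβ : IsIntegral ℤ β) {z : ℂ} (hz : z ∈ conjugates β) {q : ℤ[X]}
    (hq : aeval z q = 0) : minpoly ℤ β ∣ q := by
  have hz' : IsIntegral ℤ z :=
    ⟨minpoly ℤ β, minpoly.monic hβ, by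
      rw [← aeval_def]; exact (mem_conjugates_int hβ).mp hz⟩
  have h1 : minpoly ℚ β = minpoly ℚ z :=
    minpoly.eq_of_irreducible_of_monic (minpoly.irreducible hβ.tower_top)
      ((mem_conjugates hβ).mp hz) (minpoly.monic hβ.tower_top)
  rw [minpoly.isIntegrallyClosed_eq_field_fractions' ℚ hβ,
    minpoly.isIntegrallyClosed_eq_field_fractions' ℚ hz'] at h1
  rw [Polynomial.map_injective _ (algebraMap ℤ ℚ).injective_int h1]
  exact minpoly.isIntegrallyClosed_dvd hz' hq

theorem aeval_real {J : Finset ℂ} (q : ℤ[X]) (z : realPart J) :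
    (((aeval (conjVec J) q).1 z : ℝ) : ℂ) = aeval z.1 q := by
  have h1 := Polynomial.aeval_algHom_apply
    ((Pi.evalAlgHom ℤ (fun _ : realPart J => ℝ) z).comp
      (AlgHom.fst ℤ (realPart J → ℝ) (complexPart J → ℂ))) (conjVec J) q
  have hz' : z.1 = algebraMap ℝ ℂ z.1.re := by
    apply Complex.ext <;> simp [(Finset.mem_filter.mp z.2).2]
  rw [hz', Polynomial.aeval_algebraMap_apply]
  exact congrArg _ h1.symm

theorem aeval_complex {J : Finset ℂ} (q : ℤ[X]) (z : complexPart J) :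
    (aeval (conjVec J) q).2 z = aeval z.1 q :=
  (Polynomial.aeval_algHom_apply ((Pi.evalAlgHom ℤ (fun _ : complexPart J => ℂ) z).comp
      (AlgHom.snd ℤ (realPart J → ℝ) (complexPart J → ℂ))) (conjVec J) q).symm

theorem aeval_betaBar (q : ℤ[X]) : aeval (betaBar β φ) q =
    ((aeval (conjVec (expanding β φ)) q, aeval (conjVec (contracting β)) q), aeval φ q) := by
  have h1 := Polynomial.aeval_algHom_apply
    ((AlgHom.fst ℤ (Ke β φ) (Kc β)).comp (AlgHom.fst ℤ _ ℝ)) (betaBar β φ) q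
  have h2 := Polynomial.aeval_algHom_apply
    ((AlgHom.snd ℤ (Ke β φ) (Kc β)).comp (AlgHom.fst ℤ _ ℝ)) (betaBar β φ) q
  have h3 := Polynomial.aeval_algHom_apply
    (AlgHom.snd ℤ (Ke β φ × Kc β) ℝ) (betaBar β φ) q
  exact Prod.ext (Prod.ext h1.symm h2.symm) h3.symm

namespace Admissible

variable (h : Admissible β φ)
include h

theorem aeval_betaBar_eq_zero {z : ℂ} (hz : z ∈ conjugates β) {q : ℤ[X]}
    (hq : aeval z q = 0) : aeval (betaBar β φ) q = 0 := by
  obtain ⟨r, rfl⟩ := minpoly_dvd_of_aeval_conj h.integral hz hq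
  rw [map_mul, h.aeval_minpoly, zero_mul]

theorem mem_lattice {x : Kbar β φ} : x ∈ lattice β φ ↔ ∃ q : ℤ[X], aeval (betaBar β φ) q = x := by
  rw [h.lattice_eq_range]; rfl

theorem add_mem {x y : Kbar β φ} (hx : x ∈ lattice β φ) (hy : y ∈ lattice β φ) :
    x + y ∈ lattice β φ := by
  obtain ⟨p, rfl⟩ := h.mem_lattice.mp hx
  obtain ⟨q, rfl⟩ := h.mem_lattice.mp hy
  exact h.mem_lattice.mpr ⟨p + q, map_add _ _ _⟩

theorem sub_mem {x y : Kbar β φ} (hx : x ∈ lattice β φ) (hy : y ∈ lattice β φ) :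
    x - y ∈ lattice β φ := by
  obtain ⟨p, rfl⟩ := h.mem_lattice.mp hx
  obtain ⟨q, rfl⟩ := h.mem_lattice.mp hy
  exact h.mem_lattice.mpr ⟨p - q, map_sub _ _ _⟩

theorem mul_mem {x y : Kbar β φ} (hx : x ∈ lattice β φ) (hy : y ∈ lattice β φ) :
    x * y ∈ lattice β φ := by
  obtain ⟨p, rfl⟩ := h.mem_lattice.mp hx
  obtain ⟨q, rfl⟩ := h.mem_lattice.mp hy
  exact h.mem_lattice.mpr ⟨p * q, map_mul _ _ _⟩

theorem wordSum_mem {n : ℕ} (a : Fin n → Fin 2) : wordSum (betaBar β φ) a ∈ lattice β φ :=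
  h.mem_lattice.mpr ⟨∑ i, ((a i : ℕ) : ℤ[X]) * X ^ (i : ℕ), by simp [wordSum]⟩

/-- The free coordinate is a conjugate of every other one, so its vanishing forces divisibility by
the minimal polynomial. Hence the free coordinate orders the lattice without ties. -/
theorem eq_zero_of_free {x : Kbar β φ} (hx : x ∈ lattice β φ) (h0 : x.2 = 0) : x = 0 := by
  obtain ⟨q, rfl⟩ := h.mem_lattice.mp hx
  refine h.aeval_betaBar_eq_zero h.mem ?_
  rw [aeval_betaBar] at h0
  change aeval (algebraMap ℝ ℂ φ) q = 0
  rw [Polynomial.aeval_algebraMap_apply]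
  exact (congrArg _ h0).trans (map_zero _)

theorem coord_ne_zero {J : Finset ℂ} (hJ : J ⊆ conjugates β) {q : ℤ[X]}
    (hq : aeval (betaBar β φ) q ≠ 0) :
    (∀ z, (aeval (conjVec J) q).1 z ≠ 0) ∧ ∀ z, (aeval (conjVec J) q).2 z ≠ 0 := by
  refine ⟨fun z h0 => hq ?_, fun z h0 => hq ?_⟩
  · refine h.aeval_betaBar_eq_zero (hJ (Finset.mem_filter.mp z.2).1) ?_
    rw [← aeval_real, h0, Complex.ofReal_zero]
  · refine h.aeval_betaBar_eq_zero (hJ (Finset.mem_filter.mp z.2).1) ?_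
    rw [← aeval_complex, h0]

/-- The existence of a contracting conjugate is essential: it lets the contracting coordinate serve
as a label for lattice points, on which the functions f̄ᵢ rest. -/
theorem eq_zero_of_contracting {x : Kbar β φ} (hx : x ∈ lattice β φ) (h0 : x.1.2 = 0) : x = 0 := by
  obtain ⟨q, rfl⟩ := h.mem_lattice.mp hx
  by_contra hq
  have hne := h.coord_ne_zero (J := contracting β) (Finset.filter_subset _ _) hq
  rw [aeval_betaBar] at h0
  change aeval (conjVec (contracting β)) q = 0 at h0
  rw [h0] at hne
  obtain ⟨z, hz⟩ := h.nonempty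
  rcases lt_trichotomy z.im 0 with him | him | him
  · exact hne.2 ⟨(starRingEnd ℂ) z, Finset.mem_filter.mpr ⟨h.conj_contracting z hz,
      by simpa using him⟩⟩ rfl
  · exact hne.1 ⟨z, Finset.mem_filter.mpr ⟨hz, him⟩⟩ rfl
  · exact hne.2 ⟨z, Finset.mem_filter.mpr ⟨hz, him⟩⟩ rfl

theorem mul_inv_of_mem {x : Kbar β φ} (hx : x ∈ lattice β φ) (h0 : x ≠ 0) : x * x⁻¹ = 1 := by
  have hfree : x.2 ≠ 0 := fun h' => h0 (h.eq_zero_of_free hx h')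
  obtain ⟨q, rfl⟩ := h.mem_lattice.mp hx
  have he := h.coord_ne_zero (J := expanding β φ) (Finset.filter_subset _ _) h0
  have hc := h.coord_ne_zero (J := contracting β) (Finset.filter_subset _ _) h0
  rw [aeval_betaBar] at hfree ⊢
  exact Prod.ext (Prod.ext
    (Prod.ext (funext fun z => mul_inv_cancel₀ (he.1 z)) (funext fun z => mul_inv_cancel₀ (he.2 z)))
    (Prod.ext (funext fun z => mul_inv_cancel₀ (hc.1 z)) (funext fun z => mul_inv_cancel₀ (hc.2 z))))
    (mul_inv_cancel₀ hfree)

/-- The coefficient map is a linear homeomorphism, so a bounded lattice point has bounded integer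
coefficients. -/
theorem finite_lattice_of_norm_le (R : ℝ) : {x ∈ lattice β φ | ‖x‖ ≤ R}.Finite := by
  set e := (LinearEquiv.ofBijective (coeffMap β φ)
    ⟨h.coeffMap_injective, h.coeffMap_surjective⟩).toContinuousLinearEquiv
  set M : ℝ := ‖(e.symm : Kbar β φ →L[ℝ] (Fin (minpoly ℚ β).natDegree → ℝ))‖ * R
  have hfin : (Set.Icc (fun _ => -⌈M⌉) (fun _ => ⌈M⌉) :
      Set (Fin (minpoly ℚ β).natDegree → ℤ)).Finite := Set.finite_Icc _ _
  refine (hfin.image fun a => ∑ i : Fin (minpoly ℚ β).natDegree, (a i : Kbar β φ) * betaBar β φ ^ (i : ℕ)).subset ?_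
  rintro x ⟨⟨a, rfl⟩, hx⟩
  refine ⟨a, ?_, rfl⟩
  have h1 : e (fun i => (a i : ℝ)) = ∑ i, (a i : Kbar β φ) * betaBar β φ ^ (i : ℕ) := by
    change coeffMap β φ _ = _
    rw [coeffMap_apply]
    exact Finset.sum_congr rfl fun i _ => by simp [Algebra.smul_def]
  have h2 : ‖(fun i => (a i : ℝ))‖ ≤ M := by
    have h3 := (e.symm : Kbar β φ →L[ℝ] (Fin (minpoly ℚ β).natDegree → ℝ)).le_opNorm (e fun i => (a i : ℝ))
    rw [ContinuousLinearEquiv.coe_coe, e.symm_apply_apply, h1] at h3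
    exact h3.trans (mul_le_mul_of_nonneg_left hx (norm_nonneg _))
  have h3 : ∀ i, |(a i : ℝ)| ≤ M := fun i => (norm_le_pi_norm (fun i => (a i : ℝ)) i).trans h2
  constructor
  · intro i
    have h4 : ((-⌈M⌉ : ℤ) : ℝ) ≤ a i := by
      push_cast
      linarith [Int.le_ceil M, (abs_le.mp (h3 i)).1]
    exact_mod_cast h4
  · intro i
    have h4 : (a i : ℝ) ≤ (⌈M⌉ : ℤ) := (le_abs_self _).trans ((h3 i).trans (Int.le_ceil M))
    exact_mod_cast h4

theorem exists_lattice_near : ∃ C : ℝ, 0 ≤ C ∧ ∀ p : Kbar β φ, ∃ u ∈ lattice β φ, ‖p - u‖ ≤ C := by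
  refine ⟨∑ i : Fin (minpoly ℚ β).natDegree, ‖betaBar β φ ^ (i : ℕ)‖,
    Finset.sum_nonneg fun _ _ => norm_nonneg _, fun p => ?_⟩
  obtain ⟨t, rfl⟩ := h.coeffMap_surjective p
  refine ⟨∑ i, ((⌊t i⌋ : ℤ) : Kbar β φ) * betaBar β φ ^ (i : ℕ), ⟨_, rfl⟩, ?_⟩
  rw [coeffMap_apply, ← Finset.sum_sub_distrib]
  refine norm_sum_le_of_le _ fun i _ => ?_
  have h1 : t i • betaBar β φ ^ (i : ℕ) - ((⌊t i⌋ : ℤ) : Kbar β φ) * betaBar β φ ^ (i : ℕ) =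
      Int.fract (t i) • betaBar β φ ^ (i : ℕ) := by
    rw [Int.fract, sub_smul]
    simp [Algebra.smul_def]
  rw [h1, norm_smul, Real.norm_eq_abs, abs_of_nonneg (Int.fract_nonneg _)]
  exact mul_le_of_le_one_left (norm_nonneg _) (Int.fract_lt_one _).le

/-- There are nonzero lattice vectors close to the free axis. -/
theorem exists_lattice_small {δ : ℝ} (hδ : 0 < δ) :
    ∃ v ∈ lattice β φ, v ≠ 0 ∧ ‖v.1‖ < δ := by
  obtain ⟨C, hC, hnear⟩ := h.exists_lattice_near
  -- Lattice points are picked near equally spaced points of the free axis. Their other coordinates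
  -- stay bounded, so two of them nearly agree there.
  choose u hu hun using fun n : ℕ => hnear ((0, (n : ℝ) * (2 * C + 1)) : Kbar β φ)
  have hD : ∀ n, ‖(u n).1‖ ≤ C := by
    intro n
    have := (norm_fst_le _).trans (hun n)
    simpa using this
  have hF : ∀ n : ℕ, |(n : ℝ) * (2 * C + 1) - (u n).2| ≤ C := fun n =>
    (norm_snd_le _).trans (hun n)
  obtain ⟨y, -, k, hk, hlim⟩ := tendsto_subseq_of_bounded
    (Metric.isBounded_closedBall (x := (0 : Ke β φ × Kc β)) (r := C))
    (x := fun n => (u n).1) (fun n => by simpa using hD n)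
  obtain ⟨N, hN⟩ := Metric.cauchySeq_iff'.mp hlim.cauchySeq δ hδ
  have h1 := hN (N + 1) (Nat.le_succ N)
  refine ⟨u (k (N + 1)) - u (k N), h.sub_mem (hu _) (hu _), fun h0 => ?_, ?_⟩
  -- The spacing 2C + 1 exceeds twice the approximation error C, so the free coordinates of distinct
  -- choices differ.
  · have h2 : (u (k (N + 1))).2 - (u (k N)).2 = 0 := congrArg Prod.snd h0
    have h3 : (k N : ℝ) + 1 ≤ k (N + 1) := by exact_mod_cast hk (Nat.lt_succ_self N)
    have h4 := abs_le.mp (hF (k N))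
    have h5 := abs_le.mp (hF (k (N + 1)))
    nlinarith
  · rwa [Function.comp, Function.comp, dist_eq_norm] at h1

/-- The lattice vectors with free coordinate in a bounded positive range are dense in the other
directions. -/
theorem exists_lattice_dense {ε : ℝ} (hε : 0 < ε) : ∃ L : ℝ, ∀ y : Ke β φ × Kc β,
    ∃ v ∈ lattice β φ, 0 < v.2 ∧ v.2 ≤ L ∧ ‖v.1 - y‖ < ε := by
  obtain ⟨C, hC, hnear⟩ := h.exists_lattice_near
  -- Multiplication by v maps the lattice into itself and shrinks the approximation error C to less
  -- than ε off the free direction, at the price of enlarging it to |v.2| · C along it.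
  obtain ⟨v, hv, hv0, hvδ⟩ := h.exists_lattice_small (δ := ε / (C + 1)) (by positivity)
  refine ⟨2 * (|v.2| * C + 1), fun y => ?_⟩
  -- The free coordinate of the target exceeds the free error by 1, so the approximant has positive
  -- free coordinate.
  set p : Kbar β φ := (y, |v.2| * C + 1)
  obtain ⟨u, hu, hun⟩ := hnear (v⁻¹ * p)
  have hkey : p - v * u = v * (v⁻¹ * p - u) := by
    rw [mul_sub, ← mul_assoc, h.mul_inv_of_mem hv hv0, one_mul]
  have h1 : ‖(p - v * u).1‖ < ε := by
    rw [hkey, Prod.fst_mul]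
    calc _ ≤ ‖v.1‖ * ‖(v⁻¹ * p - u).1‖ := norm_mul_le _ _
      _ ≤ ‖v.1‖ * C := by gcongr; exact (norm_fst_le _).trans hun
      _ ≤ ε / (C + 1) * C := by gcongr
      _ < ε := by
        rw [div_mul_eq_mul_div, div_lt_iff₀ (by positivity)]; nlinarith
  have h2 : |(p - v * u).2| ≤ |v.2| * C := by
    rw [hkey, Prod.snd_mul, abs_mul]
    gcongr
    exact (norm_snd_le _).trans hun
  have h3 : (p - v * u).2 = |v.2| * C + 1 - (v * u).2 := rfl
  rw [h3, abs_le] at h2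
  refine ⟨v * u, h.mul_mem hv hu, by linarith, by linarith, ?_⟩
  rw [← norm_neg, neg_sub]
  exact h1

end Admissible

end Lattice

/-! ### The growth rate and the limit measure -/

section LimitMass

variable {β φ : ℝ}

/-- The points of the full space that are differences of values of words. -/
def IsDifference (β φ : ℝ) (x : Kbar β φ) : Prop := ∃ n, diffCount (betaBar β φ) n x ≠ 0

theorem diffCount_ne_zero_iff {R : Type*} [CommRing R] {b : R} {n : ℕ} {x : R} :
    diffCount b n x ≠ 0 ↔ ∃ a a' : Fin n → Fin 2, wordSum b a - wordSum b a' = x := by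
  rw [diffCount, Finset.card_ne_zero]
  constructor
  · rintro ⟨p, hp⟩
    exact ⟨p.1, p.2, (Finset.mem_filter.mp hp).2⟩
  · rintro ⟨a, a', h⟩
    exact ⟨(a, a'), Finset.mem_filter.mpr ⟨Finset.mem_univ _, h⟩⟩

theorem exists_digits_iff {R : Type*} [CommRing R] {b : R} {n : ℕ} {x : R} :
    (∃ a : Fin n → ℤ, (∀ i, a i ∈ ({-1, 0, 1} : Set ℤ)) ∧ x = ∑ i, (a i : R) * b ^ (i : ℕ)) ↔
      diffCount b n x ≠ 0 := by
  rw [diffCount_ne_zero_iff]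
  constructor
  · rintro ⟨a, ha, rfl⟩
    refine ⟨fun i => if a i = 1 then 1 else 0, fun i => if a i = -1 then 1 else 0, ?_⟩
    rw [wordSum, wordSum, ← Finset.sum_sub_distrib]
    refine Finset.sum_congr rfl fun i _ => ?_
    rcases ha i with h | h | (h : a i = 1) <;> simp [h]
  · rintro ⟨a, a', rfl⟩
    refine ⟨fun i => ((a i : ℕ) : ℤ) - ((a' i : ℕ) : ℤ), fun i => ?_, ?_⟩
    · have h1 := (a i).isLt
      have h2 := (a' i).isLt
      change _ = (-1 : ℤ) ∨ _ = (0 : ℤ) ∨ _ = (1 : ℤ)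
      dsimp only
      omega
    · rw [wordSum, wordSum, ← Finset.sum_sub_distrib]
      exact Finset.sum_congr rfl fun i _ => by push_cast; ring

theorem mem_spectrumSet_iff {x : Kbar β φ} :
    x ∈ spectrumSet β φ ↔ IsDifference β φ x ∧ x ∈ strip β φ := by
  rw [spectrumSet, IsDifference, Set.mem_inter_iff]
  simp only [← exists_digits_iff, Set.mem_ofPred_eq]

theorem pairCount_eq_diffCount {x : Kbar β φ} (hx : x ∈ strip β φ) (n : ℕ) :
    pairCount β φ n x = diffCount (betaBar β φ) n x := by
  rw [pairCount, if_pos hx, diffCount]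
  congr 1
  refine Finset.filter_congr fun p _ => ?_
  rw [wordSum, wordSum, ← Finset.sum_sub_distrib]
  simp only [sub_mul]

theorem radius_nonneg {z : ℂ} (hz : 1 < ‖z‖) : 0 ≤ radius z := by
  have : 0 < ‖z‖ - 1 := by linarith
  rw [radius]
  split_ifs <;> positivity

theorem one_lt_norm_of_mem_expanding {z : ℂ} (hz : z ∈ expanding β φ) : 1 < ‖z‖ :=
  (Finset.mem_filter.mp hz).2.1

theorem zero_mem_region : (0 : Ke β φ) ∈ region β φ :=
  ⟨fun z => by simpa using radius_nonneg (one_lt_norm_of_mem_expanding (Finset.mem_filter.mp z.2).1),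
   fun z => by simpa using radius_nonneg (one_lt_norm_of_mem_expanding (Finset.mem_filter.mp z.2).1)⟩

theorem zero_mem_strip : (0 : Kbar β φ) ∈ strip β φ := zero_mem_region

theorem isDifference_zero : IsDifference β φ 0 := ⟨0, by simp [diffCount_zero]⟩

theorem norm_conjVec_expanding_inv_lt : ‖(conjVec (expanding β φ))⁻¹‖ < 1 :=
  norm_conjVec_inv_lt_one fun _ hz => one_lt_norm_of_mem_expanding hz

theorem norm_conjVec_contracting_lt : ‖conjVec (contracting β)‖ < 1 :=
  norm_conjVec_lt_one fun _ hz => (Finset.mem_filter.mp hz).2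

theorem conjVec_expanding_mul_inv :
    conjVec (expanding β φ) * (conjVec (expanding β φ))⁻¹ = 1 :=
  conjVec_mul_inv fun z hz h0 => by
    have := one_lt_norm_of_mem_expanding hz
    rw [h0, norm_zero] at this
    linarith

theorem wordSum_fst_fst {n : ℕ} (a : Fin n → Fin 2) :
    (wordSum (betaBar β φ) a).1.1 = wordSum (conjVec (expanding β φ)) a :=
  map_wordSum ((RingHom.fst (Ke β φ) (Kc β)).comp (RingHom.fst _ ℝ)) _ a

theorem wordSum_fst_snd {n : ℕ} (a : Fin n → Fin 2) :
    (wordSum (betaBar β φ) a).1.2 = wordSum (conjVec (contracting β)) a :=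
  map_wordSum ((RingHom.snd (Ke β φ) (Kc β)).comp (RingHom.fst _ ℝ)) _ a

theorem wordSum_snd {n : ℕ} (a : Fin n → Fin 2) :
    (wordSum (betaBar β φ) a).2 = wordSum φ a :=
  map_wordSum (RingHom.snd (Ke β φ × Kc β) ℝ) _ a

theorem IsDifference.norm_contracting_le {x : Kbar β φ} (hx : IsDifference β φ x) :
    ‖x.1.2‖ ≤ (1 - ‖conjVec (contracting β)‖)⁻¹ := by
  obtain ⟨n, hn⟩ := hx
  obtain ⟨a, a', rfl⟩ := diffCount_ne_zero_iff.mp hn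
  rw [Prod.fst_sub, Prod.snd_sub, wordSum_fst_snd, wordSum_fst_snd]
  exact norm_wordSum_sub_le norm_one_coord_le norm_conjVec_contracting_lt a a'

namespace Admissible

variable (h : Admissible β φ)
include h

theorem ne_zero : φ ≠ 0 := by
  rintro rfl
  have := h.one_lt_abs
  simp at this
  linarith

theorem norm_inv_lt : ‖φ⁻¹‖ < 1 := by
  rw [norm_inv]
  exact inv_lt_one_of_one_lt₀ h.one_lt_abs

theorem betaBar_mem : betaBar β φ ∈ lattice β φ := h.mem_lattice.mpr ⟨Polynomial.X, by simp⟩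

theorem betaBar_mul_inv : betaBar β φ * (betaBar β φ)⁻¹ = 1 :=
  h.mul_inv_of_mem h.betaBar_mem fun h0 => h.ne_zero (congrArg Prod.snd h0)

theorem mem_lattice_of_isDifference {x : Kbar β φ} (hx : IsDifference β φ x) :
    x ∈ lattice β φ := by
  obtain ⟨n, hn⟩ := hx
  obtain ⟨a, c, rfl⟩ := diffCount_ne_zero_iff.mp hn
  exact h.sub_mem (h.wordSum_mem a) (h.wordSum_mem c)

/-- Differences with bounded expanding and free coordinates form a finite set. -/
theorem finite_isDifference (R : ℝ) :
    {x : Kbar β φ | IsDifference β φ x ∧ ‖x.1.1‖ ≤ R ∧ |x.2| ≤ R}.Finite := by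
  refine (h.finite_lattice_of_norm_le
    (max R (1 - ‖conjVec (contracting β)‖)⁻¹)).subset fun x hx => ?_
  refine ⟨h.mem_lattice_of_isDifference hx.1, ?_⟩
  refine max_le (max_le (hx.2.1.trans (le_max_left _ _)) ?_) (hx.2.2.trans (le_max_left _ _))
  exact hx.1.norm_contracting_le.trans (le_max_right _ _)

/-- At the splitting point of a coincidence the difference y of the upper words has bounded
contracting coordinate. It is also minus β⁻ᵐ times a difference of lower words, which bounds its
expanding and free coordinates. So y lies in a finite set independent of m and n. -/
theorem exists_diffCount_add_le : ∃ K : ℝ, ∀ m n : ℕ,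
    (diffCount (betaBar β φ) (m + n) 0 : ℝ) ≤
      K * (diffCount (betaBar β φ) m 0 * diffCount (betaBar β φ) n 0) := by
  set R := max (1 - ‖(conjVec (expanding β φ))⁻¹‖)⁻¹ (1 - ‖φ⁻¹‖)⁻¹
  refine ⟨(h.finite_isDifference R).toFinset.card, fun m n => ?_⟩
  have := diffCount_add_le (betaBar β φ) m n (h.finite_isDifference R).toFinset ?_
  · exact_mod_cast this
  intro a a' c c' h0
  rw [Set.Finite.mem_toFinset]
  set y := wordSum (betaBar β φ) c - wordSum (betaBar β φ) c' with hy
  refine ⟨⟨n, diffCount_ne_zero_iff.mpr ⟨c, c', rfl⟩⟩, ?_⟩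
  have hpow : (betaBar β φ)⁻¹ ^ m * betaBar β φ ^ m = 1 := by
    rw [← mul_pow, mul_comm, h.betaBar_mul_inv, one_pow]
  have hy' : y = -((betaBar β φ)⁻¹ ^ m *
      (wordSum (betaBar β φ) a - wordSum (betaBar β φ) a')) := by
    linear_combination (betaBar β φ)⁻¹ ^ m * h0 - y * hpow
  rw [hy']
  constructor
  · refine le_trans ?_ (le_max_left _ _)
    rw [Prod.fst_neg, Prod.fst_neg, norm_neg, Prod.fst_mul, Prod.fst_mul, Prod.fst_sub,
      Prod.fst_sub, wordSum_fst_fst, wordSum_fst_fst]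
    exact norm_pow_mul_wordSum_sub_le norm_one_coord_le conjVec_expanding_mul_inv
      norm_conjVec_expanding_inv_lt a a'
  · refine le_trans ?_ (le_max_right _ _)
    rw [Prod.snd_neg, abs_neg, Prod.snd_mul, Prod.snd_sub, wordSum_snd, wordSum_snd]
    exact norm_pow_mul_wordSum_sub_le (by simp) (mul_inv_cancel₀ h.ne_zero) h.norm_inv_lt a a'

/-- The lower bound 2 comes from the diagonal pairs (a, a). -/
theorem growthRate_spec : 2 ≤ growthRate β φ ∧
    (∀ n, (diffCount (betaBar β φ) n 0 : ℝ) ≤ growthRate β φ ^ n) ∧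
    ∃ K : ℝ, 0 < K ∧ ∀ n, growthRate β φ ^ n ≤ K * diffCount (betaBar β φ) n 0 := by
  obtain ⟨K, hK⟩ := h.exists_diffCount_add_le
  have h2 : ∀ n, (2 : ℝ) ^ n ≤ diffCount (betaBar β φ) n 0 := fun n => by
    exact_mod_cast two_pow_le_diffCount (betaBar β φ) n
  have h1 : ∀ n, (1 : ℝ) ≤ diffCount (betaBar β φ) n 0 := fun n =>
    (one_le_pow₀ one_le_two).trans (h2 n)
  obtain ⟨l, hl, hle, hge, hpos⟩ := exists_growth_rate (B := 4) h1
    (fun m n => by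
      have := diffCount_mul_le (betaBar β φ) m n 0 0
      rw [mul_zero, add_zero] at this
      exact_mod_cast this) hK
    (fun n => by exact_mod_cast diffCount_le (betaBar β φ) n 0)
  have heq : growthRate β φ = l := by
    refine Tendsto.limUnder_eq ?_
    simpa only [pairCount_eq_diffCount zero_mem_strip] using hl
  rw [heq]
  have hKpos : 0 < K := by
    have := hge 0
    rw [pow_zero] at this
    have h3 := h1 0
    by_contra hK0
    nlinarith
  refine ⟨?_, hle, K, hKpos, hge⟩
  have := (h2 1).trans (hle 1)
  simpa using this

theorem growthRate_pos : 0 < growthRate β φ := two_pos.trans_le h.growthRate_spec.1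

theorem isDifference_of_step {x : Kbar β φ} {i j : Fin 2}
    (hx : IsDifference β φ ((betaBar β φ)⁻¹ * (x - ((i : ℕ) : Kbar β φ) + ((j : ℕ) : Kbar β φ)))) :
    IsDifference β φ x := by
  obtain ⟨n, hn⟩ := hx
  refine ⟨n + 1, fun h0 => hn ?_⟩
  rw [diffCount_succ h.betaBar_mul_inv, Finset.sum_eq_zero_iff] at h0
  exact Finset.sum_eq_zero_iff.mp (h0 i (Finset.mem_univ _)) j (Finset.mem_univ _)

theorem exists_tendsto_mass (x : Kbar β φ) : ∃ y, Tendsto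
    (fun n : ℕ => (diffCount (betaBar β φ) n x : ℝ) / growthRate β φ ^ n) atTop (𝓝 y) := by
  obtain ⟨-, hle, K, hK, hge⟩ := h.growthRate_spec
  have hl := h.growthRate_pos
  set l := growthRate β φ
  set b := betaBar β φ
  set θ := max ‖(conjVec (expanding β φ))⁻¹‖ ‖φ⁻¹‖
  have hθ : θ < 1 := max_lt norm_conjVec_expanding_inv_lt h.norm_inv_lt
  -- A backward step sends norm at most R to norm at most θ(R + 1) in the expanding and free
  -- directions; R ≥ 1/(1 - θ) keeps this within R.
  set R := max (max ‖x.1.1‖ |x.2|) (1 - θ)⁻¹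
  have hR : θ * (R + 1) ≤ R := by
    have : 1 ≤ R * (1 - θ) := by
      calc 1 = (1 - θ)⁻¹ * (1 - θ) := (inv_mul_cancel₀ (by linarith)).symm
        _ ≤ _ := mul_le_mul_of_nonneg_right (le_max_right _ _) (by linarith)
    linarith
  have hR0 : 0 ≤ R := le_trans (inv_nonneg.mpr (by linarith)) (le_max_right _ _)
  have hstep : ∀ {A : Type} [NormedCommRing A] (h1 : ‖(1 : A)‖ ≤ 1) (c y : A) (i j : Fin 2),
      ‖c‖ ≤ θ → ‖y‖ ≤ R → ‖c * (y - ((i : ℕ) : A) + ((j : ℕ) : A))‖ ≤ R := by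
    intro A _ h1 c y i j hc hy
    refine le_trans ?_ hR
    refine (norm_mul_le _ _).trans ?_
    gcongr
    rw [sub_add]
    exact (norm_sub_le _ _).trans (add_le_add hy (norm_digit_sub_le h1 _ _))
  -- Points that are not differences step only to such points and carry no mass; the other points of
  -- E are differences with bounded coordinates, hence finite in number.
  set E : Set (Kbar β φ) := {y | ¬ IsDifference β φ y ∨ (‖y.1.1‖ ≤ R ∧ |y.2| ≤ R)}
  refine exists_tendsto_of_positive (ι := Fin 2 × Fin 2) (o := 0) (l := l) (δ := 1 / K) (E := E)
    (V := fun n y => (diffCount b n y : ℝ) / l ^ n)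
    (τ := fun p y => b⁻¹ * (y - ((p.1 : ℕ) : Kbar β φ) + ((p.2 : ℕ) : Kbar β φ)))
    hl.le ?_ ?_ ?_ (by positivity) ?_ ?_ ?_ ?_ ?_ x (Or.inr ⟨?_, ?_⟩)
  · intro n y
    rw [diffCount_succ h.betaBar_mul_inv, Fintype.sum_prod_type, pow_succ]
    push_cast
    simp only [← Finset.sum_div]
    field_simp
    rfl
  · intro y
    rw [diffCount_zero]
    split_ifs <;> simp
  · intro n y
    refine ⟨by positivity, div_le_one_of_le₀ (le_trans ?_ (hle n)) (by positivity)⟩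
    exact_mod_cast diffCount_le_diffCount_zero b n y
  · intro n
    rw [le_div_iff₀ (by positivity), one_div_mul_eq_div, div_le_iff₀ hK, mul_comm]
    exact hge n
  · intro m n y
    have := diffCount_mul_le b m n y 0
    rw [mul_zero, add_zero] at this
    rw [pow_add, div_mul_div_comm]
    gcongr
    exact_mod_cast this
  · rintro ⟨i, j⟩ y (hy | ⟨hy1, hy2⟩)
    · exact Or.inl fun hd => hy (h.isDifference_of_step hd)
    · refine Or.inr ⟨?_, ?_⟩
      · exact hstep norm_one_coord_le _ y.1.1 i j (le_max_left _ _) hy1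
      · exact hstep (by simp) (φ⁻¹) y.2 i j (le_max_right _ _) hy2
  · exact Or.inr ⟨by simpa using hR0, by simpa using hR0⟩
  · refine (h.finite_isDifference R).subset ?_
    rintro y ⟨hyE, n, hn⟩
    have hd : IsDifference β φ y := ⟨n, fun h0 => hn (by simp [b, h0])⟩
    exact ⟨hd, hyE.resolve_left (not_not.mpr hd)⟩
  · exact (le_max_left _ _).trans (le_max_left _ _)
  · exact (le_max_right _ _).trans (le_max_left _ _)

end Admissible

/-- The limit of the normalized number of pairs, without restriction to the strip. -/
noncomputable def mass (β φ : ℝ) (x : Kbar β φ) : ℝ :=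
  limUnder atTop fun n : ℕ => (diffCount (betaBar β φ) n x : ℝ) / growthRate β φ ^ n

theorem limitMass_eq_mass {x : Kbar β φ} (hx : x ∈ strip β φ) :
    limitMass β φ x = mass β φ x := by
  simp only [limitMass, mass, pairCount_eq_diffCount hx]

theorem mass_neg (x : Kbar β φ) : mass β φ (-x) = mass β φ x := by
  simp only [mass, diffCount_neg]

namespace Admissible

variable (h : Admissible β φ)
include h

theorem tendsto_mass (x : Kbar β φ) : Tendsto
    (fun n : ℕ => (diffCount (betaBar β φ) n x : ℝ) / growthRate β φ ^ n) atTop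
    (𝓝 (mass β φ x)) :=
  tendsto_nhds_limUnder (h.exists_tendsto_mass x)

theorem mass_nonneg (x : Kbar β φ) : 0 ≤ mass β φ x :=
  ge_of_tendsto' (h.tendsto_mass x) fun _ =>
    div_nonneg (Nat.cast_nonneg _) (pow_nonneg h.growthRate_pos.le _)

theorem mass_le_mass_zero (x : Kbar β φ) : mass β φ x ≤ mass β φ 0 :=
  le_of_tendsto_of_tendsto' (h.tendsto_mass x) (h.tendsto_mass 0) fun _ => by
    have := h.growthRate_pos
    gcongr
    exact diffCount_le_diffCount_zero _ _ x

theorem mass_zero_pos : 0 < mass β φ 0 := by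
  obtain ⟨-, -, K, hK, hge⟩ := h.growthRate_spec
  refine lt_of_lt_of_le (one_div_pos.mpr hK) (ge_of_tendsto' (h.tendsto_mass 0) fun n => ?_)
  have := h.growthRate_pos
  rw [le_div_iff₀ (by positivity), one_div_mul_eq_div, div_le_iff₀ hK, mul_comm]
  exact hge n

/-- Appending long coincidences to words with difference x and normalizing by λᵏ gives this in the
limit. It yields the positivity of μ and bounds finite counts by μ. -/
theorem diffCount_mul_mass_le (n : ℕ) (x : Kbar β φ) :
    (diffCount (betaBar β φ) n x : ℝ) * mass β φ 0 ≤ growthRate β φ ^ n * mass β φ x := by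
  have hl := h.growthRate_pos
  have h1 := (h.tendsto_mass 0).const_mul (diffCount (betaBar β φ) n x : ℝ)
  have h2 := (((tendsto_add_atTop_iff_nat n).mpr (h.tendsto_mass x)).const_mul
    (growthRate β φ ^ n))
  refine le_of_tendsto_of_tendsto' h1 h2 fun k => ?_
  have := diffCount_mul_le (betaBar β φ) n k x 0
  rw [mul_zero, add_zero, add_comm n k] at this
  rw [pow_add, mul_div_assoc', mul_div_assoc', mul_comm (growthRate β φ ^ k),
    mul_div_mul_left _ _ (by positivity)]
  gcongr
  exact_mod_cast this

theorem mass_pos {x : Kbar β φ} (hx : IsDifference β φ x) : 0 < mass β φ x := by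
  obtain ⟨n, hn⟩ := hx
  have h1 := h.diffCount_mul_mass_le n x
  have h2 : (0 : ℝ) < diffCount (betaBar β φ) n x := by exact_mod_cast Nat.pos_of_ne_zero hn
  exact pos_of_mul_pos_right ((mul_pos h2 h.mass_zero_pos).trans_le h1)
    (pow_nonneg h.growthRate_pos.le _)

theorem mass_eq_zero {x : Kbar β φ} (hx : ¬ IsDifference β φ x) : mass β φ x = 0 := by
  have hz : ∀ n, diffCount (betaBar β φ) n x = 0 := by
    simpa [IsDifference] using hx
  refine tendsto_nhds_unique (h.tendsto_mass x) ?_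
  simp [hz]

/-- This is the recursion on the lowest digits in the limit: μ is an eigenfunction of the transfer
operator with eigenvalue λ. -/
theorem growthRate_mul_mass (x : Kbar β φ) : growthRate β φ * mass β φ x =
    ∑ i : Fin 2, ∑ j : Fin 2,
      mass β φ ((betaBar β φ)⁻¹ * (x - ((i : ℕ) : Kbar β φ) + ((j : ℕ) : Kbar β φ))) := by
  have hl := h.growthRate_pos
  have h1 := ((tendsto_add_atTop_iff_nat 1).mpr (h.tendsto_mass x)).const_mul (growthRate β φ)
  refine tendsto_nhds_unique h1 ?_
  refine Tendsto.congr ?_ (tendsto_finsetSum _ fun i _ => tendsto_finsetSum _ fun j _ =>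
    h.tendsto_mass _)
  intro n
  rw [diffCount_succ h.betaBar_mul_inv, pow_succ]
  push_cast
  simp only [← Finset.sum_div]
  field_simp

end Admissible

end LimitMass

/-! ### The first return map -/

section FirstReturn

variable {β φ : ℝ}

theorem isCompact_region : IsCompact (region β φ) := by
  have hr : region β φ =
      (Set.univ.pi fun z : realPart (expanding β φ) => Metric.closedBall (0 : ℝ) (radius z.1)) ×ˢ
        (Set.univ.pi fun z : complexPart (expanding β φ) =>
          Metric.closedBall (0 : ℂ) (radius z.1)) := by
    ext x
    simp [region, Set.mem_pi]
  rw [hr]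
  exact (isCompact_univ_pi fun z => isCompact_closedBall _ _).prod
    (isCompact_univ_pi fun z => isCompact_closedBall _ _)

theorem neg_mem_region {x : Ke β φ} (hx : x ∈ region β φ) : -x ∈ region β φ :=
  ⟨fun z => by simpa using hx.1 z, fun z => by simpa using hx.2 z⟩

/-- The attractor is the continuous image of the compact product of digit sets, the digits -1, 0, 1
being coded by `Fin 3`. -/
theorem isCompact_attractor : IsCompact (attractor β) := by
  set w := conjVec (contracting β)
  set d : Fin 3 → ℤ := fun i => (i : ℤ) - 1
  set F : (ℕ → Fin 3) → Kc β := fun a => ∑' k, (d (a k) : Kc β) * w ^ k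
  have hpow : ∀ k : ℕ, ‖w ^ k‖ ≤ ‖w‖ ^ k := by
    intro k
    rcases Nat.eq_zero_or_pos k with rfl | hk
    · simpa using norm_one_coord_le
    · exact norm_pow_le' w hk
  have hd : ∀ i : Fin 3, ‖(d i : Kc β)‖ ≤ 1 := by
    intro i
    have h1 := norm_one_coord_le (J := contracting β)
    fin_cases i <;> simp [d, h1]
  have hF : Continuous F := by
    refine continuous_tsum (u := fun k => ‖w‖ ^ k) (fun k => ?_)
      (summable_geometric_of_lt_one (norm_nonneg _) norm_conjVec_contracting_lt) fun k a => ?_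
    · have h1 : Continuous fun i : Fin 3 => (d i : Kc β) := continuous_of_discreteTopology
      exact (h1.comp (continuous_apply k)).mul continuous_const
    · refine (norm_mul_le _ _).trans ?_
      calc _ ≤ 1 * ‖w‖ ^ k := by
            gcongr
            · exact hd _
            · exact hpow k
        _ = _ := one_mul _
  have hrange : attractor β = Set.range F := by
    ext x
    constructor
    · rintro ⟨a, ha, rfl⟩
      have hex : ∀ k, ∃ i : Fin 3, d i = a k := by
        intro k
        rcases ha k with h | h | (h : a k = 1)
        · exact ⟨0, by simp [d, h]⟩
        · exact ⟨1, by simp [d, h]⟩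
        · exact ⟨2, by simp [d, h]⟩
      choose i hi using hex
      exact ⟨i, by simp only [F, hi]; rfl⟩
    · rintro ⟨a, rfl⟩
      refine ⟨fun k => d (a k), fun k => ?_, rfl⟩
      have := (a k).isLt
      change _ = (-1 : ℤ) ∨ _ = (0 : ℤ) ∨ _ = (1 : ℤ)
      simp only [d]
      omega
  rw [hrange]
  exact isCompact_range hF

theorem isCompact_domain : IsCompact (domain β φ) := isCompact_region.prod isCompact_attractor

theorem openDomain_subset_domain : openDomain β φ ⊆ domain β φ :=
  Set.prod_mono le_rfl interior_subset

theorem measurableSet_openDomain : MeasurableSet (openDomain β φ) :=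
  isCompact_region.measurableSet.prod isOpen_interior.measurableSet

theorem exists_closedBall_subset_region : ∃ r > 0, Metric.closedBall (0 : Ke β φ) r ⊆ region β φ := by
  have hpos : ∀ z ∈ expanding β φ, 0 < radius z := by
    intro z hz
    have := one_lt_norm_of_mem_expanding hz
    have : 0 < ‖z‖ - 1 := by linarith
    rw [radius]
    split_ifs <;> positivity
  obtain ⟨r, hr, hle⟩ : ∃ r > 0, ∀ z ∈ expanding β φ, r ≤ radius z := by
    rcases (expanding β φ).eq_empty_or_nonempty with he | hne
    · exact ⟨1, one_pos, by simp [he]⟩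
    · obtain ⟨z, hz, hmin⟩ := (expanding β φ).exists_min_image radius hne
      exact ⟨radius z, hpos z hz, hmin⟩
  refine ⟨r, hr, fun x hx => ?_⟩
  rw [mem_closedBall_zero_iff] at hx
  exact ⟨fun z => ((norm_le_pi_norm x.1 z).trans ((norm_fst_le x).trans hx)).trans
      (hle _ (Finset.mem_filter.mp z.2).1),
    fun z => ((norm_le_pi_norm x.2 z).trans ((norm_snd_le x).trans hx)).trans
      (hle _ (Finset.mem_filter.mp z.2).1)⟩

theorem countable_lattice : (lattice β φ).Countable := by
  refine (Set.countable_range fun a : Fin (minpoly ℚ β).natDegree → ℤ =>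
    ∑ i, (a i : Kbar β φ) * betaBar β φ ^ (i : ℕ)).mono ?_
  rintro x ⟨a, rfl⟩
  exact ⟨a, rfl⟩

theorem measurableSet_isFirstReturn (u : Kbar β φ) :
    MeasurableSet {x | IsFirstReturn β φ x u} := by
  have hm : ∀ v : Kbar β φ, MeasurableSet {x : Ke β φ × Kc β | x + v.1 ∈ openDomain β φ} :=
    fun v => measurableSet_openDomain.preimage (continuous_add_const v.1).measurable
  have heq : {x | IsFirstReturn β φ x u} =
      ({x | u ∈ lattice β φ} ∩ ({x | 0 < u.2} ∩ {x | x + u.1 ∈ openDomain β φ})) ∩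
        ⋂ v ∈ lattice β φ, ({x | 0 < v.2 ∧ ¬ u.2 ≤ v.2} ∩ {x | x + v.1 ∈ openDomain β φ})ᶜ := by
    ext x
    simp only [IsFirstReturn, Set.mem_ofPred_eq, Set.mem_inter_iff, Set.mem_iInter,
      Set.mem_compl_iff]
    refine and_congr Iff.rfl (forall₂_congr fun v _ => ?_)
    tauto
  rw [heq]
  refine ((MeasurableSet.const _).inter ((MeasurableSet.const _).inter (hm u))).inter ?_
  exact MeasurableSet.biInter countable_lattice fun v _ =>
    ((MeasurableSet.const _).inter (hm v)).compl

/-- The lattice vector of the first return to `I × int 𝓡`, and zero outside that set. -/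
noncomputable def returnVec (β φ : ℝ) (x : Ke β φ × Kc β) : Kbar β φ :=
  if hx : x ∈ openDomain β φ ∧ ∃ u, IsFirstReturn β φ x u then hx.2.choose else 0

/-- The first return map to `I × int 𝓡`, extended by the identity. -/
noncomputable def returnMap (β φ : ℝ) (x : Ke β φ × Kc β) : Ke β φ × Kc β :=
  x + (returnVec β φ x).1

/-- The orbit of the origin in the full space under the first return map. -/
noncomputable def returnOrbit (β φ : ℝ) : ℕ → Kbar β φ
  | 0 => 0
  | k + 1 => returnOrbit β φ k + returnVec β φ (returnOrbit β φ k).1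

theorem returnOrbit_fst (k : ℕ) : (returnOrbit β φ k).1 = (returnMap β φ)^[k] 0 := by
  induction k with
  | zero => rfl
  | succ k ih =>
    rw [Function.iterate_succ_apply', ← ih]
    rfl

theorem mem_spectrumSet (hc : CutAndProjectCondition β φ) {x : Kbar β φ} :
    x ∈ spectrumSet β φ ↔ x ∈ lattice β φ ∧ x.1 ∈ openDomain β φ := by
  rw [hc]
  exact ⟨fun hx => ⟨hx.1.1, hx.2, hx.1.2⟩, fun hx => ⟨⟨hx.1, hx.2.2⟩, hx.2.1⟩⟩

theorem zero_mem_spectrumSet : (0 : Kbar β φ) ∈ spectrumSet β φ :=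
  mem_spectrumSet_iff.mpr ⟨isDifference_zero, zero_mem_strip⟩

/-- The empty sum lies in the spectrum, so Condition 1 forces 0 into int 𝓡. In particular the
interior is not empty, which makes first returns possible. -/
theorem zero_mem_openDomain (hc : CutAndProjectCondition β φ) :
    (0 : Ke β φ × Kc β) ∈ openDomain β φ :=
  ((mem_spectrumSet hc).mp zero_mem_spectrumSet).2

theorem returnVec_of_notMem {x : Ke β φ × Kc β} (hx : x ∉ openDomain β φ) :
    returnVec β φ x = 0 := dif_neg fun h' => hx h'.1

theorem returnMap_of_notMem {x : Ke β φ × Kc β} (hx : x ∉ openDomain β φ) :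
    returnMap β φ x = x := by
  rw [returnMap, returnVec_of_notMem hx, Prod.fst_zero, add_zero]

namespace Admissible

variable (h : Admissible β φ)
include h

theorem firstReturn_unique {x : Ke β φ × Kc β} {u v : Kbar β φ} (hu : IsFirstReturn β φ x u)
    (hv : IsFirstReturn β φ x v) : u = v := by
  have h1 := hu.2 v hv.1.1 hv.1.2.1 hv.1.2.2
  have h2 := hv.2 u hu.1.1 hu.1.2.1 hu.1.2.2
  have h3 := h.eq_zero_of_free (h.sub_mem hu.1.1 hv.1.1)
    (show u.2 - v.2 = 0 by linarith)
  exact sub_eq_zero.mp h3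

/-- First returns exist and take finitely many values. -/
theorem exists_firstReturn (hc : CutAndProjectCondition β φ) :
    ∃ U : Finset (Kbar β φ), ∀ x ∈ openDomain β φ, ∃ u ∈ U, IsFirstReturn β φ x u := by
  obtain ⟨ε, hε, hball⟩ : ∃ ε > 0, Metric.ball (0 : Ke β φ × Kc β) ε ⊆ openDomain β φ := by
    obtain ⟨r, hr, hrI⟩ := exists_closedBall_subset_region (β := β) (φ := φ)
    obtain ⟨r', hr', hrR⟩ := Metric.isOpen_iff.mp isOpen_interior _ (zero_mem_openDomain hc).2
    refine ⟨min r r', lt_min hr hr', fun x hx => ?_⟩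
    rw [mem_ball_zero_iff] at hx
    refine ⟨hrI ?_, hrR ?_⟩
    · rw [mem_closedBall_zero_iff]
      exact (norm_fst_le x).trans (hx.le.trans (min_le_left _ _))
    · change x.2 ∈ Metric.ball 0 r'
      rw [mem_ball_zero_iff]
      exact (norm_snd_le x).trans_lt (hx.trans_le (min_le_right _ _))
  -- Density supplies, from every starting point, a lattice vector with free coordinate at most L
  -- that leads into the ball about 0.
  obtain ⟨L, hL⟩ := h.exists_lattice_dense hε
  obtain ⟨M, hM⟩ := (isCompact_domain (β := β) (φ := φ)).isBounded.exists_norm_le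
  set U := (h.finite_lattice_of_norm_le (max (M + M) L)).toFinset
  -- A returning vector is a difference of two points of the bounded set D in all but the free
  -- direction, so the candidates up to height L form one finite set for all x.
  have hU : ∀ x ∈ openDomain β φ, ∀ v ∈ lattice β φ, 0 < v.2 → v.2 ≤ L →
      x + v.1 ∈ openDomain β φ → v ∈ U := by
    intro x hx v hv h0 hvL hxv
    refine (Set.Finite.mem_toFinset _).mpr ⟨hv, max_le ?_ ?_⟩
    · refine le_trans ?_ (le_max_left _ _)
      have h1 : v.1 = (x + v.1) - x := by abel
      rw [h1]
      exact (norm_sub_le _ _).trans (add_le_add (hM _ (openDomain_subset_domain hxv))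
        (hM _ (openDomain_subset_domain hx)))
    · rw [Real.norm_eq_abs, abs_of_pos h0]
      exact hvL.trans (le_max_right _ _)
  refine ⟨U, fun x hx => ?_⟩
  set S := U.filter fun v => v ∈ lattice β φ ∧ 0 < v.2 ∧ x + v.1 ∈ openDomain β φ
  obtain ⟨v₀, hv₀, hv₀pos, hv₀L, hv₀x⟩ := hL (-x)
  have hv₀D : x + v₀.1 ∈ openDomain β φ := hball (by
    rw [mem_ball_zero_iff]; rwa [sub_neg_eq_add, add_comm] at hv₀x)
  have hv₀S : v₀ ∈ S :=
    Finset.mem_filter.mpr ⟨hU x hx v₀ hv₀ hv₀pos hv₀L hv₀D, hv₀, hv₀pos, hv₀D⟩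
  obtain ⟨u, hu, hmin⟩ := S.exists_min_image (fun v => v.2) ⟨v₀, hv₀S⟩
  have hu' := Finset.mem_filter.mp hu
  refine ⟨u, hu'.1, hu'.2, fun v hv hv0 hvx => ?_⟩
  rcases le_or_gt v.2 L with hvL | hvL
  · exact hmin v (Finset.mem_filter.mpr ⟨hU x hx v hv hv0 hvL hvx, hv, hv0, hvx⟩)
  · exact (hmin v₀ hv₀S).trans (hv₀L.trans hvL.le)

theorem returnVec_spec (hc : CutAndProjectCondition β φ) {x : Ke β φ × Kc β}
    (hx : x ∈ openDomain β φ) : IsFirstReturn β φ x (returnVec β φ x) := by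
  obtain ⟨U, hU⟩ := h.exists_firstReturn hc
  obtain ⟨u, -, hu⟩ := hU x hx
  have hex : x ∈ openDomain β φ ∧ ∃ u, IsFirstReturn β φ x u := ⟨hx, u, hu⟩
  rw [returnVec, dif_pos hex]
  exact hex.2.choose_spec

theorem finite_range_returnVec (hc : CutAndProjectCondition β φ) :
    (Set.range (returnVec β φ)).Finite := by
  obtain ⟨U, hU⟩ := h.exists_firstReturn hc
  refine (insert 0 U).finite_toSet.subset ?_
  rintro _ ⟨x, rfl⟩
  rw [Finset.mem_coe, Finset.mem_insert]
  by_cases hx : x ∈ openDomain β φ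
  · obtain ⟨u, huU, hu⟩ := hU x hx
    rw [h.firstReturn_unique (h.returnVec_spec hc hx) hu]
    exact Or.inr huU
  · exact Or.inl (returnVec_of_notMem hx)

theorem measurableSet_returnVec_eq (hc : CutAndProjectCondition β φ) (u : Kbar β φ) :
    MeasurableSet {x | x ∈ domain β φ ∧ returnVec β φ x = u} := by
  have heq : {x | x ∈ domain β φ ∧ returnVec β φ x = u} =
      (openDomain β φ ∩ {x | IsFirstReturn β φ x u}) ∪
        ((domain β φ \ openDomain β φ) ∩ {_x | (0 : Kbar β φ) = u}) := by
    ext x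
    by_cases hx : x ∈ openDomain β φ
    · simp only [Set.mem_ofPred_eq, Set.mem_union, Set.mem_inter_iff, hx, Set.mem_sdiff,
        not_true_eq_false, and_false, false_and, or_false, true_and]
      refine ⟨fun h1 => h1.2 ▸ h.returnVec_spec hc hx, fun h1 => ⟨openDomain_subset_domain hx, ?_⟩⟩
      exact h.firstReturn_unique (h.returnVec_spec hc hx) h1
    · simp [hx, returnVec_of_notMem hx]
  rw [heq]
  exact (measurableSet_openDomain.inter (measurableSet_isFirstReturn u)).union
    ((isCompact_domain.measurableSet.diff measurableSet_openDomain).inter (MeasurableSet.const _))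

theorem returnMap_mem_openDomain (hc : CutAndProjectCondition β φ) {x : Ke β φ × Kc β}
    (hx : x ∈ openDomain β φ) : returnMap β φ x ∈ openDomain β φ :=
  (h.returnVec_spec hc hx).1.2.2

theorem mapsTo_returnMap (hc : CutAndProjectCondition β φ) :
    Set.MapsTo (returnMap β φ) (domain β φ) (domain β φ) := by
  intro x hx
  by_cases hxo : x ∈ openDomain β φ
  · exact openDomain_subset_domain (h.returnMap_mem_openDomain hc hxo)
  · rwa [returnMap_of_notMem hxo]

/-- If x had a shorter return than y to the same point, the difference of the return vectors would
carry y to x earlier than the first return of y. -/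
theorem returnVec_free_le_of_eq (hc : CutAndProjectCondition β φ) {x y : Ke β φ × Kc β}
    (hx : x ∈ openDomain β φ) (hy : y ∈ openDomain β φ) (hxy : returnMap β φ x = returnMap β φ y) :
    (returnVec β φ y).2 ≤ (returnVec β φ x).2 := by
  by_contra! hlt
  have hux := h.returnVec_spec hc hx
  have huy := h.returnVec_spec hc hy
  have h1 := huy.2 (returnVec β φ y - returnVec β φ x) (h.sub_mem huy.1.1 hux.1.1)
    (by simpa using hlt) (by
      have : y + (returnVec β φ y - returnVec β φ x).1 = x := by
        rw [Prod.fst_sub, ← add_sub_assoc]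
        change returnMap β φ y - _ = x
        rw [← hxy, returnMap, add_sub_cancel_right]
      rwa [this])
  have h2 := hux.1.2.1
  rw [Prod.snd_sub] at h1
  linarith

theorem injOn_returnMap (hc : CutAndProjectCondition β φ) :
    Set.InjOn (returnMap β φ) (domain β φ) := by
  intro x _ y _ hxy
  by_cases hx : x ∈ openDomain β φ
  · by_cases hy : y ∈ openDomain β φ
    · have h1 := h.returnVec_free_le_of_eq hc hx hy hxy
      have h2 := h.returnVec_free_le_of_eq hc hy hx hxy.symm
      have h3 := h.eq_zero_of_free (h.sub_mem (h.returnVec_spec hc hx).1.1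
        (h.returnVec_spec hc hy).1.1)
        (show (returnVec β φ x).2 - (returnVec β φ y).2 = 0 by linarith)
      rw [sub_eq_zero] at h3
      rw [returnMap, returnMap, h3] at hxy
      exact add_right_cancel hxy
    · rw [returnMap_of_notMem hy] at hxy
      exact absurd (hxy ▸ h.returnMap_mem_openDomain hc hx) hy
  · by_cases hy : y ∈ openDomain β φ
    · rw [returnMap_of_notMem hx] at hxy
      exact absurd (hxy ▸ h.returnMap_mem_openDomain hc hy) hx
    · rwa [returnMap_of_notMem hx, returnMap_of_notMem hy] at hxy

/-! ### The orbit of the origin enumerates the spectrum -/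

/-- By the cut and project description, the spectrum points above x are the translates of x by the
lattice vectors with positive free coordinate that carry x.1 back into I × int 𝓡. -/
theorem isSuccessor_add_returnVec (hc : CutAndProjectCondition β φ) {x : Kbar β φ}
    (hx : x ∈ spectrumSet β φ) : IsSuccessor β φ x (x + returnVec β φ x.1) := by
  have hx' := (mem_spectrumSet hc).mp hx
  have hr := h.returnVec_spec hc hx'.2
  refine ⟨⟨(mem_spectrumSet hc).mpr ⟨h.add_mem hx'.1 hr.1.1, hr.1.2.2⟩, ?_⟩, fun z hz hxz => ?_⟩
  · rw [Prod.snd_add]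
    linarith [hr.1.2.1]
  · have hz' := (mem_spectrumSet hc).mp hz
    have h1 := hr.2 (z - x) (h.sub_mem hz'.1 hx'.1) (by simpa using hxz) (by
      have : x.1 + (z - x).1 = z.1 := by simp
      rw [this]
      exact hz'.2)
    rw [Prod.snd_sub] at h1
    rw [Prod.snd_add]
    linarith

theorem returnOrbit_mem (hc : CutAndProjectCondition β φ) (k : ℕ) :
    returnOrbit β φ k ∈ spectrumSet β φ := by
  induction k with
  | zero => exact zero_mem_spectrumSet
  | succ k ih => exact (h.isSuccessor_add_returnVec hc ih).1.1

theorem isSuccessor_returnOrbit (hc : CutAndProjectCondition β φ) (k : ℕ) :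
    IsSuccessor β φ (returnOrbit β φ k) (returnOrbit β φ (k + 1)) :=
  h.isSuccessor_add_returnVec hc (h.returnOrbit_mem hc k)

theorem strictMono_returnOrbit (hc : CutAndProjectCondition β φ) :
    StrictMono fun k => (returnOrbit β φ k).2 :=
  strictMono_nat_of_lt_succ fun k => (h.isSuccessor_returnOrbit hc k).1.2

theorem finite_spectrumSet (R : ℝ) : {x ∈ spectrumSet β φ | |x.2| ≤ R}.Finite := by
  obtain ⟨M, hM⟩ := (isCompact_region (β := β) (φ := φ)).isBounded.exists_norm_le
  refine (h.finite_isDifference (max M R)).subset ?_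
  rintro x ⟨hx, hxR⟩
  have hx' := mem_spectrumSet_iff.mp hx
  exact ⟨hx'.1, (hM _ hx'.2).trans (le_max_left _ _), hxR.trans (le_max_right _ _)⟩

theorem exists_returnOrbit_gt (hc : CutAndProjectCondition β φ) (R : ℝ) :
    ∃ k, R < (returnOrbit β φ k).2 := by
  by_contra! hle
  have hinj : Function.Injective (returnOrbit β φ) := fun i j hij =>
    (h.strictMono_returnOrbit hc).injective (congrArg Prod.snd hij)
  refine Set.infinite_of_injective_forall_mem hinj (fun k => ?_) (h.finite_spectrumSet R)
  refine ⟨h.returnOrbit_mem hc k, ?_⟩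
  have h0 : (0 : ℝ) ≤ (returnOrbit β φ k).2 :=
    (h.strictMono_returnOrbit hc).monotone (Nat.zero_le k)
  rw [abs_of_nonneg h0]
  exact hle k

theorem exists_isGreatest_returnOrbit (hc : CutAndProjectCondition β φ) {R : ℝ} (hR : 0 ≤ R) :
    ∃ m, IsGreatest {k | (returnOrbit β φ k).2 ≤ R} m := by
  obtain ⟨K, hK⟩ := h.exists_returnOrbit_gt hc R
  have hbdd : BddAbove {k | (returnOrbit β φ k).2 ≤ R} := by
    refine ⟨K, fun k hk => ?_⟩
    by_contra! hlt
    exact absurd ((h.strictMono_returnOrbit hc hlt).trans_le hk) (not_lt.mpr hK.le)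
  exact ⟨_, Nat.sSup_mem ⟨0, hR⟩ hbdd, fun k hk => le_csSup hbdd hk⟩

/-- The orbit is unbounded in the free direction and skips no spectrum point, and the free
coordinate identifies a lattice point. -/
theorem exists_returnOrbit_eq (hc : CutAndProjectCondition β φ) {x : Kbar β φ}
    (hx : x ∈ spectrumSet β φ) (h0 : 0 ≤ x.2) : ∃ k, returnOrbit β φ k = x := by
  obtain ⟨m, hm, hmax⟩ := h.exists_isGreatest_returnOrbit hc h0
  refine ⟨m, ?_⟩
  have hm' : (returnOrbit β φ m).2 ≤ x.2 := hm
  have hle : x.2 ≤ (returnOrbit β φ m).2 := by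
    by_contra! hlt
    have h1 := hmax ((h.isSuccessor_returnOrbit hc m).2 x hx hlt)
    omega
  have h3 := h.eq_zero_of_free (h.sub_mem ((mem_spectrumSet hc).mp (h.returnOrbit_mem hc m)).1
    ((mem_spectrumSet hc).mp hx).1)
    (show (returnOrbit β φ m).2 - x.2 = 0 by linarith)
  exact sub_eq_zero.mp h3

end Admissible

end FirstReturn

/-! ### Lebesgue measure on the expanding space -/

section Volume

variable {β φ : ℝ} {J : Finset ℂ}

theorem prod_norm_eq (hJ : ∀ z ∈ J, (starRingEnd ℂ) z ∈ J) :
    ∏ z ∈ J, ‖z‖ = (∏ z : realPart J, ‖z.1‖) * ∏ z : complexPart J, ‖z.1‖ ^ 2 := by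
  have h1 : ∏ z ∈ J.filter (fun z => z.im < 0), ‖z‖ = ∏ z ∈ complexPart J, ‖z‖ := by
    refine Finset.prod_bij' (fun z _ => (starRingEnd ℂ) z) (fun z _ => (starRingEnd ℂ) z)
      ?_ ?_ ?_ ?_ ?_
    · intro z hz
      rw [Finset.mem_filter] at hz
      exact Finset.mem_filter.mpr ⟨hJ z hz.1, by simpa using hz.2⟩
    · intro z hz
      rw [complexPart, Finset.mem_filter] at hz
      exact Finset.mem_filter.mpr ⟨hJ z hz.1, by simpa using hz.2⟩
    · intro z _; simp
    · intro z _; simp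
    · intro z _; simp
  have h4 : (J.filter fun z : ℂ => ¬ z.im = 0).filter (fun z => 0 < z.im) = complexPart J := by
    rw [Finset.filter_filter, complexPart]
    exact Finset.filter_congr fun z _ => ⟨fun h => h.2, fun h => ⟨h.ne', h⟩⟩
  have h5 : (J.filter fun z : ℂ => ¬ z.im = 0).filter (fun z => ¬ 0 < z.im) =
      J.filter fun z => z.im < 0 := by
    rw [Finset.filter_filter]
    exact Finset.filter_congr fun z _ =>
      ⟨fun h => lt_of_le_of_ne (not_lt.mp h.2) h.1, fun h => ⟨h.ne, not_lt.mpr h.le⟩⟩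
  rw [← Finset.prod_filter_mul_prod_filter_not J (fun z : ℂ => z.im = 0),
    ← Finset.prod_filter_mul_prod_filter_not (J.filter fun z : ℂ => ¬ z.im = 0)
      (fun z : ℂ => 0 < z.im), h4, h5, h1, ← Finset.prod_mul_distrib]
  rw [Finset.prod_coe_sort (realPart J) (fun z => ‖z‖),
    Finset.prod_coe_sort (complexPart J) (fun z => ‖z‖ ^ 2)]
  simp only [realPart, sq]

/-- Each complex coordinate contributes |z|² to the real determinant, which accounts for both
members of the pair. -/
theorem abs_det_mulLeft_conjVec (hJ : ∀ z ∈ J, (starRingEnd ℂ) z ∈ J) :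
    |LinearMap.det (LinearMap.mulLeft ℝ (conjVec J))| = ∏ z ∈ J, ‖z‖ := by
  have heq : LinearMap.mulLeft ℝ (conjVec J) = LinearMap.prodMap
      (LinearMap.pi fun z : realPart J => (LinearMap.mulLeft ℝ (z.1.re)).comp (LinearMap.proj z))
      (LinearMap.pi fun z : complexPart J => (LinearMap.mulLeft ℝ z.1).comp (LinearMap.proj z)) :=
    LinearMap.ext fun x => rfl
  rw [heq, LinearMap.det_prodMap, LinearMap.det_pi, LinearMap.det_pi, prod_norm_eq hJ, abs_mul,
    Finset.abs_prod, Finset.abs_prod]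
  congr 1
  · refine Finset.prod_congr rfl fun z _ => ?_
    rw [LinearMap.det_mulLeft, re_norm_of_mem_realPart]
  · refine Finset.prod_congr rfl fun z _ => ?_
    have h1 : LinearMap.det (LinearMap.mulLeft ℝ z.1) = Algebra.norm ℝ z.1 := rfl
    rw [h1, Algebra.norm_complex_apply, Complex.normSq_eq_norm_sq, abs_of_nonneg (by positivity)]

instance isAddHaarMeasure_volume_coord : (volume : Measure (Coord J)).IsAddHaarMeasure :=
  Measure.prod.instIsAddHaarMeasure volume volume

theorem expandingProduct_pos : 0 < expandingProduct β φ :=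
  Finset.prod_pos fun _ hz => one_pos.trans (one_lt_norm_of_mem_expanding hz)

theorem inv_pow_mul_pow (n : ℕ) :
    (conjVec (expanding β φ))⁻¹ ^ n * conjVec (expanding β φ) ^ n = 1 := by
  rw [← mul_pow, mul_comm, conjVec_expanding_mul_inv, one_pow]

theorem Admissible.volume_dilate (h : Admissible β φ) (n : ℕ) (A : Set (Ke β φ)) :
    volume {y : Ke β φ | (conjVec (expanding β φ))⁻¹ ^ n * y ∈ A} =
      ENNReal.ofReal (expandingProduct β φ ^ n) * volume A := by
  have heq : {y : Ke β φ | (conjVec (expanding β φ))⁻¹ ^ n * y ∈ A} =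
      LinearMap.mulLeft ℝ (conjVec (expanding β φ) ^ n) '' A := by
    ext y
    constructor
    · intro hy
      refine ⟨_, hy, ?_⟩
      rw [LinearMap.mulLeft_apply, ← mul_assoc, mul_comm (_ ^ n), inv_pow_mul_pow, one_mul]
    · rintro ⟨x, hx, rfl⟩
      rw [LinearMap.mulLeft_apply, Set.mem_ofPred_eq, ← mul_assoc, inv_pow_mul_pow, one_mul]
      exact hx
  rw [heq, Measure.addHaar_image_linearMap, ← LinearMap.pow_mulLeft, map_pow, abs_pow,
    abs_det_mulLeft_conjVec h.conj_expanding]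
  rfl

/-- A packing estimate: balls contained in a set of finite measure cannot be too many if few
pairs of their centres are close. -/
theorem card_ball_subset_le {E : Type*} [NormedAddCommGroup E] [MeasurableSpace E] [BorelSpace E]
    (μ : Measure E) [μ.IsAddLeftInvariant] [IsFiniteMeasureOnCompacts μ] [ProperSpace E]
    {α : Type*} [Fintype α] (y : α → E)
    {ε : ℝ} {A : Set E} (hA : MeasurableSet A) (hA' : μ A ≠ ⊤) {t : ℝ} (ht : 0 < t) :
    2 * ((Finset.univ.filter fun a => Metric.closedBall (y a) ε ⊆ A).card : ℝ) *
        μ.real (Metric.closedBall 0 ε) ≤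
      t * μ.real A + t⁻¹ * (μ.real (Metric.closedBall 0 ε) *
        (Finset.univ.filter fun p : α × α => ‖y p.1 - y p.2‖ ≤ 2 * ε).card) := by
  set S := Finset.univ.filter fun a => Metric.closedBall (y a) ε ⊆ A
  set B : α → Set E := fun a => Metric.closedBall (y a) ε
  set v := μ.real (Metric.closedBall 0 ε)
  have hBv : ∀ a, μ.real (B a) = v := fun a => by
    have h1 : B a = (fun x => -(y a) + x) ⁻¹' Metric.closedBall 0 ε := by
      ext x
      simp [B, dist_eq_norm, neg_add_eq_sub]
    rw [Measure.real, h1, measure_preimage_add]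
    rfl
  have hBm : ∀ a, MeasurableSet (B a) := fun a => Metric.isClosed_closedBall.measurableSet
  have hBfin : ∀ a, μ (B a) ≠ ⊤ := fun a => (isCompact_closedBall _ _).measure_lt_top.ne
  have hint : ∀ {s : Set E}, MeasurableSet s → μ s ≠ ⊤ →
      Integrable (s.indicator fun _ => (1 : ℝ)) μ := fun hs hs' =>
    (integrable_indicator_iff hs).mpr (integrableOn_const hs')
  -- F counts how many of the chosen balls cover a point. Its integral counts balls, and the
  -- integral of its square only sees pairs of overlapping balls.
  set F : E → ℝ := fun x => ∑ a ∈ S, (B a).indicator (fun _ => (1 : ℝ)) x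
  have hsq : ∀ x, F x ^ 2 =
      ∑ a ∈ S, ∑ b ∈ S, (B a ∩ B b).indicator (fun _ => (1 : ℝ)) x := by
    intro x
    rw [sq, Finset.sum_mul_sum]
    refine Finset.sum_congr rfl fun a _ => Finset.sum_congr rfl fun b _ => ?_
    by_cases ha : x ∈ B a <;> by_cases hb : x ∈ B b <;> simp [ha, hb]
  -- Inside A this is the arithmetic-geometric mean inequality with a free parameter t; outside A
  -- the function F vanishes.
  have hpt : ∀ x, 2 * F x ≤ t * A.indicator (fun _ => (1 : ℝ)) x + t⁻¹ * F x ^ 2 := by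
    intro x
    by_cases hx : x ∈ A
    · rw [Set.indicator_of_mem hx]
      have h1 : t * (t⁻¹ * F x ^ 2) = F x ^ 2 := by field_simp
      have h2 : 0 ≤ (t - F x) ^ 2 := sq_nonneg _
      have h3 : 0 ≤ t * (t * 1 + t⁻¹ * F x ^ 2 - 2 * F x) := by nlinarith
      linarith [nonneg_of_mul_nonneg_right h3 ht]
    · have hF0 : F x = 0 := Finset.sum_eq_zero fun a ha =>
        Set.indicator_of_notMem (fun hxa => hx ((Finset.mem_filter.mp ha).2 hxa)) _
      rw [hF0, Set.indicator_of_notMem hx]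
      simp
  have hiB : ∀ a b, Integrable ((B a ∩ B b).indicator fun _ => (1 : ℝ)) μ := fun a b =>
    hint ((hBm a).inter (hBm b)) (measure_ne_top_of_subset Set.inter_subset_left (hBfin a))
  have hiF : Integrable F μ := integrable_finsetSum _ fun a _ => hint (hBm a) (hBfin a)
  have hiF2 : Integrable (fun x => F x ^ 2) μ := by
    simp only [hsq]
    exact integrable_finsetSum _ fun a _ => integrable_finsetSum _ fun b _ => hiB a b
  have hmono := integral_mono (hiF.const_mul 2)
    (((hint hA hA').const_mul t).add (hiF2.const_mul t⁻¹)) hpt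
  have hF : ∫ x, F x ∂μ = S.card * v := by
    rw [integral_finsetSum _ fun a _ => hint (hBm a) (hBfin a)]
    simp [integral_indicator_const, hBm, hBv]
  have hF2 : ∫ x, F x ^ 2 ∂μ ≤
      v * (Finset.univ.filter fun p : α × α => ‖y p.1 - y p.2‖ ≤ 2 * ε).card := by
    simp only [hsq]
    rw [integral_finsetSum _ fun a _ => integrable_finsetSum _ fun b _ => hiB a b]
    simp only [integral_finsetSum _ fun b _ => hiB _ b]
    calc ∑ a ∈ S, ∑ b ∈ S, ∫ x, (B a ∩ B b).indicator (fun _ => (1 : ℝ)) x ∂μ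
        ≤ ∑ a ∈ S, ∑ b ∈ S, if ‖y a - y b‖ ≤ 2 * ε then v else 0 := by
          refine Finset.sum_le_sum fun a _ => Finset.sum_le_sum fun b _ => ?_
          rw [integral_indicator_const _ ((hBm a).inter (hBm b)), smul_eq_mul, mul_one]
          split_ifs with hab
          · rw [← hBv a]
            exact measureReal_mono Set.inter_subset_left (hBfin a)
          · have hempty : B a ∩ B b = ∅ := by
              refine Set.eq_empty_of_forall_notMem fun x hx => hab ?_
              have h1 := Metric.mem_closedBall'.mp hx.1
              have h2 := Metric.mem_closedBall.mp hx.2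
              rw [← dist_eq_norm]
              linarith [dist_triangle (y a) x (y b)]
            simp [hempty]
      _ ≤ ∑ a, ∑ b, if ‖y a - y b‖ ≤ 2 * ε then v else 0 := by
          have hnn : ∀ a b, 0 ≤ if ‖y a - y b‖ ≤ 2 * ε then v else 0 := fun a b => by
            split_ifs
            exacts [measureReal_nonneg, le_rfl]
          refine (Finset.sum_le_sum fun a _ => Finset.sum_le_univ_sum_of_nonneg
            fun b => hnn a b).trans (Finset.sum_le_univ_sum_of_nonneg
            fun a => Finset.sum_nonneg fun b _ => hnn a b)
      _ = _ := by
          rw [← Fintype.sum_prod_type' (f := fun a b => if ‖y a - y b‖ ≤ 2 * ε then v else 0),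
            ← Finset.sum_filter, Finset.sum_const, nsmul_eq_mul, mul_comm]
  rw [integral_const_mul, hF, integral_add' ((hint hA hA').const_mul t) (hiF2.const_mul t⁻¹),
    integral_const_mul, integral_const_mul, integral_indicator_const _ hA, smul_eq_mul,
    mul_one] at hmono
  calc 2 * (S.card : ℝ) * v = 2 * (S.card * v) := by ring
    _ ≤ _ := hmono
    _ ≤ _ := by gcongr

/-- The number of pairs of words whose values differ by an element of `I` in the expanding
directions. -/
noncomputable def closePairs (β φ : ℝ) (n : ℕ) : ℕ :=
  (Finset.univ.filter fun p : (Fin n → Fin 2) × (Fin n → Fin 2) =>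
    wordSum (conjVec (expanding β φ)) p.1 - wordSum (conjVec (expanding β φ)) p.2 ∈
      region β φ).card

theorem card_le_closePairs {ε : ℝ} (hε : Metric.closedBall (0 : Ke β φ) (2 * ε) ⊆ region β φ)
    (n : ℕ) : (Finset.univ.filter fun p : (Fin n → Fin 2) × (Fin n → Fin 2) =>
      ‖wordSum (conjVec (expanding β φ)) p.1 - wordSum (conjVec (expanding β φ)) p.2‖ ≤
        2 * ε).card ≤ closePairs β φ n := by
  refine Finset.card_le_card fun p hp => ?_
  rw [Finset.mem_filter] at hp ⊢
  exact ⟨hp.1, hε (mem_closedBall_zero_iff.mpr hp.2)⟩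

theorem exists_radius : ∃ ε > 0, Metric.closedBall (0 : Ke β φ) (2 * ε) ⊆ region β φ := by
  obtain ⟨r, hr, hsub⟩ := exists_closedBall_subset_region (β := β) (φ := φ)
  exact ⟨r / 2, by positivity, by rwa [mul_div_cancel₀ _ two_ne_zero]⟩

theorem norm_inv_pow_mul_le (n : ℕ) (x : Ke β φ) :
    ‖(conjVec (expanding β φ))⁻¹ ^ n * x‖ ≤ ‖(conjVec (expanding β φ))⁻¹‖ ^ n * ‖x‖ := by
  refine (norm_mul_le _ _).trans ?_
  gcongr
  rcases Nat.eq_zero_or_pos n with rfl | hn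
  · simpa using norm_one_coord_le
  · exact norm_pow_le' _ hn

/-- There are always at least as many close pairs as for a uniform distribution. -/
theorem Admissible.exists_le_closePairs (h : Admissible β φ) :
    ∃ c > 0, ∀ n, c * (4 / expandingProduct β φ) ^ n ≤ closePairs β φ n := by
  obtain ⟨ε, hε, hsub⟩ := exists_radius (β := β) (φ := φ)
  set w := conjVec (expanding β φ)
  set P := expandingProduct β φ
  have hP : 0 < P := expandingProduct_pos
  -- With this radius every ball of radius ε about a word value lies in the n-fold dilate of the
  -- ball of radius R.
  set R := (1 - ‖w⁻¹‖)⁻¹ + ε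
  have hθ : ‖w⁻¹‖ < 1 := norm_conjVec_expanding_inv_lt
  have hR : 0 < R := by
    have : 0 < 1 - ‖w⁻¹‖ := by linarith
    positivity
  set v := (volume : Measure (Ke β φ)).real (Metric.closedBall 0 ε)
  set V := (volume : Measure (Ke β φ)).real (Metric.closedBall 0 R)
  have hball : ∀ {r : ℝ}, 0 < r → 0 < (volume : Measure (Ke β φ)).real (Metric.closedBall 0 r) :=
    fun hr => ENNReal.toReal_pos (Metric.measure_closedBall_pos _ _ hr).ne'
      (isCompact_closedBall _ _).measure_lt_top.ne
  have hv : 0 < v := hball hε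
  have hV : 0 < V := hball hR
  refine ⟨v / V, by positivity, fun n => ?_⟩
  set A : Set (Ke β φ) := {y | w⁻¹ ^ n * y ∈ Metric.closedBall 0 R}
  have hA : MeasurableSet A :=
    (Metric.isClosed_closedBall.preimage (continuous_const.mul continuous_id)).measurableSet
  have hAv : volume A = ENNReal.ofReal (P ^ n) * volume (Metric.closedBall (0 : Ke β φ) R) :=
    h.volume_dilate n _
  have hAr : (volume : Measure (Ke β φ)).real A = P ^ n * V := by
    rw [Measure.real, hAv, ENNReal.toReal_mul, ENNReal.toReal_ofReal (by positivity)]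
    rfl
  have hAfin : volume A ≠ ⊤ := by
    rw [hAv]
    exact ENNReal.mul_ne_top ENNReal.ofReal_ne_top (isCompact_closedBall _ _).measure_lt_top.ne
  have hall : (Finset.univ.filter fun a : Fin n → Fin 2 =>
      Metric.closedBall (wordSum w a) ε ⊆ A) = Finset.univ := by
    refine Finset.filter_true_of_mem fun a _ y hy => ?_
    change w⁻¹ ^ n * y ∈ Metric.closedBall 0 R
    rw [mem_closedBall_zero_iff]
    have h1 : w⁻¹ ^ n * y = w⁻¹ ^ n * (wordSum w a - wordSum w (0 : Fin n → Fin 2)) +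
        w⁻¹ ^ n * (y - wordSum w a) := by
      have : wordSum w (0 : Fin n → Fin 2) = 0 := by simp [wordSum]
      rw [this]; ring
    rw [h1]
    refine (norm_add_le _ _).trans (add_le_add ?_ ?_)
    · exact norm_pow_mul_wordSum_sub_le norm_one_coord_le conjVec_expanding_mul_inv hθ a 0
    · refine (norm_inv_pow_mul_le n _).trans ?_
      have h2 : ‖y - wordSum w a‖ ≤ ε := by rwa [← dist_eq_norm]
      calc _ ≤ 1 * ε := by
            gcongr
            exact pow_le_one₀ (norm_nonneg _) hθ.le
        _ = ε := one_mul ε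
  -- This t makes the volume term exactly half of the left side, so the close pairs must account for
  -- the other half.
  set t := 2 ^ n * v / (P ^ n * V)
  have ht : 0 < t := by positivity
  have hmain := card_ball_subset_le volume (fun a : Fin n → Fin 2 => wordSum w a) (ε := ε) hA hAfin ht
  rw [hall, hAr, Finset.card_univ, Fintype.card_fun, Fintype.card_fin, Fintype.card_fin] at hmain
  have hclose : ((Finset.univ.filter fun p : (Fin n → Fin 2) × (Fin n → Fin 2) =>
      ‖wordSum w p.1 - wordSum w p.2‖ ≤ 2 * ε).card : ℝ) ≤ closePairs β φ n := by
    exact_mod_cast card_le_closePairs hsub n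
  have h1 : t * (P ^ n * V) = 2 ^ n * v := div_mul_cancel₀ _ (by positivity)
  have h2 : (2 : ℝ) ^ n * v ≤ t⁻¹ * (v * closePairs β φ n) := by
    have h3 : t⁻¹ * (v * ((Finset.univ.filter fun p : (Fin n → Fin 2) × (Fin n → Fin 2) =>
      ‖wordSum w p.1 - wordSum w p.2‖ ≤ 2 * ε).card : ℝ)) ≤ t⁻¹ * (v * closePairs β φ n) := by
      gcongr
    rw [h1] at hmain
    push_cast at hmain
    change _ ≤ _ + t⁻¹ * (v * _) at hmain
    linarith
  rw [inv_mul_eq_div, le_div_iff₀ ht] at h2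
  have h4 : v / V * (4 / P) ^ n = 2 ^ n * v * t / v := by
    simp only [t]
    rw [div_pow, show (4 : ℝ) = 2 * 2 by norm_num, mul_pow]
    field_simp
  rw [h4, div_le_iff₀ hv]
  linarith

end Volume

/-! ### The self-affine measure -/

section SelfAffine

variable {β φ : ℝ}

/-- Coin tossing measure on the space of binary sequences. -/
noncomputable def coinMeasure : Measure (ℕ → Fin 2) :=
  Measure.infinitePi fun _ => (PMF.uniformOfFintype (Fin 2)).toMeasure

instance isProbabilityMeasure_coinMeasure : IsProbabilityMeasure coinMeasure := by
  rw [coinMeasure]; infer_instance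

/-- Prepending a digit to a sequence. -/
def prepend (p : Fin 2 × (ℕ → Fin 2)) : ℕ → Fin 2 := fun n => Nat.casesOn n p.1 p.2

theorem prepend_zero (p : Fin 2 × (ℕ → Fin 2)) : prepend p 0 = p.1 := rfl

theorem prepend_succ (p : Fin 2 × (ℕ → Fin 2)) (n : ℕ) : prepend p (n + 1) = p.2 n := rfl

theorem measurable_prepend : Measurable prepend := by
  refine measurable_pi_lambda _ fun n => ?_
  cases n with
  | zero => exact measurable_fst
  | succ n => exact (measurable_pi_apply n).comp measurable_snd

theorem map_prepend :
    ((PMF.uniformOfFintype (Fin 2)).toMeasure.prod coinMeasure).map prepend = coinMeasure := by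
  set μ := (PMF.uniformOfFintype (Fin 2)).toMeasure
  refine Measure.eq_infinitePi (μ := fun _ : ℕ => μ) fun s t ht => ?_
  obtain ⟨N, hN⟩ : ∃ N, s ⊆ Finset.range (N + 1) :=
    ⟨s.sup id, fun k hk => Finset.mem_range.mpr (Nat.lt_succ_of_le (Finset.le_sup (f := id) hk))⟩
  -- Padding with the full set turns the cylinder into one over an initial segment, where splitting
  -- off coordinate 0 is a shift of the index.
  set t' : ℕ → Set (Fin 2) := fun n => if n ∈ s then t n else Set.univ
  have hpre : prepend ⁻¹' (Set.pi s t) =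
      t' 0 ×ˢ Set.pi (Finset.range N : Set ℕ) fun n => t' (n + 1) := by
    ext p
    simp only [Set.mem_preimage, Set.mem_pi, Finset.mem_coe, Set.mem_prod]
    constructor
    · intro hp
      refine ⟨?_, fun n _ => ?_⟩
      · by_cases h0 : 0 ∈ s
        · simpa [t', h0, prepend_zero, prepend_succ] using hp 0 h0
        · simp [t', h0]
      · by_cases h0 : n + 1 ∈ s
        · simpa [t', h0, prepend_zero, prepend_succ] using hp (n + 1) h0
        · simp [t', h0]
    · rintro ⟨h1, h2⟩ n hn
      cases n with
      | zero => simpa [t', hn, prepend_zero, prepend_succ] using h1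
      | succ n =>
        have hlt := Finset.mem_range.mp (hN hn)
        simpa [t', hn, prepend_zero, prepend_succ] using h2 n (Finset.mem_range.mpr (by omega))
  rw [Measure.map_apply measurable_prepend (MeasurableSet.pi s.countable_toSet fun i _ => ht i),
    hpre, Measure.prod_prod, coinMeasure, Measure.infinitePi_pi _ (fun i _ => .of_discrete)]
  calc μ (t' 0) * ∏ n ∈ Finset.range N, μ (t' (n + 1))
      = ∏ n ∈ Finset.range (N + 1), μ (t' n) := by rw [Finset.prod_range_succ', mul_comm]
    _ = ∏ n ∈ s, μ (t' n) := by
        refine (Finset.prod_subset hN fun n _ hn => ?_).symm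
        simp [t', hn]
    _ = ∏ n ∈ s, μ (t n) := Finset.prod_congr rfl fun n hn => by simp [t', hn]

/-- The random series `∑ aₖ β⁻⁽ᵏ⁺¹⁾` in the expanding space. -/
noncomputable def randomSeries (β φ : ℝ) (a : ℕ → Fin 2) : Ke β φ :=
  ∑' k, ((a k : ℕ) : Ke β φ) * (conjVec (expanding β φ))⁻¹ ^ (k + 1)

theorem norm_randomSeries_term_le (a : ℕ → Fin 2) (k : ℕ) :
    ‖((a k : ℕ) : Ke β φ) * (conjVec (expanding β φ))⁻¹ ^ (k + 1)‖ ≤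
      ‖(conjVec (expanding β φ))⁻¹‖ ^ (k + 1) := by
  have h1 : ‖((a k : ℕ) : Ke β φ)‖ ≤ 1 := by
    simpa using norm_digit_sub_le (A := Ke β φ) norm_one_coord_le (a k) 0
  calc _ ≤ ‖((a k : ℕ) : Ke β φ)‖ * ‖(conjVec (expanding β φ))⁻¹ ^ (k + 1)‖ := norm_mul_le _ _
    _ ≤ 1 * ‖(conjVec (expanding β φ))⁻¹‖ ^ (k + 1) := by
        gcongr
        exact norm_pow_le' _ (Nat.succ_pos k)
    _ = _ := one_mul _

theorem summable_norm_inv_pow :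
    Summable fun k : ℕ => ‖(conjVec (expanding β φ))⁻¹‖ ^ (k + 1) :=
  (summable_nat_add_iff 1).mpr
    (summable_geometric_of_lt_one (norm_nonneg _) norm_conjVec_expanding_inv_lt)

theorem continuous_randomSeries : Continuous (randomSeries β φ) := by
  refine continuous_tsum (fun k => ?_) (summable_norm_inv_pow (β := β) (φ := φ))
    fun k a => norm_randomSeries_term_le a k
  have h1 : Continuous fun i : Fin 2 => ((i : ℕ) : Ke β φ) := continuous_of_discreteTopology
  exact (h1.comp (continuous_apply k)).mul continuous_const

theorem norm_randomSeries_le (a : ℕ → Fin 2) :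
    ‖randomSeries β φ a‖ ≤ ∑' k : ℕ, ‖(conjVec (expanding β φ))⁻¹‖ ^ (k + 1) :=
  tsum_of_norm_bounded summable_norm_inv_pow.hasSum fun k => norm_randomSeries_term_le a k

theorem randomSeries_prepend (i : Fin 2) (a : ℕ → Fin 2) : randomSeries β φ (prepend (i, a)) =
    (conjVec (expanding β φ))⁻¹ * (((i : ℕ) : Ke β φ) + randomSeries β φ a) := by
  have hs : ∀ a : ℕ → Fin 2,
      Summable fun k => ((a k : ℕ) : Ke β φ) * (conjVec (expanding β φ))⁻¹ ^ (k + 1) := fun a =>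
    Summable.of_norm_bounded summable_norm_inv_pow fun k => norm_randomSeries_term_le a k
  rw [randomSeries, (hs _).tsum_eq_zero_add, mul_add, randomSeries, ← (hs a).tsum_mul_left]
  congr 1
  · change ((i : ℕ) : Ke β φ) * _ ^ (0 + 1) = _
    ring
  · refine tsum_congr fun k => ?_
    change ((a k : ℕ) : Ke β φ) * _ ^ (k + 1 + 1) = _
    ring

theorem affMap_image_neg (i : Fin 2) (A : Set (Ke β φ)) :
    affMap β φ (-((i : ℕ) : ℤ)) '' A =
      {t | (conjVec (expanding β φ))⁻¹ * (((i : ℕ) : Ke β φ) + t) ∈ A} := by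
  ext t
  constructor
  · rintro ⟨x, hx, rfl⟩
    have h1 : (conjVec (expanding β φ))⁻¹ * (((i : ℕ) : Ke β φ) + affMap β φ (-((i : ℕ) : ℤ)) x) =
        x := by
      rw [affMap]
      push_cast
      linear_combination x * conjVec_expanding_mul_inv (β := β) (φ := φ)
    rw [Set.mem_ofPred_eq, h1]
    exact hx
  · intro ht
    refine ⟨_, ht, ?_⟩
    rw [affMap]
    push_cast
    linear_combination (((i : ℕ) : Ke β φ) + t) * conjVec_expanding_mul_inv (β := β) (φ := φ)

theorem isSelfAffineMeasure_iff {ν : Measure (Ke β φ)} : IsSelfAffineMeasure β φ ν ↔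
    IsProbabilityMeasure ν ∧ ∀ A : Set (Ke β φ), MeasurableSet A → ν A =
      (∑ i : Fin 2, ν {t | (conjVec (expanding β φ))⁻¹ * (((i : ℕ) : Ke β φ) + t) ∈ A}) / 2 := by
  have h0 := affMap_image_neg (β := β) (φ := φ) 0
  have h1 := affMap_image_neg (β := β) (φ := φ) 1
  simp only [Fin.isValue, Fin.val_zero, Fin.val_one, Nat.cast_zero, neg_zero, Nat.cast_one]
    at h0 h1
  rw [IsSelfAffineMeasure]
  simp only [h0, h1, Fin.sum_univ_two, Fin.isValue, Fin.val_zero, Fin.val_one, Nat.cast_zero,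
    Nat.cast_one]

/-- The invariance is the effect of splitting off the first digit: coin tossing measure is unchanged
when an independent fair digit is prepended. -/
theorem isSelfAffineMeasure_map : IsSelfAffineMeasure β φ (coinMeasure.map (randomSeries β φ)) := by
  have hX : Measurable (randomSeries β φ) := continuous_randomSeries.measurable
  refine isSelfAffineMeasure_iff.mpr
    ⟨Measure.isProbabilityMeasure_map hX.aemeasurable, fun A hA => ?_⟩
  have hA' : ∀ i : Fin 2, MeasurableSet
      {t | (conjVec (expanding β φ))⁻¹ * (((i : ℕ) : Ke β φ) + t) ∈ A} := fun i =>
    hA.preimage (continuous_const.mul (continuous_const.add continuous_id)).measurable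
  rw [Measure.map_apply hX hA]
  conv_lhs => rw [← map_prepend]
  rw [Measure.map_apply measurable_prepend (hX hA),
    Measure.prod_apply (measurable_prepend (hX hA)), lintegral_fintype]
  simp only [PMF.toMeasure_apply_singleton _ _ (MeasurableSet.of_discrete),
    PMF.uniformOfFintype_apply, Fintype.card_fin, Nat.cast_ofNat]
  rw [ENNReal.div_eq_inv_mul, Finset.mul_sum]
  refine Finset.sum_congr rfl fun i _ => ?_
  rw [mul_comm, Measure.map_apply hX (hA' i)]
  congr 2
  ext a
  simp only [Set.mem_preimage, randomSeries_prepend, Set.mem_ofPred_eq]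

theorem IsSelfAffineMeasure.iterate {ν : Measure (Ke β φ)} (hν : IsSelfAffineMeasure β φ ν)
    (n : ℕ) {A : Set (Ke β φ)} (hA : MeasurableSet A) :
    ν A = (2 ^ n)⁻¹ * ∑ a : Fin n → Fin 2,
      ν {t | (conjVec (expanding β φ))⁻¹ ^ n * (wordSum (conjVec (expanding β φ)) a + t) ∈ A} := by
  induction n with
  | zero => simp [wordSum]
  | succ n ih =>
    rw [ih, sum_words_succ, Finset.sum_comm, pow_succ,
      ENNReal.mul_inv (Or.inr (by simp)) (Or.inr (by simp)), mul_assoc, Finset.mul_sum (a := 2⁻¹)]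
    congr 1
    refine Finset.sum_congr rfl fun a _ => ?_
    have hm : MeasurableSet {t | (conjVec (expanding β φ))⁻¹ ^ n *
        (wordSum (conjVec (expanding β φ)) a + t) ∈ A} :=
      hA.preimage (continuous_const.mul (continuous_const.add continuous_id)).measurable
    rw [(isSelfAffineMeasure_iff.mp hν).2 _ hm, ENNReal.div_eq_inv_mul]
    congr 1
    refine Finset.sum_congr rfl fun i _ => ?_
    congr 1
    ext t
    simp only [Set.mem_ofPred_eq, wordSum_cons]
    have : (conjVec (expanding β φ))⁻¹ ^ n * (wordSum (conjVec (expanding β φ)) a +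
          (conjVec (expanding β φ))⁻¹ * (((i : ℕ) : Ke β φ) + t)) =
        (conjVec (expanding β φ))⁻¹ ^ (n + 1) * (((i : ℕ) : Ke β φ) +
          conjVec (expanding β φ) * wordSum (conjVec (expanding β φ)) a + t) := by
      linear_combination (-(conjVec (expanding β φ))⁻¹ ^ n *
        wordSum (conjVec (expanding β φ)) a) * conjVec_expanding_mul_inv (β := β) (φ := φ)
    rw [this]

/-- If close pairs are at most as frequent as for a uniform distribution, up to a constant, a
self-affine measure of bounded support is absolutely continuous. -/
theorem Admissible.absolutelyContinuous (h : Admissible β φ) {ν : Measure (Ke β φ)}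
    (hν : IsSelfAffineMeasure β φ ν) {R : ℝ} (hR : 0 ≤ R)
    (hνR : ∀ᵐ x ∂ν, ‖x‖ ≤ R) {C : ℝ}
    (hC : ∀ n, (closePairs β φ n : ℝ) ≤ C * (4 / expandingProduct β φ) ^ n) : ν ≪ volume := by
  have := hν.1
  obtain ⟨ε, hε, hsub⟩ := exists_radius (β := β) (φ := φ)
  set w := conjVec (expanding β φ)
  set P := expandingProduct β φ
  have hP : 0 < P := expandingProduct_pos
  set v := (volume : Measure (Ke β φ)).real (Metric.closedBall 0 ε)
  have hv : 0 < v := ENNReal.toReal_pos (Metric.measure_closedBall_pos _ _ hε).ne'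
      (isCompact_closedBall _ _).measure_lt_top.ne
  have hC0 : 0 ≤ C := by
    have h1 := hC 0
    rw [pow_zero, mul_one] at h1
    exact (Nat.cast_nonneg _).trans h1
  have hθ : ‖w⁻¹‖ < 1 := norm_conjVec_expanding_inv_lt
  -- For open O this is the packing estimate in the limit n → ∞. The parameter κ trades the volume
  -- of O against the constant of the close pairs.
  have hopen : ∀ (O : Set (Ke β φ)) (κ : ℝ), IsOpen O → volume O ≠ ⊤ → 0 < κ →
      ν.real O ≤ κ * volume.real O / v + C / κ := by
    intro O κ hO hOfin hκ
    -- The margin covers the image under the n-th contraction of a support point together with a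
    -- ball of radius ε. The extended distance handles an empty complement.
    set On : ℕ → Set (Ke β φ) := fun n =>
      {x | ENNReal.ofReal (‖w⁻¹‖ ^ n * (ε + R)) < Metric.infEDist x Oᶜ}
    have hOn : ∀ n, IsOpen (On n) := fun n =>
      isOpen_lt continuous_const Metric.continuous_infEDist
    have hmono : Monotone On := by
      intro i j hij x hx
      refine lt_of_le_of_lt (ENNReal.ofReal_le_ofReal ?_) hx
      gcongr ?_ * _
      exact pow_le_pow_of_le_one (norm_nonneg _) hθ.le hij
    have hunion : O ⊆ ⋃ n, On n := by
      intro x hx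
      have h1 : 0 < Metric.infEDist x Oᶜ := by
        rw [Metric.infEDist_pos_iff_notMem_closure, hO.isClosed_compl.closure_eq]
        exact fun h' => h' hx
      have h2 : Tendsto (fun n : ℕ => ENNReal.ofReal (‖w⁻¹‖ ^ n * (ε + R))) atTop (𝓝 0) := by
        have := ENNReal.tendsto_ofReal ((tendsto_pow_atTop_nhds_zero_of_lt_one
          (norm_nonneg w⁻¹) hθ).mul_const (ε + R))
        simpa using this
      obtain ⟨n, hn⟩ := (h2.eventually (gt_mem_nhds h1)).exists
      exact Set.mem_iUnion.mpr ⟨n, hn⟩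
    have hbound : ∀ n, ν.real (On n) ≤ κ * volume.real O / v + C / κ := by
      intro n
      set A : Set (Ke β φ) := {y | w⁻¹ ^ n * y ∈ O}
      have hA : MeasurableSet A :=
        (hO.preimage (continuous_const.mul continuous_id)).measurableSet
      have hAv : volume A = ENNReal.ofReal (P ^ n) * volume O := h.volume_dilate n _
      have hAr : (volume : Measure (Ke β φ)).real A = P ^ n * volume.real O := by
        rw [Measure.real, hAv, ENNReal.toReal_mul, ENNReal.toReal_ofReal (by positivity)]
        rfl
      have hAfin : volume A ≠ ⊤ := by
        rw [hAv]
        exact ENNReal.mul_ne_top ENNReal.ofReal_ne_top hOfin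
      set S := Finset.univ.filter fun a : Fin n → Fin 2 => Metric.closedBall (wordSum w a) ε ⊆ A
      -- If the ball about a word value leaves A, some y in it has its contraction outside O. All
      -- support points translated by that word contract to within the margin of it, hence miss `On
      -- n`.
      have hcount : ν (On n) ≤ (2 ^ n)⁻¹ * (S.card : ENNReal) := by
        rw [hν.iterate n (hOn n).measurableSet]
        gcongr
        have hS : (S.card : ENNReal) = ∑ a : Fin n → Fin 2,
            if Metric.closedBall (wordSum w a) ε ⊆ A then (1 : ENNReal) else 0 := by
          rw [Finset.sum_boole]
        rw [hS]
        refine Finset.sum_le_sum fun a _ => ?_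
        split_ifs with ha
        · exact prob_le_one
        · refine le_of_eq (measure_mono_null (t := {x | ¬ ‖x‖ ≤ R}) (fun t ht htR => ha ?_) hνR)
          intro y hy
          change w⁻¹ ^ n * y ∈ O
          by_contra hyO
          have h1 : Metric.infEDist (w⁻¹ ^ n * (wordSum w a + t)) Oᶜ ≤
              edist (w⁻¹ ^ n * (wordSum w a + t)) (w⁻¹ ^ n * y) :=
            Metric.infEDist_le_edist_of_mem hyO
          have h2 : ENNReal.ofReal (‖w⁻¹‖ ^ n * (ε + R)) <
            Metric.infEDist (w⁻¹ ^ n * (wordSum w a + t)) Oᶜ := ht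
          have h3 := h2.trans_le h1
          rw [edist_dist] at h3
          refine absurd h3 (not_lt.mpr (ENNReal.ofReal_le_ofReal ?_))
          rw [dist_eq_norm, ← mul_sub]
          refine (norm_inv_pow_mul_le n _).trans ?_
          gcongr
          have h4 : ‖wordSum w a - y‖ ≤ ε := by
            rw [← dist_eq_norm, dist_comm]; exact hy
          calc ‖wordSum w a + t - y‖ = ‖(wordSum w a - y) + t‖ := by congr 1; ring
            _ ≤ ε + R := (norm_add_le _ _).trans (add_le_add h4 htR)
      have hcount' : ν.real (On n) ≤ (2 ^ n)⁻¹ * S.card := by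
        have := ENNReal.toReal_mono (ENNReal.mul_ne_top (by simp) (by simp)) hcount
        simpa [Measure.real] using this
      -- This scaling makes both terms of the packing estimate equal to 2ⁿ times a quantity
      -- independent of n.
      set t := κ * (2 / P) ^ n
      have ht : 0 < t := by positivity
      have hmain := card_ball_subset_le volume (fun a : Fin n → Fin 2 => wordSum w a) (ε := ε)
        hA hAfin ht
      rw [hAr] at hmain
      change 2 * (S.card : ℝ) * v ≤ t * _ + t⁻¹ * (v * _) at hmain
      have hclose : ((Finset.univ.filter fun p : (Fin n → Fin 2) × (Fin n → Fin 2) =>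
          ‖wordSum w p.1 - wordSum w p.2‖ ≤ 2 * ε).card : ℝ) ≤ C * (4 / P) ^ n :=
        le_trans (by exact_mod_cast card_le_closePairs hsub n) (hC n)
      have h3 : 2 * (S.card : ℝ) * v ≤
          t * (P ^ n * volume.real O) + t⁻¹ * (v * (C * (4 / P) ^ n)) :=
        hmain.trans (by gcongr)
      have h5 : t * (P ^ n * volume.real O) + t⁻¹ * (v * (C * (4 / P) ^ n)) =
          2 ^ n * v * (κ * volume.real O / v + C / κ) := by
        simp only [t]
        rw [div_pow, div_pow, show (4 : ℝ) = 2 * 2 by norm_num, mul_pow]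
        field_simp
      rw [h5] at h3
      refine hcount'.trans ?_
      rw [inv_mul_le_iff₀ (by positivity)]
      have h6 : 0 ≤ κ * volume.real O / v + C / κ := by positivity
      have h7 : 0 ≤ (S.card : ℝ) := Nat.cast_nonneg _
      have h8 : (S.card : ℝ) * v ≤ 2 ^ n * (κ * volume.real O / v + C / κ) * v := by
        nlinarith [mul_nonneg h7 hv.le]
      exact le_of_mul_le_mul_right h8 hv
    have hlim := (tendsto_measure_iUnion_atTop (μ := ν) hmono)
    have hlim' : Tendsto (fun n => ν.real (On n)) atTop (𝓝 (ν.real (⋃ n, On n))) :=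
      (ENNReal.tendsto_toReal (measure_ne_top _ _)).comp hlim
    exact (measureReal_mono hunion).trans (le_of_tendsto' hlim' hbound)
  refine Measure.AbsolutelyContinuous.mk fun N _ hN => ?_
  have hzero : ν.real N ≤ 0 := by
    refine le_of_forall_pos_le_add fun η hη => ?_
    -- Each term of the bound becomes at most η/2; using C + 1 keeps κ positive when C = 0.
    set κ := 2 * (C + 1) / η
    have hκ : 0 < κ := by positivity
    obtain ⟨O, hNO, hO, hOv⟩ := N.exists_isOpen_lt_of_lt (μ := (volume : Measure (Ke β φ)))
      (ENNReal.ofReal (η * v / (2 * κ))) (by rw [hN]; simp; positivity)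
    have hOfin : volume O ≠ ⊤ := (hOv.trans ENNReal.ofReal_lt_top).ne
    have hOr : volume.real O ≤ η * v / (2 * κ) := by
      have := ENNReal.toReal_mono ENNReal.ofReal_ne_top hOv.le
      rwa [ENNReal.toReal_ofReal (by positivity)] at this
    calc ν.real N ≤ ν.real O := measureReal_mono hNO
      _ ≤ κ * volume.real O / v + C / κ := hopen O κ hO hOfin hκ
      _ ≤ κ * (η * v / (2 * κ)) / v + (C + 1) / κ := by gcongr; linarith
      _ = 0 + η := by simp only [κ]; field_simp; ring
  have := le_antisymm hzero measureReal_nonneg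
  exact (measureReal_eq_zero_iff).mp this

end SelfAffine

/-! ### Uniqueness of the self-affine measure via characteristic functions -/

section Uniqueness

variable {β φ : ℝ}

theorem IsSelfAffineMeasure.eq_sum_map {ν : Measure (Ke β φ)} (hν : IsSelfAffineMeasure β φ ν) :
    ν = (2 : ENNReal)⁻¹ • ∑ i : Fin 2, ν.map fun t =>
      (conjVec (expanding β φ))⁻¹ * (((i : ℕ) : Ke β φ) + t) := by
  ext A hA
  rw [(isSelfAffineMeasure_iff.mp hν).2 A hA, Measure.smul_apply, Measure.finsetSum_apply,
    ENNReal.div_eq_inv_mul, smul_eq_mul]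
  congr 1
  refine Finset.sum_congr rfl fun i _ => ?_
  have hm : Measurable fun t : Ke β φ =>
      (conjVec (expanding β φ))⁻¹ * (((i : ℕ) : Ke β φ) + t) :=
    (continuous_const.mul (continuous_const.add continuous_id)).measurable
  rw [Measure.map_apply hm hA]
  rfl

theorem IsSelfAffineMeasure.charFunDual_eq {ν : Measure (Ke β φ)}
    (hν : IsSelfAffineMeasure β φ ν) (L : StrongDual ℝ (Ke β φ)) :
    charFunDual ν L = 2⁻¹ * ∑ i : Fin 2,
      Complex.exp (L ((conjVec (expanding β φ))⁻¹ * ((i : ℕ) : Ke β φ)) * Complex.I) *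
        charFunDual ν (L.comp (ContinuousLinearMap.mul ℝ _ (conjVec (expanding β φ))⁻¹)) := by
  have := hν.1
  have hm : ∀ i : Fin 2, Measurable fun t : Ke β φ =>
      (conjVec (expanding β φ))⁻¹ * (((i : ℕ) : Ke β φ) + t) := fun i =>
    (continuous_const.mul (continuous_const.add continuous_id)).measurable
  have hcont : Continuous fun x : Ke β φ => Complex.exp (L x * Complex.I) := by fun_prop
  have hint : ∀ (μ : Measure (Ke β φ)) [IsFiniteMeasure μ],
      Integrable (fun x : Ke β φ => Complex.exp (L x * Complex.I)) μ := fun μ _ =>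
    Integrable.of_bound hcont.aestronglyMeasurable 1
      (Eventually.of_forall fun x => by rw [Complex.norm_exp_ofReal_mul_I])
  conv_lhs => rw [hν.eq_sum_map]
  rw [charFunDual_apply, integral_smul_measure, integral_finsetSum_measure]
  · rw [Complex.real_smul]
    congr 1
    · simp
    refine Finset.sum_congr rfl fun i _ => ?_
    rw [integral_map (hm i).aemeasurable hcont.aestronglyMeasurable, charFunDual_apply,
      ← integral_const_mul]
    refine integral_congr_ae (Eventually.of_forall fun t => ?_)
    simp only [mul_add, map_add, Complex.ofReal_add, add_mul, Complex.exp_add]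
    rfl
  · intro i _
    exact hint _

/-- Both characteristic functions satisfy the same refinement equation, whose trigonometric factor
is an average of unit complex numbers and so has modulus at most 1. -/
theorem IsSelfAffineMeasure.norm_charFunDual_sub_le {ν ν' : Measure (Ke β φ)}
    (hν : IsSelfAffineMeasure β φ ν) (hν' : IsSelfAffineMeasure β φ ν') (n : ℕ) :
    ∀ L : StrongDual ℝ (Ke β φ), ‖charFunDual ν L - charFunDual ν' L‖ ≤
      ‖charFunDual ν (L.comp (ContinuousLinearMap.mul ℝ _ ((conjVec (expanding β φ))⁻¹ ^ n))) -
        charFunDual ν' (L.comp (ContinuousLinearMap.mul ℝ _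
          ((conjVec (expanding β φ))⁻¹ ^ n)))‖ := by
  induction n with
  | zero =>
    intro L
    have : L.comp (ContinuousLinearMap.mul ℝ (Ke β φ) ((conjVec (expanding β φ))⁻¹ ^ 0)) = L := by
      ext <;> simp
    rw [this]
  | succ n ih =>
    intro L
    set c := (conjVec (expanding β φ))⁻¹
    refine (ih L).trans ?_
    set M := L.comp (ContinuousLinearMap.mul ℝ _ (c ^ n))
    have hM : M.comp (ContinuousLinearMap.mul ℝ _ c) =
        L.comp (ContinuousLinearMap.mul ℝ _ (c ^ (n + 1))) := by
      refine ContinuousLinearMap.ext fun x => ?_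
      change L (c ^ n * (c * x)) = L (c ^ (n + 1) * x)
      rw [pow_succ, mul_assoc]
    rw [hν.charFunDual_eq M, hν'.charFunDual_eq M, hM, ← mul_sub, ← Finset.sum_sub_distrib]
    simp only [← mul_sub]
    rw [← Finset.sum_mul, ← mul_assoc, norm_mul]
    refine mul_le_of_le_one_left (norm_nonneg _) ?_
    rw [norm_mul]
    have h1 : ‖∑ i : Fin 2, Complex.exp (M (c * ((i : ℕ) : Ke β φ)) * Complex.I)‖ ≤
        ∑ i : Fin 2, 1 :=
      norm_sum_le_of_le _ fun i _ => (Complex.norm_exp_ofReal_mul_I _).le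
    have h2 : ‖(2 : ℂ)⁻¹‖ = 2⁻¹ := by simp
    rw [h2]
    simp only [Finset.sum_const, Finset.card_univ, Fintype.card_fin, nsmul_eq_mul] at h1
    push_cast at h1
    linarith

theorem tendsto_charFunDual_one (ν : Measure (Ke β φ)) [IsProbabilityMeasure ν]
    (L : StrongDual ℝ (Ke β φ)) : Tendsto (fun n : ℕ => charFunDual ν
      (L.comp (ContinuousLinearMap.mul ℝ _ ((conjVec (expanding β φ))⁻¹ ^ n)))) atTop (𝓝 1) := by
  have h1 : (1 : ℂ) = ∫ _x : Ke β φ, (1 : ℂ) ∂ν := by simp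
  rw [h1]
  simp only [charFunDual_apply]
  refine tendsto_integral_of_dominated_convergence (fun _ => 1) (fun n => ?_)
    (integrable_const 1) (fun n => Eventually.of_forall fun x => ?_)
    (Eventually.of_forall fun x => ?_)
  · exact Continuous.aestronglyMeasurable (by fun_prop)
  · rw [Complex.norm_exp_ofReal_mul_I]
  · have h2 : Tendsto (fun n : ℕ => (conjVec (expanding β φ))⁻¹ ^ n * x) atTop (𝓝 0) := by
      refine squeeze_zero_norm (fun n => norm_inv_pow_mul_le n x) ?_
      simpa using (tendsto_pow_atTop_nhds_zero_of_lt_one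
        (norm_nonneg (conjVec (expanding β φ))⁻¹) norm_conjVec_expanding_inv_lt).mul_const ‖x‖
    have hcont : Continuous fun y : Ke β φ => Complex.exp (L y * Complex.I) := by fun_prop
    have h3 := (hcont.tendsto 0).comp h2
    rw [map_zero, Complex.ofReal_zero, zero_mul, Complex.exp_zero] at h3
    exact h3

/-- Refining n times moves the argument to L ∘ β⁻ⁿ, where both characteristic functions tend to 1 as
n grows. No assumption on the supports is needed. -/
theorem IsSelfAffineMeasure.unique {ν ν' : Measure (Ke β φ)} (hν : IsSelfAffineMeasure β φ ν)
    (hν' : IsSelfAffineMeasure β φ ν') : ν = ν' := by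
  have := hν.1
  have := hν'.1
  refine Measure.ext_of_charFunDual (funext fun L => ?_)
  have h1 := ((tendsto_charFunDual_one ν L).sub (tendsto_charFunDual_one ν' L)).norm
  rw [sub_self, norm_zero] at h1
  have h2 := ge_of_tendsto' h1 fun n => hν.norm_charFunDual_sub_le hν' n L
  exact sub_eq_zero.mp (norm_le_zero_iff.mp h2)

theorem Admissible.selfAffineMeasureIsAbsolutelyContinuous (h : Admissible β φ) {C : ℝ}
    (hC : ∀ n, (closePairs β φ n : ℝ) ≤ C * (4 / expandingProduct β φ) ^ n) :
    SelfAffineMeasureIsAbsolutelyContinuous β φ := by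
  refine ⟨_, isSelfAffineMeasure_map, fun ν' hν' => hν'.unique isSelfAffineMeasure_map, ?_⟩
  refine h.absolutelyContinuous isSelfAffineMeasure_map
    (R := ∑' k : ℕ, ‖(conjVec (expanding β φ))⁻¹‖ ^ (k + 1))
    (tsum_nonneg fun k => by positivity) ?_ hC
  rw [ae_map_iff continuous_randomSeries.aemeasurable
    (measurableSet_le measurable_norm measurable_const)]
  exact Eventually.of_forall norm_randomSeries_le

end Uniqueness

/-! ### A perturbed multiplicative recursion -/

/-- The lower bound on p turns the additive error K into a factor 1/(1 - eₙ) with eₙ geometrically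
small. Taking logarithms of p n / qⁿ then leaves the sum of log r and a convergent series. -/
theorem exists_le_mul_pow_of_recursion {p r : ℕ → ℝ} {q c K C : ℝ} (hq : 1 < q) (hc : 0 < c)
    (hK : 0 ≤ K) (hr : ∀ n, 0 < r n) (hlow : ∀ n, c * q ^ n ≤ p n)
    (hrec : ∀ n, p (n + 1) ≤ q * r n * p n + K)
    (hsum : ∀ M, ∑ n ∈ Finset.Icc 1 M, Real.log (r n) ≤ C) :
    ∃ C', ∀ n, p n ≤ C' * q ^ n := by
  have hq0 : 0 < q := one_pos.trans hq
  have hp : ∀ n, 0 < p n := fun n => (by positivity : 0 < c * q ^ n).trans_le (hlow n)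
  set e : ℕ → ℝ := fun n => K / c * q⁻¹ ^ (n + 1) with he
  have he0 : ∀ n, 0 ≤ e n := fun n => by positivity
  have hqi : q⁻¹ < 1 := inv_lt_one_of_one_lt₀ hq
  have hesum : Summable e :=
    ((summable_nat_add_iff 1).mpr (summable_geometric_of_lt_one (by positivity) hqi)).mul_left _
  -- Below 1/2 one has -log(1 - e) ≤ 2e. Starting at N ≥ 1 avoids r 0, which the hypothesis on the
  -- logarithms does not include.
  obtain ⟨N, hN1, hN⟩ : ∃ N, 1 ≤ N ∧ ∀ n, N ≤ n → e n ≤ 1 / 2 := by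
    obtain ⟨N, hN⟩ := eventually_atTop.mp
      (hesum.tendsto_atTop_zero.eventually (ge_mem_nhds (show (0 : ℝ) < 1 / 2 by norm_num)))
    exact ⟨max 1 N, le_max_left _ _, fun n hn => hN n ((le_max_right _ _).trans hn)⟩
  set d : ℕ → ℝ := fun n => p n / q ^ n
  have hd : ∀ n, 0 < d n := fun n => div_pos (hp n) (by positivity)
  have hstep : ∀ n, d (n + 1) * (1 - e n) ≤ r n * d n := by
    intro n
    have h1 : K ≤ p (n + 1) * e n := by
      calc K = c * q ^ (n + 1) * e n := by
            simp only [he, inv_pow]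
            field_simp
        _ ≤ _ := mul_le_mul_of_nonneg_right (hlow _) (he0 n)
    have h2 : d (n + 1) * (1 - e n) = p (n + 1) * (1 - e n) / q ^ (n + 1) := by
      simp only [d]; ring
    have h3 : r n * d n = q * r n * p n / q ^ (n + 1) := by
      simp only [d, pow_succ]; field_simp
    rw [h2, h3]
    exact div_le_div_of_nonneg_right (by linarith [hrec n]) (by positivity)
  have hlog : ∀ n, N ≤ n → Real.log (d (n + 1)) ≤ Real.log (d n) + Real.log (r n) + 2 * e n := by
    intro n hn
    have h1 : 0 < 1 - e n := by linarith [hN n hn]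
    have h2 := Real.log_le_log (mul_pos (hd _) h1) (hstep n)
    rw [Real.log_mul (hd _).ne' h1.ne', Real.log_mul (hr n).ne' (hd n).ne'] at h2
    have h3 : -(2 * e n) ≤ Real.log (1 - e n) := by
      have h4 := Real.one_sub_inv_le_log_of_pos h1
      have h5 : (1 - e n)⁻¹ ≤ 1 + 2 * e n := by
        rw [inv_le_iff_one_le_mul₀ h1]
        nlinarith [he0 n, hN n hn]
      linarith
    linarith
  set B := Real.log (d N) - ∑ k ∈ Finset.Icc 1 (N - 1), Real.log (r k)
  have hacc : ∀ n, N ≤ n → Real.log (d n) ≤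
      B + ∑ k ∈ Finset.Icc 1 (n - 1), Real.log (r k) + 2 * ∑ k ∈ Finset.range n, e k := by
    intro n hn
    induction n, hn using Nat.le_induction with
    | base =>
      have := Finset.sum_nonneg fun k (_ : k ∈ Finset.range N) => he0 k
      simp only [B]
      linarith
    | succ n hn ih =>
      have h1 : Finset.Icc 1 (n + 1 - 1) = insert n (Finset.Icc 1 (n - 1)) := by
        ext k
        simp only [Finset.mem_Icc, Finset.mem_insert]
        omega
      rw [h1, Finset.sum_insert (by simp; omega), Finset.sum_range_succ]
      linarith [hlog n hn]
  set C₁ := Real.exp (B + C + 2 * ∑' k, e k)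
  have hlarge : ∀ n, N ≤ n → d n ≤ C₁ := by
    intro n hn
    rw [← Real.log_le_iff_le_exp (hd n)]
    have := hesum.sum_le_tsum (Finset.range n) fun k _ => he0 k
    linarith [hacc n hn, hsum (n - 1)]
  refine ⟨C₁ + ∑ k ∈ Finset.range N, d k, fun n => ?_⟩
  rw [← div_le_iff₀ (by positivity)]
  have hs : 0 ≤ ∑ k ∈ Finset.range N, d k := Finset.sum_nonneg fun k _ => (hd k).le
  rcases le_or_gt N n with hn | hn
  · exact (hlarge n hn).trans (by linarith)
  · have h1 := Finset.single_le_sum (fun k _ => (hd k).le) (Finset.mem_range.mpr hn)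
    have h2 : 0 < C₁ := Real.exp_pos _
    exact h1.trans (by linarith)

/-! ### Masses of finite parts of the spectrum -/

section Criterion

variable {β φ : ℝ}

theorem one_le_radius_mul {z : ℂ} (hz : 1 < ‖z‖) : 1 ≤ radius z * (‖z‖ - 1) := by
  have h1 : 0 < ‖z‖ - 1 := by linarith
  rw [radius]
  split_ifs
  · rw [div_mul_cancel₀ _ h1.ne']
  · rw [div_mul_cancel₀ _ h1.ne']; norm_num

/-- The radius ρ of each factor of I satisfies ρ + 1 ≤ |z|ρ, so a backward step with digit
difference of modulus at most 1 stays in I. Thus restricting to the strip loses no terms of the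
recursion for μ. -/
theorem inv_mul_mem_region {y : Ke β φ} (hy : y ∈ region β φ) (i j : Fin 2) :
    (conjVec (expanding β φ))⁻¹ * (y - ((i : ℕ) : Ke β φ) + ((j : ℕ) : Ke β φ)) ∈ region β φ := by
  have hstep : ∀ (z : ℂ) (_ : z ∈ expanding β φ) (s t : ℝ), s ≤ radius z → t ≤ s + 1 →
      ‖z‖⁻¹ * t ≤ radius z := by
    intro z hz s t hs ht
    have h1 := one_lt_norm_of_mem_expanding hz
    rw [inv_mul_le_iff₀ (by linarith)]
    linarith [one_le_radius_mul h1]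
  refine ⟨fun z => ?_, fun z => ?_⟩
  · change |(z.1.re)⁻¹ * (y.1 z - ((i : ℕ) : ℝ) + ((j : ℕ) : ℝ))| ≤ radius z.1
    rw [abs_mul, abs_inv, re_norm_of_mem_realPart]
    refine hstep z.1 (Finset.mem_filter.mp z.2).1 _ _ (hy.1 z) ?_
    rw [sub_add]
    exact (abs_sub _ _).trans (add_le_add le_rfl (norm_digit_sub_le (A := ℝ) (by simp) i j))
  · change ‖(z.1)⁻¹ * (y.2 z - ((i : ℕ) : ℂ) + ((j : ℕ) : ℂ))‖ ≤ radius z.1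
    rw [norm_mul, norm_inv]
    refine hstep z.1 (Finset.mem_filter.mp z.2).1 _ _ (hy.2 z) ?_
    rw [sub_add]
    exact (norm_sub_le _ _).trans (add_le_add le_rfl (norm_digit_sub_le (A := ℂ) (by simp) i j))

/-- In this form g counts the digit pairs whose forward step stays in I, which is what arises when
the recursion for μ is read from x to its images. -/
theorem stepFun_eq_sum (x : Ke β φ) : stepFun β φ x = ∑ i : Fin 2, ∑ j : Fin 2,
    (region β φ).indicator (1 : Ke β φ → ℝ)
      (conjVec (expanding β φ) * x + ((i : ℕ) : Ke β φ) - ((j : ℕ) : Ke β φ)) := by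
  simp only [stepFun, affMap, Fin.sum_univ_two, Fin.isValue, Fin.val_zero, Fin.val_one,
    Nat.cast_zero, Nat.cast_one, Int.cast_one, Int.cast_neg, Int.cast_zero, add_zero, sub_zero,
    add_sub_cancel_right, ← sub_eq_add_neg]
  ring

theorem stepFun_nonneg (x : Ke β φ) : 0 ≤ stepFun β φ x := by
  rw [stepFun_eq_sum]
  exact Finset.sum_nonneg fun i _ => Finset.sum_nonneg fun j _ =>
    Set.indicator_nonneg (fun _ _ => zero_le_one) _

theorem stepFun_le (x : Ke β φ) : stepFun β φ x ≤ 4 := by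
  have h1 : ∀ y : Ke β φ, (region β φ).indicator (1 : Ke β φ → ℝ) y ≤ 1 := fun y => by
    rw [Set.indicator_apply]
    split_ifs
    exacts [le_rfl, zero_le_one]
  rw [stepFun]
  linarith [h1 (affMap β φ 1 x), h1 (affMap β φ (-1) x), h1 (affMap β φ 0 x)]

theorem neg_mem_region_iff {x : Ke β φ} : -x ∈ region β φ ↔ x ∈ region β φ :=
  ⟨fun hx => by simpa using neg_mem_region hx, neg_mem_region⟩

theorem stepFun_neg (x : Ke β φ) : stepFun β φ (-x) = stepFun β φ x := by
  have hind : ∀ y : Ke β φ, (region β φ).indicator (1 : Ke β φ → ℝ) (-y) =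
      (region β φ).indicator (1 : Ke β φ → ℝ) y := fun y => by
    simp only [Set.indicator_apply, neg_mem_region_iff, Pi.one_apply]
  rw [stepFun_eq_sum, stepFun_eq_sum, Finset.sum_comm]
  refine Finset.sum_congr rfl fun j _ => Finset.sum_congr rfl fun i _ => ?_
  rw [← hind]
  congr 1
  ring

theorem stepFun_zero_pos : 0 < stepFun β φ 0 := by
  have h1 : ∀ y : Ke β φ, 0 ≤ (region β φ).indicator (1 : Ke β φ → ℝ) y := fun y =>
    Set.indicator_nonneg (fun _ _ => zero_le_one) _
  have h2 : affMap β φ 0 0 = 0 := by simp [affMap]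
  rw [stepFun, h2, Set.indicator_of_mem zero_mem_region]
  have := h1 (affMap β φ 1 0)
  have := h1 (affMap β φ (-1) 0)
  simp only [Pi.one_apply]
  linarith

theorem measurable_stepFun : Measurable (stepFun β φ) := by
  have h1 : Measurable ((region β φ).indicator (1 : Ke β φ → ℝ)) :=
    measurable_one.indicator isCompact_region.measurableSet
  have h2 : ∀ i : ℤ, Measurable (affMap β φ i) := fun i =>
    ((continuous_const.mul continuous_id).add continuous_const).measurable
  exact ((h1.comp (h2 1)).add (h1.comp (h2 (-1)))).add ((h1.comp (h2 0)).const_mul 2)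

theorem neg_mem_spectrumSet {x : Kbar β φ} (hx : x ∈ spectrumSet β φ) : -x ∈ spectrumSet β φ := by
  obtain ⟨⟨n, hn⟩, hs⟩ := mem_spectrumSet_iff.mp hx
  exact mem_spectrumSet_iff.mpr ⟨⟨n, by rwa [diffCount_neg]⟩, neg_mem_region hs⟩

namespace Admissible

variable (h : Admissible β φ)

/-- The points of the spectrum with free coordinate at most `R` in absolute value. -/
noncomputable def slab (R : ℝ) : Finset (Kbar β φ) := (h.finite_spectrumSet R).toFinset

theorem mem_slab {R : ℝ} {x : Kbar β φ} :
    x ∈ h.slab R ↔ x ∈ spectrumSet β φ ∧ |x.2| ≤ R := by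
  rw [slab, Set.Finite.mem_toFinset]; rfl

/-- The sum of an even function over a symmetric part of the spectrum. -/
theorem sum_slab_add {R : ℝ} (hR : 0 ≤ R) (f : Kbar β φ → ℝ) (hf : ∀ x, f (-x) = f x) :
    ∑ x ∈ h.slab R, f x + f 0 = 2 * ∑ x ∈ (h.slab R).filter (fun x => 0 ≤ x.2), f x := by
  have h1 := Finset.sum_filter_add_sum_filter_not (h.slab R) (fun x => 0 ≤ x.2) f
  have h2 : ∑ x ∈ (h.slab R).filter (fun x => 0 ≤ x.2), f x =
      f 0 + ∑ x ∈ (h.slab R).filter (fun x => 0 < x.2), f x := by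
    have hins : (h.slab R).filter (fun x => 0 ≤ x.2) =
        insert 0 ((h.slab R).filter (fun x => 0 < x.2)) := by
      ext x
      simp only [Finset.mem_filter, Finset.mem_insert, h.mem_slab]
      constructor
      · rintro ⟨hx, h0⟩
        rcases h0.eq_or_lt with h0 | h0
        · exact Or.inl (h.eq_zero_of_free (h.mem_lattice_of_isDifference
            (mem_spectrumSet_iff.mp hx.1).1) h0.symm)
        · exact Or.inr ⟨hx, h0⟩
      · rintro (rfl | ⟨hx, h0⟩)
        · exact ⟨⟨zero_mem_spectrumSet, by simpa using hR⟩, le_rfl⟩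
        · exact ⟨hx, h0.le⟩
    rw [hins, Finset.sum_insert (by simp)]
  have h3 : ∑ x ∈ (h.slab R).filter (fun x => ¬ 0 ≤ x.2), f x =
      ∑ x ∈ (h.slab R).filter (fun x => 0 < x.2), f x := by
    refine Finset.sum_bij' (fun x _ => -x) (fun x _ => -x) ?_ ?_ ?_ ?_ ?_
    · intro x hx
      simp only [Finset.mem_filter, h.mem_slab, not_le] at hx ⊢
      exact ⟨⟨neg_mem_spectrumSet hx.1.1, by simpa using hx.1.2⟩, by simpa using hx.2⟩
    · intro x hx
      simp only [Finset.mem_filter, h.mem_slab, not_le] at hx ⊢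
      exact ⟨⟨neg_mem_spectrumSet hx.1.1, by simpa using hx.1.2⟩, by simpa using hx.2⟩
    · intro x _; simp
    · intro x _; simp
    · intro x _; exact (hf x).symm
  linarith

/-- The recursion for the limit measure, summed over a part of the spectrum. -/
theorem growthRate_mul_sum_slab_le {R : ℝ} :
    growthRate β φ * ∑ y ∈ h.slab (|φ| * R + 1), mass β φ y ≤
      ∑ x ∈ h.slab (R + 2), mass β φ x * stepFun β φ x.1.1 := by
  simp only [Finset.mul_sum, h.growthRate_mul_mass, stepFun_eq_sum]
  rw [Finset.sum_comm, Finset.sum_comm (s := h.slab (R + 2))]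
  refine Finset.sum_le_sum fun i _ => ?_
  rw [Finset.sum_comm, Finset.sum_comm (s := h.slab (R + 2))]
  refine Finset.sum_le_sum fun j _ => ?_
  set τ : Kbar β φ → Kbar β φ := fun y =>
    (betaBar β φ)⁻¹ * (y - ((i : ℕ) : Kbar β φ) + ((j : ℕ) : Kbar β φ)) with hτ
  set G : Kbar β φ → ℝ := fun x => mass β φ x * (region β φ).indicator (1 : Ke β φ → ℝ)
    (conjVec (expanding β φ) * x.1.1 + ((i : ℕ) : Ke β φ) - ((j : ℕ) : Ke β φ))
  have hback : ∀ y, betaBar β φ * τ y + ((i : ℕ) : Kbar β φ) - ((j : ℕ) : Kbar β φ) = y := by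
    intro y
    rw [hτ]
    linear_combination (y - ((i : ℕ) : Kbar β φ) + ((j : ℕ) : Kbar β φ)) * h.betaBar_mul_inv
  have hinj : Function.Injective τ := fun y y' hyy => by rw [← hback y, ← hback y', hyy]
  have hG : ∀ x, 0 ≤ G x := fun x =>
    mul_nonneg (h.mass_nonneg x) (Set.indicator_nonneg (fun _ _ => zero_le_one) _)
  change ∑ y ∈ h.slab (|φ| * R + 1), mass β φ (τ y) ≤ ∑ x ∈ h.slab (R + 2), G x
  -- A preimage of nonzero mass is a difference, hence belongs to the spectrum; the others can be
  -- dropped.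
  rw [← Finset.sum_filter_ne_zero]
  calc _ = ∑ y ∈ (h.slab (|φ| * R + 1)).filter (fun y => mass β φ (τ y) ≠ 0), G (τ y) := by
        refine Finset.sum_congr rfl fun y hy => ?_
        have hy' := h.mem_slab.mp (Finset.mem_filter.mp hy).1
        have hreg : conjVec (expanding β φ) * (τ y).1.1 + ((i : ℕ) : Ke β φ) -
            ((j : ℕ) : Ke β φ) = y.1.1 := congrArg (fun u : Kbar β φ => u.1.1) (hback y)
        have hyI : y.1.1 ∈ region β φ := (mem_spectrumSet_iff.mp hy'.1).2
        simp only [G]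
        rw [hreg, Set.indicator_of_mem hyI, Pi.one_apply, mul_one]
    _ = ∑ x ∈ ((h.slab (|φ| * R + 1)).filter (fun y => mass β φ (τ y) ≠ 0)).image τ, G x :=
        (Finset.sum_image fun _ _ _ _ hyy => hinj hyy).symm
    _ ≤ _ := by
        refine Finset.sum_le_sum_of_subset_of_nonneg ?_ fun x _ _ => hG x
        intro x hx
        obtain ⟨y, hy, rfl⟩ := Finset.mem_image.mp hx
        obtain ⟨hy1, hy2⟩ := Finset.mem_filter.mp hy
        have hy' := h.mem_slab.mp hy1
        refine h.mem_slab.mpr ⟨mem_spectrumSet_iff.mpr ⟨?_, ?_⟩, ?_⟩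
        · by_contra hd
          exact hy2 (h.mass_eq_zero hd)
        · exact inv_mul_mem_region (mem_spectrumSet_iff.mp hy'.1).2 i j
        -- The digit difference adds at most 1 to |φ|R + 1, and (|φ|R + 2)/|φ| ≤ R + 2.
        · change |φ⁻¹ * (y.2 - ((i : ℕ) : ℝ) + ((j : ℕ) : ℝ))| ≤ R + 2
          have hφ := h.one_lt_abs
          rw [abs_mul, abs_inv, inv_mul_le_iff₀ (by linarith), sub_add]
          have h1 := norm_digit_sub_le (A := ℝ) (by simp) i j
          rw [Real.norm_eq_abs] at h1
          have h2 := abs_sub y.2 (((i : ℕ) : ℝ) - ((j : ℕ) : ℝ))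
          have h3 := hy'.2
          nlinarith [h3]

/-- The number of points of the spectrum with free coordinate in an interval of given length is
bounded. -/
theorem exists_card_slab_le : ∃ K : ℕ, ∀ R : ℝ,
    ((h.slab (R + 2)).filter fun x => ¬ |x.2| ≤ R).card ≤ K := by
  obtain ⟨M, hM⟩ := (isCompact_region (β := β) (φ := φ)).isBounded.exists_norm_le
  set Rc := (1 - ‖conjVec (contracting β)‖)⁻¹
  set G := (h.finite_lattice_of_norm_le (max (max (M + M) (Rc + Rc)) 2)).toFinset
  have hcard : ∀ F : Finset (Kbar β φ), (∀ x ∈ F, x ∈ spectrumSet β φ) →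
      (∀ x ∈ F, ∀ y ∈ F, |x.2 - y.2| ≤ 2) → F.card ≤ G.card := by
    intro F hF hF2
    rcases F.eq_empty_or_nonempty with rfl | ⟨x₀, hx₀⟩
    · simp
    refine Finset.card_le_card_of_injOn (fun x => x - x₀) (fun x hx => ?_)
      fun _ _ _ _ hxy => sub_left_injective hxy
    have h1 := mem_spectrumSet_iff.mp (hF x hx)
    have h2 := mem_spectrumSet_iff.mp (hF x₀ hx₀)
    refine (Set.Finite.mem_toFinset _).mpr ⟨h.sub_mem (h.mem_lattice_of_isDifference h1.1)
      (h.mem_lattice_of_isDifference h2.1), max_le (max_le ?_ ?_) ?_⟩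
    · exact ((norm_sub_le _ _).trans (add_le_add (hM _ h1.2) (hM _ h2.2))).trans
        ((le_max_left _ _).trans (le_max_left _ _))
    · exact ((norm_sub_le _ _).trans (add_le_add h1.1.norm_contracting_le
        h2.1.norm_contracting_le)).trans ((le_max_right _ _).trans (le_max_left _ _))
    · exact (hF2 x hx x₀ hx₀).trans (le_max_right _ _)
  refine ⟨G.card + G.card, fun R => ?_⟩
  rw [← Finset.card_filter_add_card_filter_not (fun x : Kbar β φ => 0 ≤ x.2)]
  refine add_le_add (hcard _ ?_ ?_) (hcard _ ?_ ?_)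
  · intro x hx
    exact (h.mem_slab.mp (Finset.mem_filter.mp (Finset.mem_filter.mp hx).1).1).1
  · intro x hx y hy
    simp only [Finset.mem_filter, h.mem_slab, not_le] at hx hy
    rw [abs_of_nonneg hx.2] at hx
    rw [abs_of_nonneg hy.2] at hy
    rw [abs_le]
    constructor <;> linarith [hx.1.1.2, hx.1.2, hy.1.1.2, hy.1.2]
  · intro x hx
    exact (h.mem_slab.mp (Finset.mem_filter.mp (Finset.mem_filter.mp hx).1).1).1
  · intro x hx y hy
    simp only [Finset.mem_filter, h.mem_slab, not_le] at hx hy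
    rw [abs_of_neg hx.2] at hx
    rw [abs_of_neg hy.2] at hy
    rw [abs_le]
    constructor <;> linarith [hx.1.1.2, hx.1.2, hy.1.1.2, hy.1.2]

/-- The mass of the part of the spectrum with free coordinate in `[0, R]`. -/
noncomputable def halfMass (R : ℝ) : ℝ :=
  ∑ x ∈ (h.slab R).filter (fun x => 0 ≤ x.2), mass β φ x

/-- The integral of the step function over the part of the spectrum with free coordinate in
`[0, R]`. -/
noncomputable def halfStep (R : ℝ) : ℝ :=
  ∑ x ∈ (h.slab R).filter (fun x => 0 ≤ x.2), mass β φ x * stepFun β φ x.1.1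

/-- The layer between R and R + 2 has boundedly many points, each contributing at most 4μ(0).
Evenness of μ and g halves the slabs, the origin being the only point counted twice. -/
theorem exists_growthRate_mul_halfMass_le : ∃ K : ℝ, 0 ≤ K ∧ ∀ R, 0 ≤ R →
    growthRate β φ * h.halfMass (|φ| * R + 1) ≤ h.halfStep R + K := by
  obtain ⟨N, hN⟩ := h.exists_card_slab_le
  have hl := h.growthRate_pos
  have hm := h.mass_zero_pos
  refine ⟨2 * N * mass β φ 0 + growthRate β φ * mass β φ 0, by positivity, fun R hR => ?_⟩
  have hφ : 0 ≤ |φ| * R + 1 := by positivity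
  have h1 := h.growthRate_mul_sum_slab_le (R := R)
  have h2 := h.sum_slab_add hφ (mass β φ) mass_neg
  have h3 := h.sum_slab_add hR (fun x => mass β φ x * stepFun β φ x.1.1) (fun x => by
    rw [mass_neg, Prod.fst_neg, Prod.fst_neg, stepFun_neg])
  have h4 : ∑ x ∈ h.slab (R + 2), mass β φ x * stepFun β φ x.1.1 ≤
      ∑ x ∈ h.slab R, mass β φ x * stepFun β φ x.1.1 + 4 * N * mass β φ 0 := by
    rw [← Finset.sum_filter_add_sum_filter_not (h.slab (R + 2)) (fun x => |x.2| ≤ R)]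
    refine add_le_add (le_of_eq ?_) ?_
    · congr 1
      ext x
      simp only [Finset.mem_filter, h.mem_slab]
      exact ⟨fun hx => ⟨hx.1.1, hx.2⟩, fun hx => ⟨⟨hx.1, by linarith [hx.2]⟩, hx.2⟩⟩
    · calc _ ≤ ∑ x ∈ (h.slab (R + 2)).filter (fun x => ¬ |x.2| ≤ R), mass β φ 0 * 4 :=
            Finset.sum_le_sum fun x _ => mul_le_mul (h.mass_le_mass_zero x) (stepFun_le _)
              (stepFun_nonneg _) hm.le
        _ = (((h.slab (R + 2)).filter (fun x => ¬ |x.2| ≤ R)).card : ℝ) * (mass β φ 0 * 4) := by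
            rw [Finset.sum_const, nsmul_eq_mul]
        _ ≤ N * (mass β φ 0 * 4) := by
            gcongr
            exact hN R
        _ = _ := by ring
  have h5 : 0 ≤ mass β φ 0 * stepFun β φ (0 : Kbar β φ).1.1 :=
    mul_nonneg hm.le (stepFun_nonneg _)
  rw [halfMass, halfStep]
  nlinarith

/-- The difference of a close pair lies in the strip and has free coordinate at most ∑ |φ|ⁱ in
modulus. Grouping pairs by this difference and comparing counts with μ gives the bound; the factor 2
is the symmetry of the slab. -/
theorem closePairs_mul_le (n : ℕ) : (closePairs β φ n : ℝ) * mass β φ 0 ≤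
    2 * growthRate β φ ^ n * h.halfMass (∑ i ∈ Finset.range n, |φ| ^ i) := by
  set s := ∑ i ∈ Finset.range n, |φ| ^ i
  have hs : 0 ≤ s := Finset.sum_nonneg fun i _ => by positivity
  have hl := h.growthRate_pos
  have hcount : closePairs β φ n ≤ ∑ x ∈ h.slab s, diffCount (betaBar β φ) n x := by
    rw [closePairs, Finset.card_eq_sum_card_fiberwise (t := h.slab s)
      (f := fun p => wordSum (betaBar β φ) p.1 - wordSum (betaBar β φ) p.2)]
    · refine Finset.sum_le_sum fun x _ => Finset.card_le_card fun p hp => ?_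
      exact Finset.mem_filter.mpr ⟨Finset.mem_univ _, (Finset.mem_filter.mp hp).2⟩
    · intro p hp
      refine h.mem_slab.mpr ⟨mem_spectrumSet_iff.mpr
        ⟨⟨n, diffCount_ne_zero_iff.mpr ⟨p.1, p.2, rfl⟩⟩, ?_⟩, ?_⟩
      · change (wordSum (betaBar β φ) p.1 - wordSum (betaBar β φ) p.2).1.1 ∈ region β φ
        rw [Prod.fst_sub, Prod.fst_sub, wordSum_fst_fst, wordSum_fst_fst]
        exact (Finset.mem_filter.mp hp).2
      · change |(wordSum (betaBar β φ) p.1 - wordSum (betaBar β φ) p.2).2| ≤ s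
        rw [Prod.snd_sub, wordSum_snd, wordSum_snd, wordSum_sub_eq]
        refine (Finset.abs_sum_le_sum_abs _ _).trans ?_
        change _ ≤ ∑ i ∈ Finset.range n, |φ| ^ i
        rw [← Fin.sum_univ_eq_sum_range (fun i => |φ| ^ i) n]
        refine Finset.sum_le_sum fun i _ => ?_
        rw [abs_mul, abs_pow]
        exact mul_le_of_le_one_left (by positivity)
          (norm_digit_sub_le (A := ℝ) (by simp) _ _)
  have h2 := h.sum_slab_add hs (mass β φ) mass_neg
  calc (closePairs β φ n : ℝ) * mass β φ 0
      ≤ (∑ x ∈ h.slab s, (diffCount (betaBar β φ) n x : ℝ)) * mass β φ 0 := by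
        have := h.mass_zero_pos
        gcongr
        exact_mod_cast hcount
    _ = ∑ x ∈ h.slab s, diffCount (betaBar β φ) n x * mass β φ 0 := Finset.sum_mul _ _ _
    _ ≤ ∑ x ∈ h.slab s, growthRate β φ ^ n * mass β φ x :=
        Finset.sum_le_sum fun x _ => h.diffCount_mul_mass_le n x
    _ = growthRate β φ ^ n * ∑ x ∈ h.slab s, mass β φ x := (Finset.mul_sum _ _ _).symm
    _ ≤ growthRate β φ ^ n * (2 * h.halfMass s) := by
        gcongr
        rw [halfMass]
        linarith [h.mass_zero_pos]
    _ = _ := by ring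

theorem halfMass_pos {R : ℝ} (hR : 0 ≤ R) : 0 < h.halfMass R := by
  refine Finset.sum_pos (fun x hx => h.mass_pos
    (mem_spectrumSet_iff.mp (h.mem_slab.mp (Finset.mem_filter.mp hx).1).1).1) ⟨0, ?_⟩
  exact Finset.mem_filter.mpr ⟨h.mem_slab.mpr ⟨zero_mem_spectrumSet, by simpa using hR⟩, le_rfl⟩

theorem halfStep_pos {R : ℝ} (hR : 0 ≤ R) : 0 < h.halfStep R := by
  have h0 : (0 : Kbar β φ) ∈ (h.slab R).filter (fun x => 0 ≤ x.2) :=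
    Finset.mem_filter.mpr ⟨h.mem_slab.mpr ⟨zero_mem_spectrumSet, by simpa using hR⟩, le_rfl⟩
  refine lt_of_lt_of_le (mul_pos h.mass_zero_pos (stepFun_zero_pos (β := β) (φ := φ))) ?_
  exact Finset.single_le_sum (f := fun x : Kbar β φ => mass β φ x * stepFun β φ x.1.1)
    (fun x _ => mul_nonneg (h.mass_nonneg x) (stepFun_nonneg _)) h0

/-- The criterion for absolute continuity in terms of the masses of parts of the spectrum. -/
theorem absolutelyContinuous_of_sum_log_le (hlam : growthRate β φ < 4 / expandingProduct β φ)
    {C : ℝ} (hC : ∀ M, ∑ n ∈ Finset.Icc 1 M, Real.log (expandingProduct β φ / 4 *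
      (h.halfStep (∑ i ∈ Finset.range n, |φ| ^ i) /
        h.halfMass (∑ i ∈ Finset.range n, |φ| ^ i))) ≤ C) :
    SelfAffineMeasureIsAbsolutelyContinuous β φ := by
  set P := expandingProduct β φ
  have hP : 0 < P := expandingProduct_pos
  have hl := h.growthRate_pos
  have hm := h.mass_zero_pos
  set l := growthRate β φ
  set s : ℕ → ℝ := fun n => ∑ i ∈ Finset.range n, |φ| ^ i
  have hs : ∀ n, 0 ≤ s n := fun n => Finset.sum_nonneg fun i _ => by positivity
  -- The cutoffs are chosen so that one step of the recursion leads from one slab to the next.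
  have hs1 : ∀ n, s (n + 1) = |φ| * s n + 1 := fun n => by
    simp only [s]
    rw [Finset.sum_range_succ', Finset.mul_sum, pow_zero]
    simp only [pow_succ']
  set q := 4 / P / l
  have hq : 1 < q := (one_lt_div hl).mpr hlam
  obtain ⟨c, hc, hclow⟩ := h.exists_le_closePairs
  obtain ⟨K, hK, hrec⟩ := h.exists_growthRate_mul_halfMass_le
  have hql : (l * q) = 4 / P := mul_div_cancel₀ _ hl.ne'
  -- The lower bound required here comes from the universal lower bound for close pairs, divided by
  -- λⁿ.
  obtain ⟨C', hC'⟩ := exists_le_mul_pow_of_recursion (p := fun n => h.halfMass (s n))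
    (r := fun n => P / 4 * (h.halfStep (s n) / h.halfMass (s n))) (q := q)
    (c := c * mass β φ 0 / 2) (K := K / l) (C := C) hq (by positivity) (by positivity)
    (fun n => mul_pos (by positivity) (div_pos (h.halfStep_pos (hs n)) (h.halfMass_pos (hs n))))
    (fun n => by
      have h1 := h.closePairs_mul_le n
      have h2 := mul_le_mul_of_nonneg_right (hclow n) hm.le
      change _ ≤ 2 * l ^ n * h.halfMass (s n) at h1
      rw [← hql, mul_pow] at h2
      have h3 : l ^ n * (c * mass β φ 0 / 2 * q ^ n) ≤ l ^ n * h.halfMass (s n) := by linarith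
      exact le_of_mul_le_mul_left h3 (by positivity))
    (fun n => by
      have h1 := hrec (s n) (hs n)
      rw [← hs1] at h1
      have h2 := h.halfMass_pos (hs n)
      have h3 : q * (P / 4 * (h.halfStep (s n) / h.halfMass (s n))) * h.halfMass (s n) + K / l =
          (h.halfStep (s n) + K) / l := by
        simp only [q]
        field_simp
      change h.halfMass (s (n + 1)) ≤ _
      rw [h3, le_div_iff₀ hl, mul_comm]
      exact h1)
    hC
  refine h.selfAffineMeasureIsAbsolutelyContinuous (C := 2 * C' / mass β φ 0) fun n => ?_
  have h1 := h.closePairs_mul_le n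
  rw [div_mul_eq_mul_div, le_div_iff₀ hm]
  refine h1.trans ?_
  change 2 * l ^ n * h.halfMass (s n) ≤ 2 * C' * (4 / P) ^ n
  rw [← hql, mul_pow]
  calc 2 * l ^ n * h.halfMass (s n) ≤ 2 * l ^ n * (C' * q ^ n) := by
        gcongr
        exact hC' n
    _ = _ := by ring

end Admissible

end Criterion

/-! ### The orbit measures -/

section OrbitMeasure

variable {β φ : ℝ}

theorem orbitMeasure_real_univ {V : Type*} [MeasurableSpace V] [Zero V] (T : V → V) {f : V → ℝ}
    (hf : ∀ x, 0 ≤ f x) (m : ℕ) : (orbitMeasure T f m).real Set.univ =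
      ∑ k ∈ Finset.range (m + 1), ∏ i ∈ Finset.range k, f (T^[i] 0) := by
  have hnn : ∀ k, 0 ≤ ∏ i ∈ Finset.range k, f (T^[i] 0) := fun k =>
    Finset.prod_nonneg fun i _ => hf _
  rw [Measure.real, orbitMeasure, Measure.finsetSum_apply, ENNReal.toReal_sum]
  · refine Finset.sum_congr rfl fun k _ => ?_
    rw [Measure.smul_apply, measure_univ, smul_eq_mul, mul_one, ENNReal.toReal_ofReal (hnn k)]
  · intro k _
    rw [Measure.smul_apply, measure_univ, smul_eq_mul, mul_one]
    exact ENNReal.ofReal_ne_top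

theorem integral_map_orbitMeasure {V W : Type*} [MeasurableSpace V] [Zero V] [MeasurableSpace W]
    (T : V → V) {f : V → ℝ} (hf : ∀ x, 0 ≤ f x) (m : ℕ) {π : V → W} (hπ : Measurable π)
    {g : W → ℝ} (hg : Measurable g) : ∫ y, g y ∂((orbitMeasure T f m).map π) =
      ∑ k ∈ Finset.range (m + 1), (∏ i ∈ Finset.range k, f (T^[i] 0)) * g (π (T^[k] 0)) := by
  have hnn : ∀ k, 0 ≤ ∏ i ∈ Finset.range k, f (T^[i] 0) := fun k =>
    Finset.prod_nonneg fun i _ => hf _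
  have hgπ : StronglyMeasurable fun x => g (π x) := (hg.comp hπ).stronglyMeasurable
  rw [integral_map hπ.aemeasurable hg.stronglyMeasurable.aestronglyMeasurable, orbitMeasure,
    integral_finsetSum_measure]
  · refine Finset.sum_congr rfl fun k _ => ?_
    rw [integral_smul_measure, integral_dirac' _ _ hgπ, ENNReal.toReal_ofReal (hnn k),
      smul_eq_mul]
  · intro k _
    refine Integrable.smul_measure ?_ ENNReal.ofReal_ne_top
    exact integrable_dirac' hgπ (by simp)

theorem Admissible.sum_returnOrbit (h : Admissible β φ) (hc : CutAndProjectCondition β φ) {R : ℝ}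
    {m : ℕ} (hm : IsGreatest {k | (returnOrbit β φ k).2 ≤ R} m) (F : Kbar β φ → ℝ) :
    ∑ k ∈ Finset.range (m + 1), F (returnOrbit β φ k) =
      ∑ x ∈ (h.slab R).filter (fun x => 0 ≤ x.2), F x := by
  have hmono := h.strictMono_returnOrbit hc
  have himg : (h.slab R).filter (fun x => 0 ≤ x.2) =
      (Finset.range (m + 1)).image (returnOrbit β φ) := by
    ext x
    simp only [Finset.mem_filter, h.mem_slab, Finset.mem_image, Finset.mem_range]
    constructor
    · rintro ⟨⟨hx, hxR⟩, h0⟩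
      obtain ⟨k, rfl⟩ := h.exists_returnOrbit_eq hc hx h0
      rw [abs_of_nonneg h0] at hxR
      exact ⟨k, Nat.lt_succ_of_le (hm.2 hxR), rfl⟩
    · rintro ⟨k, hk, rfl⟩
      have h0 : (0 : ℝ) ≤ (returnOrbit β φ k).2 := hmono.monotone (Nat.zero_le k)
      refine ⟨⟨h.returnOrbit_mem hc k, ?_⟩, h0⟩
      rw [abs_of_nonneg h0]
      exact (hmono.monotone (Nat.lt_succ_iff.mp hk)).trans hm.1
  rw [himg, Finset.sum_image fun i _ j _ hij => hmono.injective (congrArg Prod.snd hij)]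

/-- The weights of the orbit measure are μ(orbit point)/μ(0), and the common factor cancels after
normalization. -/
theorem Admissible.averageRatio_orbitMeasure (h : Admissible β φ)
    (hc : CutAndProjectCondition β φ) {f : Ke β φ × Kc β → ℝ} (hf : ∀ x, 0 ≤ f x)
    (hprod : ∀ k, mass β φ (returnOrbit β φ k) =
      mass β φ 0 * ∏ i ∈ Finset.range k, f ((returnMap β φ)^[i] 0))
    {R : ℝ} {m : ℕ} (hm : IsGreatest {k | (returnOrbit β φ k).2 ≤ R} m) :
    averageRatio β φ (orbitMeasure (returnMap β φ) f m) =
      expandingProduct β φ / 4 * (h.halfStep R / h.halfMass R) := by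
  have hm0 := h.mass_zero_pos
  have hprod' : ∀ k, ∏ i ∈ Finset.range k, f ((returnMap β φ)^[i] 0) =
      mass β φ (returnOrbit β φ k) / mass β φ 0 := fun k => by
    rw [hprod k, mul_div_cancel_left₀ _ hm0.ne']
  have h1 : (orbitMeasure (returnMap β φ) f m).real Set.univ = h.halfMass R / mass β φ 0 := by
    rw [orbitMeasure_real_univ _ hf, halfMass, ← h.sum_returnOrbit hc hm, Finset.sum_div]
    simp only [hprod']
  have h2 : ∫ y, stepFun β φ y ∂((orbitMeasure (returnMap β φ) f m).map Prod.fst) =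
      h.halfStep R / mass β φ 0 := by
    rw [integral_map_orbitMeasure _ hf _ measurable_fst measurable_stepFun, halfStep,
      ← h.sum_returnOrbit hc hm (fun x => mass β φ x * stepFun β φ x.1.1), Finset.sum_div]
    refine Finset.sum_congr rfl fun k _ => ?_
    rw [hprod', returnOrbit_fst]
    ring
  rw [averageRatio, h1, h2, one_div_div, div_mul_div_comm, mul_comm (mass β φ 0),
    mul_div_mul_right _ _ (ne_of_gt hm0)]

/-- The logarithmic increment of the limit measure along the translation by `u`, as a function of
the contracting coordinate. -/
noncomputable def logIncrement (β φ : ℝ) (u : Kbar β φ) (y : Kc β) : ℝ :=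
  if hy : ∃ x ∈ spectrumSet β φ, x.1.2 = y then
    Real.log (limitMass β φ (hy.choose + u)) - Real.log (limitMass β φ hy.choose)
  else 0

/-- The chosen point is x itself, because a lattice point is determined by its contracting
coordinate. -/
theorem Admissible.logIncrement_eq (h : Admissible β φ) (u : Kbar β φ) {x : Kbar β φ}
    (hx : x ∈ spectrumSet β φ) : logIncrement β φ u x.1.2 =
      Real.log (limitMass β φ (x + u)) - Real.log (limitMass β φ x) := by
  have hy : ∃ x' ∈ spectrumSet β φ, x'.1.2 = x.1.2 := ⟨x, hx, rfl⟩
  have hmem : ∀ {z : Kbar β φ}, z ∈ spectrumSet β φ → z ∈ lattice β φ := fun hz =>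
    h.mem_lattice_of_isDifference (mem_spectrumSet_iff.mp hz).1
  have heq : hy.choose = x := by
    refine sub_eq_zero.mp (h.eq_zero_of_contracting
      (h.sub_mem (hmem hy.choose_spec.1) (hmem hx)) ?_)
    rw [Prod.fst_sub, Prod.snd_sub, hy.choose_spec.2, sub_self]
  rw [logIncrement, dif_pos hy, heq]

end OrbitMeasure

end BernoulliConv

/-! ### The main theorem -/

open BernoulliConv MeasureTheory Filter Topology in
theorem theorem5p6 (β φ : ℝ) (hβ1 : 1 < β) (hβ2 : β < 2) (hβ : IsHyperbolicInteger β)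
    (hφ : (φ : ℂ) ∈ conjugates β) (hφβ : φ ≠ β) (hφ1 : 1 < |φ|)
    (hs : (contracting β).Nonempty)
    (hlam : growthRate β φ < 4 / expandingProduct β φ)
    (hcond : CutAndProjectCondition β φ) :
    -- the growth rate and the limit measure are genuine limits
    (1 < growthRate β φ ∧ ∀ x ∈ spectrumSet β φ, 0 < limitMass β φ x ∧
      Tendsto (fun n : ℕ => (pairCount β φ n x : ℝ) / growthRate β φ ^ n) atTop
        (𝓝 (limitMass β φ x))) ∧
    ∃ (N : ℕ) (P : Fin N → Set (Ke β φ × Kc β)) (u : Fin N → Kbar β φ)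
      (T : Ke β φ × Kc β → Ke β φ × Kc β) (s : Ke β φ × Kc β → Fin N)
      (fbar : Fin N → Kc β → ℝ) (f : Ke β φ × Kc β → ℝ)
      (orb : ℕ → Kbar β φ) (m : ℕ → ℕ),
      -- the domain exchange transformation, given by the first return to `I × int 𝓡`
      IsDomainExchange (domain β φ) T P ∧
      (∀ i, ∀ x ∈ P i, T x = x + (u i).1) ∧
      (∀ i, ∀ x ∈ P i, x ∈ openDomain β φ → IsFirstReturn β φ x (u i)) ∧
      (∀ x ∈ domain β φ, x ∈ P (s x)) ∧
      -- the cocycle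
      (∀ i, ∀ x ∈ spectrumSet β φ, x.1 ∈ P i →
        fbar i x.1.2 = Real.log (limitMass β φ (x + u i)) - Real.log (limitMass β φ x)) ∧
      (∀ x ∈ domain β φ, f x = Real.exp (fbar (s x) x.2)) ∧
      -- the orbit of the origin under the successor map, and the times at which it is cut off
      (orb 0 = 0 ∧ (∀ k, IsSuccessor β φ (orb k) (orb (k + 1))) ∧ ∀ k, (orb k).1 = T^[k] 0) ∧
      (∀ k, limitMass β φ (orb k) = limitMass β φ 0 * ∏ i ∈ Finset.range k, f (T^[i] 0)) ∧
      (∀ n, IsGreatest {k | (orb k).2 ≤ ∑ i ∈ Finset.range n, |φ| ^ i} (m n)) ∧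
      -- the criterion
      ((∃ C : ℝ, 0 < C ∧ ∀ M : ℕ, ∑ n ∈ Finset.Icc 1 M,
          Real.log (averageRatio β φ (orbitMeasure T f (m n))) ≤ Real.log C) →
        SelfAffineMeasureIsAbsolutelyContinuous β φ) := by
  have h : Admissible β φ := ⟨hβ, hφ, hφ1, hs⟩
  have hstrip : ∀ {x : Kbar β φ}, x ∈ spectrumSet β φ → x ∈ strip β φ := fun hx =>
    (mem_spectrumSet_iff.mp hx).2
  have hpos : ∀ {x : Kbar β φ}, x ∈ spectrumSet β φ → 0 < limitMass β φ x := fun hx => by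
    rw [limitMass_eq_mass (hstrip hx)]
    exact h.mass_pos (mem_spectrumSet_iff.mp hx).1
  refine ⟨⟨one_lt_two.trans_le h.growthRate_spec.1, fun x hx => ⟨hpos hx, ?_⟩⟩, ?_⟩
  · rw [limitMass_eq_mass (hstrip hx)]
    simpa only [pairCount_eq_diffCount (hstrip hx)] using h.tendsto_mass x
  -- The pieces are the level sets of the return vector in D. Points of D outside I × int 𝓡 have
  -- return vector 0 and are fixed.
  set U := (h.finite_range_returnVec hcond).toFinset
  have hU : ∀ x, returnVec β φ x ∈ U := fun x =>
    (Set.Finite.mem_toFinset _).mpr ⟨x, rfl⟩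
  set e := U.equivFin
  set u : Fin U.card → Kbar β φ := fun i => (e.symm i).1
  set s : Ke β φ × Kc β → Fin U.card := fun x => e ⟨returnVec β φ x, hU x⟩
  have hus : ∀ x, u (s x) = returnVec β φ x := fun x => by simp [u, s]
  set P : Fin U.card → Set (Ke β φ × Kc β) := fun i =>
    {x | x ∈ domain β φ ∧ returnVec β φ x = u i}
  set f : Ke β φ × Kc β → ℝ := fun x => Real.exp (logIncrement β φ (u (s x)) x.2)
  have hsums : ∀ n : ℕ, 0 ≤ ∑ i ∈ Finset.range n, |φ| ^ i := fun n =>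
    Finset.sum_nonneg fun i _ => by positivity
  choose m hm using fun n : ℕ => h.exists_isGreatest_returnOrbit hcond (hsums n)
  have hprod : ∀ k, limitMass β φ (returnOrbit β φ k) =
      limitMass β φ 0 * ∏ i ∈ Finset.range k, f ((returnMap β φ)^[i] 0) := by
    intro k
    induction k with
    | zero => simp [returnOrbit]
    | succ k ih =>
      have hk := h.returnOrbit_mem hcond k
      have hfk : f ((returnMap β φ)^[k] 0) =
          limitMass β φ (returnOrbit β φ (k + 1)) / limitMass β φ (returnOrbit β φ k) := by
        rw [← returnOrbit_fst]
        simp only [f]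
        rw [h.logIncrement_eq _ hk, hus, Real.exp_sub, Real.exp_log (hpos hk)]
        change Real.exp (Real.log (limitMass β φ (returnOrbit β φ (k + 1)))) / _ = _
        rw [Real.exp_log (hpos (h.returnOrbit_mem hcond (k + 1)))]
      rw [Finset.prod_range_succ, ← mul_assoc, ← ih, hfk, mul_div_cancel₀ _ (hpos hk).ne']
  refine ⟨U.card, P, u, returnMap β φ, s, fun i => logIncrement β φ (u i), f, returnOrbit β φ, m,
    ⟨isCompact_domain, fun i => h.measurableSet_returnVec_eq hcond (u i), ?_, ?_,
      h.mapsTo_returnMap hcond, h.injOn_returnMap hcond, ?_⟩, ?_, ?_, ?_, ?_, ?_,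
    ⟨rfl, h.isSuccessor_returnOrbit hcond, returnOrbit_fst⟩, hprod, hm, ?_⟩
  · intro i j hij
    refine Set.disjoint_left.mpr fun x hxi hxj => hij ?_
    have h1 : u i = u j := hxi.2.symm.trans hxj.2
    exact e.symm.injective (Subtype.ext h1)
  · ext x
    simp only [Set.mem_iUnion]
    exact ⟨fun ⟨i, hi⟩ => hi.1, fun hx => ⟨s x, hx, (hus x).symm⟩⟩
  · exact fun i => ⟨(u i).1, fun x hx => by rw [returnMap, hx.2]⟩
  · exact fun i x hx => by rw [returnMap, hx.2]
  · intro i x hx hxo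
    rw [← hx.2]
    exact h.returnVec_spec hcond hxo
  · exact fun x hx => ⟨hx, (hus x).symm⟩
  · exact fun i x hx _ => h.logIncrement_eq (u i) hx
  · exact fun x _ => rfl
  · rintro ⟨C, -, hC⟩
    have hprod' : ∀ k, mass β φ (returnOrbit β φ k) =
        mass β φ 0 * ∏ i ∈ Finset.range k, f ((returnMap β φ)^[i] 0) := fun k => by
      rw [← limitMass_eq_mass (hstrip (h.returnOrbit_mem hcond k)),
        ← limitMass_eq_mass zero_mem_strip]
      exact hprod k
    refine h.absolutelyContinuous_of_sum_log_le hlam (C := Real.log C) fun M => ?_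
    refine le_trans (le_of_eq (Finset.sum_congr rfl fun n _ => ?_)) (hC M)
    rw [h.averageRatio_orbitMeasure hcond (fun x => (Real.exp_pos _).le) hprod' (hm n)]
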